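/- Let $(M,g)$ be a smooth Riemannian surface (without boundary), let $\mu$ be its area measure and $s$ its one-dimensional (arc length) measure. A compact smooth domain is a compact set $E\subset M$ (not necessarily connected) which near each point of $\partial E$ has the form $\{\rho\le 0\}$ for a smooth function $\rho$ with $d\rho\neq 0$. Let $0<\theta\le 1$ and $\kappa\in\mathbb{R}$, and assume that $(M,g)$ satisfies the $(\theta,\kappa)$-isoperimetric inequality, that is, $$4\pi\theta\,\mu(E)-\kappa\,\mu(E)^2\le s(\partial E)^2\quad\text{for every compact smooth domain } E\subset M.$$ Let $\Omega\subset M$ be a nonempty open set with compact closure, let $\lambda\in\mathbb{R}$, and let $u\in C^\infty(\overline{\Omega})$ and $f:\Omega\to\mathbb{R}$ be such that $$-\Delta_g u+\kappa=\lambda e^{2u}+f\ \text{ in }\Omega,\qquad u|_{\partial\Omega}=0,\qquad u<0\ \text{ in }\Omega,$$ where $\Delta_g$ is the Laplace–Beltrami operator, with $\Delta=\partial_1^2+\partial_2^2$ in the flat case. Put $\Theta=\frac{1}{2\pi}\int_\Omega f^-\,d\mu$, where $f^-=\max(-f,0)$. Then $$4\pi\theta\,\mu(\Omega)-\kappa\,\mu(\Omega)^2\le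 4\pi(\theta+\Theta)\int_\Omega e^{2u}\,d\mu-\lambda\Big(\int_\Omega e^{2u}\,d\mu\Big)^2 .$$ In particular, if $\Theta=0$ and $\lambda=\kappa>0$, then $$\int_\Omega e^{2u}\,d\mu+\mu(\Omega)\ge\frac{4\pi\theta}{\lambda}.$$ -/

import Mathlib

open MeasureTheory Bundle
open scoped Manifold ContDiff

noncomputable section

namespace RiemannianSurface

/-- The model plane of a surface. -/
abbrev Plane : Type := EuclideanSpace ℝ (Fin 2)

/-- The partial derivative `∂ᵢ F (y)` of a function on the plane. -/
def pderiv (i : Fin 2) (F : Plane → ℝ) (y : Plane) : ℝ :=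
  fderiv ℝ F y (EuclideanSpace.single i 1)

section Charts

variable {M : Type*} [TopologicalSpace M] [ChartedSpace Plane M]

/-- The coordinate vector field `∂ᵢ` of the chart `e`, at the point with coordinates `y`. -/
def coordVector (e : OpenPartialHomeomorph M Plane) (y : Plane) (i : Fin 2) :
    TangentSpace (𝓡 2) (e.symm y) :=
  mfderiv (𝓡 2) (𝓡 2) e.symm y (EuclideanSpace.single i (1 : ℝ) : Plane)

/-- Compact smooth domains: compact sets `D` which near each of their boundary points are
the sublevel set `{ρ ≤ 0}` of a smooth function `ρ` with nonvanishing differential. -/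
def IsCompactSmoothDomain (D : Set M) : Prop :=
  IsCompact D ∧ ∀ p ∈ frontier D, ∃ U : Set M, IsOpen U ∧ p ∈ U ∧
    ∃ ρ : M → ℝ, ContMDiffOn (𝓡 2) 𝓘(ℝ, ℝ) ∞ ρ U ∧
      (∀ q ∈ U, mfderiv (𝓡 2) 𝓘(ℝ, ℝ) ρ q ≠ 0) ∧ D ∩ U = {q ∈ U | ρ q ≤ 0}

variable [RiemannianBundle (fun x : M ↦ TangentSpace (𝓡 2) x)]

/-- The matrix `(gᵢⱼ)` of the metric in the chart `e`, at the point with coordinates `y`. -/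
def metricMatrix (e : OpenPartialHomeomorph M Plane) (y : Plane) : Matrix (Fin 2) (Fin 2) ℝ :=
  Matrix.of fun i j ↦ inner ℝ (coordVector e y i) (coordVector e y j)

/-- The area density `√(det (gᵢⱼ))` in the chart `e`. -/
def areaDensity (e : OpenPartialHomeomorph M Plane) (y : Plane) : ℝ :=
  √(metricMatrix e y).det

/-- The Laplace–Beltrami operator with the sign convention `Δ = ∂₁² + ∂₂²` in the flat plane:
`Δ_g u = (1 / √(det g)) ∑ᵢ ∂ᵢ (√(det g) ∑ⱼ gⁱʲ ∂ⱼ u)`, computed at `x` in the chart at `x`. -/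
def laplaceBeltrami (u : M → ℝ) (x : M) : ℝ :=
  let e := chartAt Plane x
  (areaDensity e (e x))⁻¹ *
    ∑ i, pderiv i (fun y ↦ areaDensity e y *
      ∑ j, (metricMatrix e y)⁻¹ i j * pderiv j (fun z ↦ u (e.symm z)) y) (e x)

/-- The measure `√(det g) dy¹ dy²` of the chart `e`, carried to the domain of `e` in `M`
and extended by zero outside of it. -/
def chartArea [MeasurableSpace M] (e : OpenPartialHomeomorph M Plane) : Measure M :=
  ((volume.restrict e.target).withDensity fun y ↦ ENNReal.ofReal (areaDensity e y)).map e.symm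

variable (M) in
/-- The Riemannian area measure `μ`. The measures `√(det g) dy¹ dy²` of any two charts agree on
the intersection of their domains, and `μ` is the measure which restricts to each of them; it is
therefore their supremum in the lattice of measures. -/
def area [MeasurableSpace M] : Measure M :=
  ⨆ x : M, chartArea (chartAt Plane x)

end Charts

/-- The `(θ, κ)`-isoperimetric inequality `4πθ μ(D) - κ μ(D)² ≤ s(∂D)²`. Here `s` is the
one-dimensional Hausdorff measure of the Riemannian distance (the arc length on curves). -/
def IsoperimetricInequality (M : Type*) [EMetricSpace M] [ChartedSpace Plane M]
    [RiemannianBundle (fun x : M ↦ TangentSpace (𝓡 2) x)]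
    [MeasurableSpace M] [BorelSpace M] (θ κ : ℝ) : Prop :=
  ∀ D : Set M, IsCompactSmoothDomain D →
    4 * Real.pi * θ * (area M).real D - κ * (area M).real D ^ 2 ≤
      (Measure.hausdorffMeasure 1 : Measure M).real (frontier D) ^ 2

end RiemannianSurface

end

/-
Write `β(t)` and `α(t)` for the areas of `{u ≤ t}` in the metrics `g` and `e²ᵘ g`, put `p = ∫ f⁻`,
and let `P(t) = ∫_{u ≤ t} Δu` be the flux of `∇u` through `{u = t}`. By Sard's theorem `{u ≤ t}` is
a compact smooth domain for almost every `t < 0`, so the isoperimetric inequality bounds its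
boundary length `ℓ` from below, while the coarea formula and the Cauchy–Schwarz inequality give
`ℓ² ≤ β' P`. The equation yields `P ≤ κ β - λ α + p`, and `α' = e²ᵗ β'`. Hence the function
`e²ᵗ (4πθ β - κ β²) - (4πθ + 2p) α + λ α²` has nonpositive derivative almost everywhere. As `β`
and `α` may jump, one also needs that its increments are at most `C (b - a)`; it is then
nonincreasing. It vanishes for `t` below the minimum of `u`, and letting `t → 0⁻` gives the theorem.
-/

namespace RiemannianSurface

open scoped NNReal ENNReal Topology

set_option maxSynthPendingDepth 3

section Sard

theorem outerMeasure_le_of_locally_le {X : Type*} [TopologicalSpace X] [SecondCountableTopology X]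
    [MeasurableSpace X] [OpensMeasurableSpace X] (m : OuterMeasure X) (ν : Measure X)
    {S : Set X} (hS : MeasurableSet S)
    (h : ∀ x ∈ S, ∃ U, IsOpen U ∧ x ∈ U ∧ ∀ A ⊆ U ∩ S, MeasurableSet A → m A ≤ ν A) :
    m S ≤ ν S := by
  rcases S.eq_empty_or_nonempty with rfl | hne
  · simp
  choose! U hUo hxU hU using h
  obtain ⟨t, htS, htc, hcov⟩ := TopologicalSpace.countable_cover_nhdsWithin
    (f := U) (s := S) fun x hx ↦ mem_nhdsWithin_of_mem_nhds ((hUo x hx).mem_nhds (hxU x hx))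
  have htne : t.Nonempty := by
    obtain ⟨x, hx⟩ := hne
    obtain ⟨y, hy, -⟩ := Set.mem_iUnion₂.1 (hcov hx)
    exact ⟨y, hy⟩
  obtain ⟨g, rfl⟩ := htc.exists_eq_range htne
  have hgS (n : ℕ) : g n ∈ S := htS ⟨n, rfl⟩
  let V (n : ℕ) : Set X := U (g n) ∩ S
  have hV (n : ℕ) : MeasurableSet (V n) := (hUo _ (hgS n)).measurableSet.inter hS
  have hSV : S = ⋃ n, disjointed V n := by
    rw [iUnion_disjointed]
    refine subset_antisymm (fun x hx ↦ ?_) (Set.iUnion_subset fun n ↦ Set.inter_subset_right)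
    obtain ⟨y, ⟨n, rfl⟩, hy⟩ := Set.mem_iUnion₂.1 (hcov hx)
    exact Set.mem_iUnion.2 ⟨n, hy, hx⟩
  calc m S = m (⋃ n, disjointed V n) := by rw [← hSV]
    _ ≤ ∑' n, m (disjointed V n) := measure_iUnion_le _
    _ ≤ ∑' n, ν (disjointed V n) := ENNReal.tsum_le_tsum fun n ↦
        hU _ (hgS n) _ (disjointed_subset V n) (MeasurableSet.disjointed hV n)
    _ = ν (⋃ n, disjointed V n) :=
        (measure_iUnion (disjoint_disjointed V) fun n ↦ MeasurableSet.disjointed hV n).symm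
    _ = ν S := by rw [← hSV]

variable {E : Type*} [NormedAddCommGroup E] [NormedSpace ℝ E] {v : E → ℝ} {A O : Set E}

theorem holderOnWith_two_of_fderiv_eq_zero {c : E} {r : ℝ} {K : ℝ≥0}
    (hv : ∀ y ∈ Metric.ball c r, DifferentiableAt ℝ v y)
    (hv' : ∀ y ∈ Metric.ball c r, DifferentiableAt ℝ (fderiv ℝ v) y)
    (hK : ∀ y ∈ Metric.ball c r, ‖fderiv ℝ (fderiv ℝ v) y‖ ≤ K)
    (hA : A ⊆ Metric.ball c r) (hA0 : ∀ y ∈ A, fderiv ℝ v y = 0) :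
    HolderOnWith K 2 v A := by
  intro x hx y hy
  have hfderiv (z : E) (hz : z ∈ Metric.ball c r) : ‖fderiv ℝ v z‖ ≤ K * dist z x := by
    have := (convex_ball c r).norm_image_sub_le_of_norm_fderiv_le hv' hK (hA hx) hz
    rwa [hA0 x hx, sub_zero, ← dist_eq_norm] at this
  have hdist : ‖v x - v y‖ ≤ K * dist x y * ‖x - y‖ := by
    refine Convex.norm_image_sub_le_of_norm_fderiv_le (𝕜 := ℝ)
      (s := Metric.ball c r ∩ Metric.closedBall x (dist x y)) (fun z hz ↦ hv z hz.1) (fun z hz ↦ ?_)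
      ((convex_ball c r).inter (convex_closedBall x _)) ⟨hA hy, ?_⟩ ⟨hA hx, by simp⟩
    · exact (hfderiv z hz.1).trans (mul_le_mul_of_nonneg_left hz.2 K.2)
    · rw [Metric.mem_closedBall, dist_comm]
  rw [← dist_eq_norm, ← dist_eq_norm, mul_assoc, ← sq] at hdist
  rw [edist_dist, edist_dist]
  refine (ENNReal.ofReal_le_ofReal hdist).trans_eq ?_
  rw [ENNReal.ofReal_mul K.coe_nonneg, ENNReal.ofReal_pow dist_nonneg]
  simp

theorem differentiableAt_fderiv_of_contDiffOn (hO : IsOpen O) (hv : ContDiffOn ℝ 2 v O) {y : E}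
    (hy : y ∈ O) : DifferentiableAt ℝ (fderiv ℝ v) y :=
  ((hv.fderiv_of_isOpen (m := 1) hO (by norm_num)).contDiffAt (hO.mem_nhds hy)).differentiableAt
    (by norm_num)

variable [MeasurableSpace E] [BorelSpace E]

theorem exists_isOpen_volume_image_le_hausdorffMeasure (hO : IsOpen O) (hv : ContDiffOn ℝ 2 v O)
    {y : E} (hy : y ∈ O) {K : ℝ≥0} (hK : ‖fderiv ℝ (fderiv ℝ v) y‖ < K) :
    ∃ U, IsOpen U ∧ y ∈ U ∧ ∀ A ⊆ U ∩ {z ∈ O | fderiv ℝ v z = 0},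
      volume (v '' A) ≤ K * Measure.hausdorffMeasure 2 A := by
  have hcont : ContinuousOn (fderiv ℝ (fderiv ℝ v)) O :=
    (hv.fderiv_of_isOpen (m := 1) hO (by norm_num)).continuousOn_fderiv_of_isOpen hO le_rfl
  have hnear : ∀ᶠ z in 𝓝 y, z ∈ O ∧ ‖fderiv ℝ (fderiv ℝ v) z‖ < K :=
    (hO.eventually_mem hy).and
      (((hcont.continuousAt (hO.mem_nhds hy)).norm).eventually (gt_mem_nhds hK))
  obtain ⟨r, hr, hball⟩ := Metric.eventually_nhds_iff_ball.1 hnear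
  refine ⟨Metric.ball y r, Metric.isOpen_ball, Metric.mem_ball_self hr, fun A hA ↦ ?_⟩
  have hholder : HolderOnWith K 2 v A := holderOnWith_two_of_fderiv_eq_zero
    (fun z hz ↦ (hv.contDiffAt (hO.mem_nhds (hball z hz).1)).differentiableAt (by norm_num))
    (fun z hz ↦ differentiableAt_fderiv_of_contDiffOn hO hv (hball z hz).1)
    (fun z hz ↦ (hball z hz).2.le) (fun z hz ↦ (hA hz).1) (fun z hz ↦ (hA hz).2.2)
  simpa [hausdorffMeasure_real] using
    hholder.hausdorffMeasure_image_le (by norm_num) zero_le_one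

variable [FiniteDimensional ℝ E]

theorem ae_fderivWithin_eq_zero_of_eq_zero (μ : Measure E) [μ.IsAddHaarMeasure] {g : E → E}
    {g' : E → E →L[ℝ] E} {C : Set E} (hC : MeasurableSet C)
    (hg : ∀ x ∈ C, HasFDerivWithinAt g (g' x) C x) (h0 : ∀ x ∈ C, g x = 0) :
    ∀ᵐ x ∂μ.restrict C, g' x = 0 := by
  have happ : ApproximatesLinearOn g (0 : E →L[ℝ] E) C 0 := fun x hx y hy ↦ by
    simp [h0 x hx, h0 y hy]
  filter_upwards [happ.norm_fderiv_sub_le μ hC g' hg] with x hx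
  simpa using hx

theorem addHaar_fderiv_fderiv_ne_zero (μ : Measure E) [μ.IsAddHaarMeasure] (hO : IsOpen O)
    (hv : ContDiffOn ℝ 2 v O) :
    μ {y | (y ∈ O ∧ fderiv ℝ v y = 0) ∧ fderiv ℝ (fderiv ℝ v) y ≠ 0} = 0 := by
  let L : (E →L[ℝ] ℝ) ≃L[ℝ] E := ContinuousLinearEquiv.ofFinrankEq <| by
    rw [← (LinearMap.toContinuousLinearMap (𝕜 := ℝ) (E := E) (F' := ℝ)).finrank_eq,
      Subspace.dual_finrank_eq]
  have hC : MeasurableSet {y ∈ O | fderiv ℝ v y = 0} :=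
    hO.measurableSet.inter (measurable_fderiv ℝ v (measurableSet_singleton 0))
  have hae := ae_fderivWithin_eq_zero_of_eq_zero μ hC (g := fun y ↦ L (fderiv ℝ v y))
    (g' := fun y ↦ (L : (E →L[ℝ] ℝ) →L[ℝ] E).comp (fderiv ℝ (fderiv ℝ v) y))
    (fun x hx ↦ (L.hasFDerivAt.comp x
      (differentiableAt_fderiv_of_contDiffOn hO hv hx.1).hasFDerivAt).hasFDerivWithinAt)
    fun x hx ↦ by rw [hx.2, map_zero]
  rw [ae_restrict_iff' hC] at hae
  refine measure_mono_null ?_ hae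
  rintro x ⟨hxC, hx⟩ hL
  refine hx ?_
  ext1 a
  exact L.map_eq_zero_iff.1 (congrArg (fun T ↦ T a) (hL hxC))

theorem volume_image_null_of_hausdorffMeasure_null (hO : IsOpen O) (hv : ContDiffOn ℝ 2 v O)
    (hA : MeasurableSet A) (hAO : A ⊆ {y ∈ O | fderiv ℝ v y = 0})
    (h0 : Measure.hausdorffMeasure 2 A = 0) : volume (v '' A) = 0 := by
  suffices OuterMeasure.comap v (volume : Measure ℝ).toOuterMeasure A ≤ (0 : Measure E) A by
    simpa using this
  refine outerMeasure_le_of_locally_le _ 0 hA fun y hy ↦ ?_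
  obtain ⟨U, hUo, hyU, hU⟩ := exists_isOpen_volume_image_le_hausdorffMeasure hO hv (hAO hy).1
    (K := ‖fderiv ℝ (fderiv ℝ v) y‖₊ + 1) (by simp)
  refine ⟨U, hUo, hyU, fun B hB _ ↦ ?_⟩
  have hle := hU B (hB.trans (Set.inter_subset_inter_right U hAO))
  rwa [measure_mono_null (hB.trans Set.inter_subset_right) h0, mul_zero] at hle

theorem volume_image_null_of_fderiv_fderiv_eq_zero
    [(Measure.hausdorffMeasure 2 : Measure E).IsAddHaarMeasure] (hO : IsOpen O)
    (hv : ContDiffOn ℝ 2 v O) (hA : MeasurableSet A) (hAO : A ⊆ {y ∈ O | fderiv ℝ v y = 0})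
    (hA2 : ∀ y ∈ A, fderiv ℝ (fderiv ℝ v) y = 0) : volume (v '' A) = 0 := by
  have hball (n : ℕ) : volume (v '' (A ∩ Metric.ball 0 n)) = 0 := by
    have hfin : (Measure.hausdorffMeasure 2 : Measure E) (Metric.ball 0 n) ≠ ⊤ :=
      measure_ball_lt_top.ne
    have hle (ε : ℝ≥0) (hε : 0 < ε) : volume (v '' (A ∩ Metric.ball 0 n)) ≤
        ε * (Measure.hausdorffMeasure 2 : Measure E) (Metric.ball 0 n) := by
      refine (outerMeasure_le_of_locally_le
        (OuterMeasure.comap v (volume : Measure ℝ).toOuterMeasure) (ε • Measure.hausdorffMeasure 2)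
        (hA.inter measurableSet_ball) fun y hy ↦ ?_).trans
        (mul_le_mul_right (measure_mono Set.inter_subset_right) _)
      obtain ⟨U, hUo, hyU, hU⟩ := exists_isOpen_volume_image_le_hausdorffMeasure hO hv
        (hAO hy.1).1 (K := ε) (by rw [hA2 y hy.1, norm_zero]; exact_mod_cast hε)
      exact ⟨U, hUo, hyU, fun B hB _ ↦ hU B fun z hz ↦ ⟨(hB hz).1, hAO (hB hz).2.1⟩⟩
    by_contra hne
    obtain ⟨ε, hε, hε'⟩ := ENNReal.exists_nnreal_pos_mul_lt hfin hne
    exact absurd (hle ε hε) (not_le.2 hε')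
  rw [← Set.inter_univ A, ← Metric.iUnion_ball_nat (0 : E), Set.inter_iUnion, Set.image_iUnion]
  exact measure_iUnion_null hball

/-- Sard's theorem: where the second derivative vanishes too, the Hölder constant can be taken
arbitrarily small, and the other critical points form a null set. -/
theorem volume_image_critical_eq_zero (hE : Module.finrank ℝ E = 2) (hO : IsOpen O)
    (hv : ContDiffOn ℝ 2 v O) : volume (v '' {y ∈ O | fderiv ℝ v y = 0}) = 0 := by
  have hHaar : (Measure.hausdorffMeasure 2 : Measure E).IsAddHaarMeasure := by
    simpa [hE] using isAddHaarMeasure_hausdorffMeasure (E := E)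
  set C : Set E := {y ∈ O | fderiv ℝ v y = 0}
  set N : Set E := {y | y ∈ C ∧ fderiv ℝ (fderiv ℝ v) y ≠ 0}
  have hC : MeasurableSet C :=
    hO.measurableSet.inter (measurable_fderiv ℝ v (measurableSet_singleton 0))
  have hN : MeasurableSet N :=
    hC.inter (measurable_fderiv ℝ (fderiv ℝ v) isClosed_singleton.measurableSet).compl
  have hNC : N ⊆ C := fun y hy ↦ hy.1
  rw [← Set.union_sdiff_cancel hNC, Set.image_union]
  exact measure_union_null
    (volume_image_null_of_hausdorffMeasure_null hO hv hN hNC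
      (addHaar_fderiv_fderiv_ne_zero _ hO hv))
    (volume_image_null_of_fderiv_fderiv_eq_zero hO hv (hC.diff hN) Set.sdiff_subset
      fun y hy ↦ not_not.1 fun hne ↦ hy.2 ⟨hy.1, hne⟩)

end Sard

section SmoothCharts

variable {M : Type*} [TopologicalSpace M] [ChartedSpace Plane M]

/-- A smooth chart of the surface. Unlike the members of the atlas, smooth charts may be
straightened along a given function. -/
structure IsSmoothChart (e : OpenPartialHomeomorph M Plane) : Prop where
  contMDiffOn : ContMDiffOn (𝓡 2) (𝓡 2) ∞ e e.source
  contMDiffOn_symm : ContMDiffOn (𝓡 2) (𝓡 2) ∞ e.symm e.target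

theorem isSmoothChart_chartAt [IsManifold (𝓡 2) ∞ M] (x : M) :
    IsSmoothChart (chartAt Plane x) :=
  ⟨contMDiffOn_chart, contMDiffOn_chart_symm⟩

variable {e e' : OpenPartialHomeomorph M Plane}

namespace IsSmoothChart

theorem trans (he : IsSmoothChart e) {ψ : OpenPartialHomeomorph Plane Plane}
    (h : ContDiffOn ℝ ∞ ψ ψ.source) (h' : ContDiffOn ℝ ∞ ψ.symm ψ.target) :
    IsSmoothChart (e.trans ψ) where
  contMDiffOn := h.contMDiffOn.comp (he.contMDiffOn.mono fun _ hx ↦ hx.1) fun _ hx ↦ hx.2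
  contMDiffOn_symm :=
    he.contMDiffOn_symm.comp (h'.contMDiffOn.mono fun _ hx ↦ hx.1) fun _ hx ↦ hx.2

theorem contDiffOn_comp_symm (he : IsSmoothChart e) {s : Set M} {u : M → ℝ}
    (hu : ContMDiffOn (𝓡 2) 𝓘(ℝ, ℝ) ∞ u s) :
    ContDiffOn ℝ ∞ (fun y ↦ u (e.symm y)) (e.target ∩ e.symm ⁻¹' s) :=
  (hu.comp (he.contMDiffOn_symm.mono Set.inter_subset_left) fun _ hy ↦ hy.2).contDiffOn

theorem contDiffOn_transition (he : IsSmoothChart e) (he' : IsSmoothChart e') :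
    ContDiffOn ℝ ∞ (fun y ↦ e' (e.symm y)) (e.target ∩ e.symm ⁻¹' e'.source) :=
  (he'.contMDiffOn.comp (he.contMDiffOn_symm.mono Set.inter_subset_left)
    (fun _ hy ↦ hy.2)).contDiffOn

theorem mdifferentiableAt_symm (he : IsSmoothChart e) {y : Plane} (hy : y ∈ e.target) :
    MDifferentiableAt (𝓡 2) (𝓡 2) e.symm y :=
  (he.contMDiffOn_symm.contMDiffAt (e.open_target.mem_nhds hy)).mdifferentiableAt (by simp)

theorem mdifferentiableAt (he : IsSmoothChart e) {x : M} (hx : x ∈ e.source) :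
    MDifferentiableAt (𝓡 2) (𝓡 2) e x :=
  (he.contMDiffOn.contMDiffAt (e.open_source.mem_nhds hx)).mdifferentiableAt (by simp)

end IsSmoothChart

theorem mdifferentiableAt_of_contMDiffOn {u : M → ℝ} {s : Set M} (hs : IsOpen s)
    (hu : ContMDiffOn (𝓡 2) 𝓘(ℝ, ℝ) ∞ u s) {x : M} (hx : x ∈ s) :
    MDifferentiableAt (𝓡 2) 𝓘(ℝ, ℝ) u x :=
  (hu.contMDiffAt (hs.mem_nhds hx)).mdifferentiableAt (by simp)

/-- The differential at `y` of the inverse of the chart `e`, as an endomorphism of the plane: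
the tangent space at `e.symm y` is definitionally the model plane. -/
noncomputable def symmDeriv (e : OpenPartialHomeomorph M Plane) (y : Plane) : Plane →L[ℝ] Plane :=
  mfderiv (𝓡 2) (𝓡 2) e.symm y

theorem IsSmoothChart.symmDeriv_injective (he : IsSmoothChart e) {y : Plane}
    (hy : y ∈ e.target) : Function.Injective (symmDeriv e y) := by
  have hid : e ∘ e.symm =ᶠ[𝓝 y] id := by
    filter_upwards [e.open_target.mem_nhds hy] with z hz using e.right_inv hz
  have hcomp : mfderiv (𝓡 2) (𝓡 2) (e ∘ e.symm) y = ContinuousLinearMap.id ℝ Plane :=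
    hid.mfderiv_eq.trans mfderiv_id
  rw [mfderiv_comp y (he.mdifferentiableAt (e.map_target hy)) (he.mdifferentiableAt_symm hy)]
    at hcomp
  exact Function.LeftInverse.injective (g := mfderiv (𝓡 2) (𝓡 2) e (e.symm y))
    fun v ↦ congrArg (fun T : Plane →L[ℝ] Plane ↦ T v) hcomp

theorem symmDeriv_eq_comp (he : IsSmoothChart e) (he' : IsSmoothChart e') {y : Plane}
    (hy : y ∈ e.target) (hy' : e.symm y ∈ e'.source) :
    symmDeriv e y = (symmDeriv e' (e' (e.symm y))).comp (fderiv ℝ (fun z ↦ e' (e.symm z)) y) := by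
  have heq : e.symm =ᶠ[𝓝 y] (e'.symm ∘ fun z ↦ e' (e.symm z)) := by
    filter_upwards [(e.isOpen_inter_preimage_symm e'.open_source).mem_nhds ⟨hy, hy'⟩] with z hz
    exact (e'.left_inv hz.2).symm
  have hd : MDifferentiableAt (𝓡 2) (𝓡 2) (fun z ↦ e' (e.symm z)) y :=
    (he'.mdifferentiableAt hy').comp y (he.mdifferentiableAt_symm hy)
  unfold symmDeriv
  rw [heq.mfderiv_eq, mfderiv_comp y (he'.mdifferentiableAt_symm (e'.map_source hy')) hd,
    mfderiv_eq_fderiv]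
  rfl

/-- The Jacobian matrix of a linear map of the plane. -/
noncomputable def jacobian (L : Plane →L[ℝ] Plane) : Matrix (Fin 2) (Fin 2) ℝ :=
  Matrix.of fun k i ↦ L (EuclideanSpace.single i 1) k

theorem det_jacobian (L : Plane →L[ℝ] Plane) : (jacobian L).det = L.det := by
  have h : jacobian L = LinearMap.toMatrix (EuclideanSpace.basisFun (Fin 2) ℝ).toBasis
      (EuclideanSpace.basisFun (Fin 2) ℝ).toBasis (L : Plane →ₗ[ℝ] Plane) := by
    ext k i
    simp [jacobian, LinearMap.toMatrix_apply]
  rw [h, LinearMap.det_toMatrix]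

theorem sum_smul_single {ι : Type*} [Fintype ι] [DecidableEq ι] (a : EuclideanSpace ℝ ι) :
    ∑ i, a i • EuclideanSpace.single i (1 : ℝ) = a := by
  simpa using (EuclideanSpace.basisFun ι ℝ).sum_repr a

variable [RiemannianBundle (fun x : M ↦ TangentSpace (𝓡 2) x)]

/-- The metric at `p`, as a bilinear form on the model plane, which is definitionally the tangent
space at `p`. -/
noncomputable def metricForm (p : M) : Plane →ₗ[ℝ] Plane →ₗ[ℝ] ℝ :=
  innerₗ (TangentSpace (𝓡 2) p)

theorem metricMatrix_apply (e : OpenPartialHomeomorph M Plane) (y : Plane) (i j : Fin 2) :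
    metricMatrix e y i j = metricForm (e.symm y) (symmDeriv e y (EuclideanSpace.single i 1))
      (symmDeriv e y (EuclideanSpace.single j 1)) := rfl

theorem metricForm_comm (p : M) (a b : Plane) : metricForm p a b = metricForm p b a :=
  real_inner_comm (F := TangentSpace (𝓡 2) p) b a

theorem metricForm_self_pos (p : M) {a : Plane} (ha : a ≠ 0) : 0 < metricForm p a a :=
  (real_inner_self_pos (F := TangentSpace (𝓡 2) p) (x := a)).2 ha

theorem metricForm_self_eq_norm_sq (p : M) (a : Plane) :
    metricForm p a a = ‖(show TangentSpace (𝓡 2) p from a)‖ ^ 2 :=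
  real_inner_self_eq_norm_sq (F := TangentSpace (𝓡 2) p) a

theorem metricForm_symmDeriv_apply (e : OpenPartialHomeomorph M Plane) (y a b : Plane) :
    metricForm (e.symm y) (symmDeriv e y a) (symmDeriv e y b) =
      ∑ k, ∑ l, a k * b l * metricMatrix e y k l := by
  conv_lhs => rw [← sum_smul_single a, ← sum_smul_single b]
  simp only [metricMatrix_apply, Fin.sum_univ_two, map_add, map_smul, LinearMap.add_apply,
    LinearMap.smul_apply, smul_eq_mul]
  ring

theorem metricMatrix_eq_transpose_mul_mul (he : IsSmoothChart e) (he' : IsSmoothChart e')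
    {y : Plane} (hy : y ∈ e.target) (hy' : e.symm y ∈ e'.source) :
    metricMatrix e y = (jacobian (fderiv ℝ (fun z ↦ e' (e.symm z)) y)).transpose *
      metricMatrix e' (e' (e.symm y)) * jacobian (fderiv ℝ (fun z ↦ e' (e.symm z)) y) := by
  ext i j
  rw [metricMatrix_apply, symmDeriv_eq_comp he he' hy hy', ← e'.left_inv hy', e'.right_inv
    (e'.map_source hy')]
  simp only [ContinuousLinearMap.comp_apply, metricForm_symmDeriv_apply]
  simp only [Matrix.mul_apply, Matrix.transpose_apply, jacobian, Matrix.of_apply,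
    Fin.sum_univ_two]
  ring

namespace IsSmoothChart

theorem metricMatrix_posDef (he : IsSmoothChart e) {y : Plane} (hy : y ∈ e.target) :
    (metricMatrix e y).PosDef := by
  refine Matrix.PosDef.of_dotProduct_mulVec_pos (Matrix.ext fun i j ↦ ?_) fun a ha ↦ ?_
  · exact metricForm_comm _ _ _
  · have hne : symmDeriv e y (WithLp.toLp 2 a) ≠ 0 := fun h ↦ ha <| by
      simpa using he.symmDeriv_injective hy (h.trans (map_zero _).symm)
    refine (metricForm_self_pos (e.symm y) hne).trans_eq ?_
    rw [metricForm_symmDeriv_apply]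
    simp only [dotProduct, Matrix.mulVec, Fin.sum_univ_two, star_trivial]
    ring

theorem metricMatrix_det_pos (he : IsSmoothChart e) {y : Plane} (hy : y ∈ e.target) :
    0 < (metricMatrix e y).det :=
  (he.metricMatrix_posDef hy).det_pos

theorem areaDensity_pos (he : IsSmoothChart e) {y : Plane} (hy : y ∈ e.target) :
    0 < areaDensity e y :=
  Real.sqrt_pos.2 (he.metricMatrix_det_pos hy)

end IsSmoothChart

theorem areaDensity_eq_abs_det_mul (he : IsSmoothChart e) (he' : IsSmoothChart e') {y : Plane}
    (hy : y ∈ e.target) (hy' : e.symm y ∈ e'.source) :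
    areaDensity e y =
      |(fderiv ℝ (fun z ↦ e' (e.symm z)) y).det| * areaDensity e' (e' (e.symm y)) := by
  rw [areaDensity, areaDensity, metricMatrix_eq_transpose_mul_mul he he' hy hy', Matrix.det_mul,
    Matrix.det_mul, Matrix.det_transpose, det_jacobian, ← Real.sqrt_sq_eq_abs,
    ← Real.sqrt_mul (sq_nonneg _)]
  congr 1
  ring

namespace IsSmoothChart

variable [IsManifold (𝓡 2) ∞ M]
  [IsContMDiffRiemannianBundle (𝓡 2) ∞ Plane (fun x : M ↦ TangentSpace (𝓡 2) x)]

theorem contDiffOn_metricMatrix (he : IsSmoothChart e) (i j : Fin 2) :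
    ContDiffOn ℝ ∞ (fun y ↦ metricMatrix e y i j) e.target := by
  have htangent := he.contMDiffOn_symm.contMDiffOn_tangentMapWithin (m := ∞) (by simp)
    e.open_target.uniqueMDiffOn
  have hcoord (k : Fin 2) : ContMDiffOn (𝓡 2) (𝓡 2).tangent ∞
      (fun y ↦ (⟨e.symm y, coordVector e y k⟩ : TangentBundle (𝓡 2) M)) e.target := by
    have hconst : ContMDiffOn (𝓡 2) (𝓡 2).tangent ∞
        (fun y : Plane ↦ (⟨y, EuclideanSpace.single k (1 : ℝ)⟩ : TangentBundle (𝓡 2) Plane))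
        e.target :=
      contMDiffOn_vectorSpace_iff_contDiffOn.2 contDiffOn_const
    refine (htangent.comp hconst fun y hy ↦ hy).congr fun y hy ↦ ?_
    simp only [Function.comp, tangentMapWithin, mfderivWithin_of_isOpen e.open_target hy]
    rfl
  exact (ContMDiffOn.inner_bundle (hcoord i) (hcoord j)).contDiffOn

theorem contDiffOn_det_metricMatrix (he : IsSmoothChart e) :
    ContDiffOn ℝ ∞ (fun y ↦ (metricMatrix e y).det) e.target := by
  simp only [Matrix.det_fin_two]
  exact ((he.contDiffOn_metricMatrix _ _).mul (he.contDiffOn_metricMatrix _ _)).sub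
    ((he.contDiffOn_metricMatrix _ _).mul (he.contDiffOn_metricMatrix _ _))

theorem contDiffOn_areaDensity (he : IsSmoothChart e) :
    ContDiffOn ℝ ∞ (areaDensity e) e.target :=
  he.contDiffOn_det_metricMatrix.sqrt fun _ hy ↦ (he.metricMatrix_det_pos hy).ne'

theorem contDiffOn_metricMatrix_inv (he : IsSmoothChart e) (i j : Fin 2) :
    ContDiffOn ℝ ∞ (fun y ↦ (metricMatrix e y)⁻¹ i j) e.target := by
  simp only [Matrix.inv_def, Matrix.smul_apply, Ring.inverse_eq_inv', smul_eq_mul]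
  refine (he.contDiffOn_det_metricMatrix.inv fun _ hy ↦ (he.metricMatrix_det_pos hy).ne').mul ?_
  simp only [Matrix.adjugate_fin_two]
  fin_cases i <;> fin_cases j <;>
    simp only [Matrix.of_apply, Matrix.cons_val', Matrix.cons_val_zero, Matrix.cons_val_one,
      Matrix.cons_val_fin_one, Fin.zero_eta, Fin.mk_one]
  exacts [he.contDiffOn_metricMatrix _ _, (he.contDiffOn_metricMatrix _ _).neg,
    (he.contDiffOn_metricMatrix _ _).neg, he.contDiffOn_metricMatrix _ _]

end IsSmoothChart

end SmoothCharts

section Area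

theorem chartArea_le_area {M : Type*} [TopologicalSpace M] [ChartedSpace Plane M]
    [RiemannianBundle (fun x : M ↦ TangentSpace (𝓡 2) x)] [MeasurableSpace M] (x : M) :
    chartArea (chartAt Plane x) ≤ area M :=
  le_iSup (fun x : M ↦ chartArea (chartAt Plane x)) x

theorem measurableSet_inter_preimage_of_continuousOn {X Y : Type*} [TopologicalSpace X]
    [MeasurableSpace X] [OpensMeasurableSpace X] [TopologicalSpace Y] [MeasurableSpace Y]
    [BorelSpace Y] {f : X → Y} {s : Set X} (hf : ContinuousOn f s) (hs : MeasurableSet s)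
    {A : Set Y} (hA : MeasurableSet A) : MeasurableSet (s ∩ f ⁻¹' A) := by
  have hpre : MeasurableSet (s.domRestrict f ⁻¹' A) :=
    (continuousOn_iff_continuous_domRestrict.1 hf).measurable hA
  convert hs.subtype_image hpre using 1
  ext x
  simp [Set.domRestrict, and_comm]

theorem aemeasurable_symm {X : Type*} [TopologicalSpace X] [MeasurableSpace X] [BorelSpace X]
    (e : OpenPartialHomeomorph X Plane) (ρ : Plane → ℝ≥0∞) :
    AEMeasurable e.symm ((volume.restrict e.target).withDensity ρ) :=
  (e.continuousOn_symm.aemeasurable e.open_target.measurableSet).mono_ac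
    (withDensity_absolutelyContinuous _ _)

variable {M : Type*} [TopologicalSpace M] [ChartedSpace Plane M] [IsManifold (𝓡 2) ∞ M]
  [RiemannianBundle (fun x : M ↦ TangentSpace (𝓡 2) x)]
  [IsContMDiffRiemannianBundle (𝓡 2) ∞ Plane (fun x : M ↦ TangentSpace (𝓡 2) x)]
  {e e' : OpenPartialHomeomorph M Plane}

theorem IsSmoothChart.aemeasurable_areaDensity (he : IsSmoothChart e) :
    AEMeasurable (fun y ↦ ENNReal.ofReal (areaDensity e y)) (volume.restrict e.target) :=
  (he.contDiffOn_areaDensity.continuousOn.aemeasurable e.open_target.measurableSet).ennreal_ofReal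

variable [MeasurableSpace M] [BorelSpace M]

theorem IsSmoothChart.lintegral_chartArea (he : IsSmoothChart e) {F : M → ℝ≥0∞}
    (hF : AEMeasurable F (chartArea e)) :
    ∫⁻ x, F x ∂chartArea e =
      ∫⁻ y in e.target, ENNReal.ofReal (areaDensity e y) * F (e.symm y) := by
  rw [chartArea, lintegral_map' hF (aemeasurable_symm e _),
    lintegral_withDensity_eq_lintegral_mul₀' he.aemeasurable_areaDensity
      (g := fun y ↦ F (e.symm y)) (hF.comp_aemeasurable (aemeasurable_symm e _))]
  rfl

theorem IsSmoothChart.integral_chartArea (he : IsSmoothChart e) {F : M → ℝ}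
    (hF : AEStronglyMeasurable F (chartArea e)) :
    ∫ x, F x ∂chartArea e = ∫ y in e.target, areaDensity e y * F (e.symm y) := by
  rw [chartArea, integral_map (aemeasurable_symm e _) hF,
    integral_withDensity_eq_integral_toReal_smul₀ he.aemeasurable_areaDensity (by simp)]
  refine setIntegral_congr_fun e.open_target.measurableSet fun y hy ↦ ?_
  simp [ENNReal.toReal_ofReal (he.areaDensity_pos hy).le]

theorem IsSmoothChart.chartArea_apply (he : IsSmoothChart e) {A : Set M} (hA : MeasurableSet A) :
    chartArea e A = ∫⁻ y in e.target ∩ e.symm ⁻¹' A, ENNReal.ofReal (areaDensity e y) := by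
  rw [← lintegral_indicator_one hA,
    he.lintegral_chartArea (measurable_one.indicator hA).aemeasurable,
    ← lintegral_indicator e.open_target.measurableSet,
    ← lintegral_indicator (measurableSet_inter_preimage_of_continuousOn e.continuousOn_symm
      e.open_target.measurableSet hA)]
  refine lintegral_congr fun y ↦ ?_
  by_cases hy : e.symm y ∈ A <;> by_cases hy' : y ∈ e.target <;> simp [hy, hy']

theorem chartArea_congr (he : IsSmoothChart e) (he' : IsSmoothChart e') {A : Set M}
    (hA : MeasurableSet A) (hAe : A ⊆ e.source) (hAe' : A ⊆ e'.source) :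
    chartArea e A = chartArea e' A := by
  rw [he.chartArea_apply hA, he'.chartArea_apply hA]
  set S := e.target ∩ e.symm ⁻¹' A
  have hSm : MeasurableSet S := measurableSet_inter_preimage_of_continuousOn e.continuousOn_symm
      e.open_target.measurableSet hA
  have himg : e'.target ∩ e'.symm ⁻¹' A = (fun y ↦ e' (e.symm y)) '' S := by
    ext z
    constructor
    · rintro ⟨hz, hzA⟩
      refine ⟨e (e'.symm z), ⟨e.map_source (hAe hzA), ?_⟩, ?_⟩
      · simpa [e.left_inv (hAe hzA)] using hzA
      · simp [e.left_inv (hAe hzA), e'.right_inv hz]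
    · rintro ⟨y, ⟨-, hyA⟩, rfl⟩
      refine ⟨e'.map_source (hAe' hyA), ?_⟩
      simpa [e'.left_inv (hAe' hyA)] using hyA
  have hinj : Set.InjOn (fun y ↦ e' (e.symm y)) S := fun y hy z hz hyz ↦
    e.symm.injOn hy.1 hz.1 (e'.injOn (hAe' hy.2) (hAe' hz.2) hyz)
  have hder : ∀ y ∈ S, HasFDerivWithinAt (fun y ↦ e' (e.symm y))
      (fderiv ℝ (fun z ↦ e' (e.symm z)) y) S y := fun y hy ↦
    (((he.contDiffOn_transition he').contDiffAt
      ((e.isOpen_inter_preimage_symm e'.open_source).mem_nhds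
        ⟨hy.1, hAe' hy.2⟩)).differentiableAt (by simp)).hasFDerivAt.hasFDerivWithinAt
  rw [himg, lintegral_image_eq_lintegral_abs_det_fderiv_mul volume hSm hder hinj]
  refine setLIntegral_congr_fun hSm fun y hy ↦ ?_
  rw [areaDensity_eq_abs_det_mul he he' hy.1 (hAe' hy.2), ENNReal.ofReal_mul (abs_nonneg _)]

theorem IsSmoothChart.chartArea_inter_source (he : IsSmoothChart e) {A : Set M}
    (hA : MeasurableSet A) : chartArea e (A ∩ e.source) = chartArea e A := by
  rw [he.chartArea_apply hA, he.chartArea_apply (hA.inter e.open_source.measurableSet)]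
  congr 2
  ext y
  constructor
  · exact fun h ↦ ⟨h.1, h.2.1⟩
  · exact fun h ↦ ⟨h.1, h.2, e.map_target h.1⟩

theorem IsSmoothChart.area_le_chartArea_add_restrict (he : IsSmoothChart e) :
    area M ≤ chartArea e + (area M).restrict e.sourceᶜ := by
  refine iSup_le fun x ↦ Measure.le_iff.2 fun B hB ↦ ?_
  have hx := isSmoothChart_chartAt (M := M) x
  have hBe : MeasurableSet (B ∩ e.source) := hB.inter e.open_source.measurableSet
  have hin : chartArea (chartAt Plane x) (B ∩ e.source) ≤ chartArea e B := by
    rw [← hx.chartArea_inter_source hBe,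
      chartArea_congr hx he (hBe.inter (chartAt Plane x).open_source.measurableSet)
        Set.inter_subset_right (Set.inter_subset_left.trans Set.inter_subset_right)]
    exact measure_mono (Set.inter_subset_left.trans Set.inter_subset_left)
  rw [Measure.add_apply, Measure.restrict_apply hB, ← Set.sdiff_eq,
    ← measure_inter_add_sdiff B e.open_source.measurableSet]
  exact add_le_add hin (chartArea_le_area x _)

variable [SecondCountableTopology M]

theorem IsSmoothChart.area_apply (he : IsSmoothChart e) {A : Set M} (hA : MeasurableSet A)
    (hAe : A ⊆ e.source) : area M A = chartArea e A := by
  apply le_antisymm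
  · calc area M A ≤ chartArea e A + (area M).restrict e.sourceᶜ A :=
          he.area_le_chartArea_add_restrict A
      _ = chartArea e A := by
          rw [Measure.restrict_apply hA, ← Set.sdiff_eq, Set.sdiff_eq_empty.2 hAe, measure_empty,
            add_zero]
  · refine outerMeasure_le_of_locally_le (chartArea e).toOuterMeasure (area M) hA fun x _ ↦
      ⟨(chartAt Plane x).source, (chartAt Plane x).open_source, mem_chart_source Plane x,
        fun B hB hBm ↦ ?_⟩
    exact (chartArea_congr he (isSmoothChart_chartAt x) hBm
      (hB.trans (Set.inter_subset_right.trans hAe)) (hB.trans Set.inter_subset_left)).trans_le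
      (chartArea_le_area x B)

theorem IsSmoothChart.restrict_area (he : IsSmoothChart e) :
    (area M).restrict e.source = chartArea e := by
  ext A hA
  rw [Measure.restrict_apply hA, he.area_apply (hA.inter e.open_source.measurableSet)
    Set.inter_subset_right, he.chartArea_inter_source hA]

theorem IsSmoothChart.restrict_area_of_subset (he : IsSmoothChart e) {A : Set M}
    (hA : MeasurableSet A) (hAe : A ⊆ e.source) :
    (area M).restrict A = (chartArea e).restrict A := by
  rw [← he.restrict_area, Measure.restrict_restrict hA, Set.inter_eq_left.2 hAe]

theorem IsSmoothChart.setIntegral_area (he : IsSmoothChart e) {A : Set M} (hA : MeasurableSet A)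
    (hAe : A ⊆ e.source) {F : M → ℝ} (hF : AEStronglyMeasurable F ((area M).restrict A)) :
    ∫ x in A, F x ∂area M =
      ∫ y in e.target ∩ e.symm ⁻¹' A, areaDensity e y * F (e.symm y) := by
  have hAm : MeasurableSet (e.target ∩ e.symm ⁻¹' A) :=
    measurableSet_inter_preimage_of_continuousOn e.continuousOn_symm e.open_target.measurableSet hA
  rw [he.restrict_area_of_subset hA hAe] at hF ⊢
  rw [← integral_indicator hA,
    he.integral_chartArea ((aestronglyMeasurable_indicator_iff hA).2 hF),
    ← integral_indicator e.open_target.measurableSet, ← integral_indicator hAm]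
  refine integral_congr_ae (.of_forall fun y ↦ ?_)
  by_cases hy : e.symm y ∈ A <;> by_cases hy' : y ∈ e.target <;> simp [hy, hy']

theorem IsSmoothChart.setLIntegral_area (he : IsSmoothChart e) {A : Set M} (hA : MeasurableSet A)
    (hAe : A ⊆ e.source) {F : M → ℝ≥0∞} (hF : AEMeasurable F ((area M).restrict A)) :
    ∫⁻ x in A, F x ∂area M =
      ∫⁻ y in e.target ∩ e.symm ⁻¹' A, ENNReal.ofReal (areaDensity e y) * F (e.symm y) := by
  have hAm : MeasurableSet (e.target ∩ e.symm ⁻¹' A) :=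
    measurableSet_inter_preimage_of_continuousOn e.continuousOn_symm e.open_target.measurableSet hA
  rw [he.restrict_area_of_subset hA hAe] at hF ⊢
  rw [← lintegral_indicator hA, he.lintegral_chartArea ((aemeasurable_indicator_iff hA).2 hF),
    ← lintegral_indicator e.open_target.measurableSet, ← lintegral_indicator hAm]
  refine lintegral_congr fun y ↦ ?_
  by_cases hy : e.symm y ∈ A <;> by_cases hy' : y ∈ e.target <;> simp [hy, hy']

instance isLocallyFiniteMeasure_area : IsLocallyFiniteMeasure (area M) := by
  refine ⟨fun x ↦ ?_⟩
  have he := isSmoothChart_chartAt (M := M) x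
  set e := chartAt Plane x
  have hx : x ∈ e.source := mem_chart_source Plane x
  obtain ⟨r, hr, hball⟩ := Metric.nhds_basis_closedBall.mem_iff.1
    (e.open_target.mem_nhds (e.map_source hx))
  have hopen : IsOpen (e.source ∩ e ⁻¹' Metric.ball (e x) r) :=
    e.isOpen_inter_preimage Metric.isOpen_ball
  refine ⟨e.source ∩ e ⁻¹' Metric.ball (e x) r,
    hopen.mem_nhds ⟨hx, Metric.mem_ball_self hr⟩, ?_⟩
  rw [he.area_apply hopen.measurableSet Set.inter_subset_left,
    he.chartArea_apply hopen.measurableSet]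
  have hsub : e.target ∩ e.symm ⁻¹' (e.source ∩ e ⁻¹' Metric.ball (e x) r) ⊆
      Metric.closedBall (e x) r := by
    rintro y ⟨hy, -, hy'⟩
    exact Metric.ball_subset_closedBall (e.right_inv hy ▸ hy')
  have hint : IntegrableOn (areaDensity e) (Metric.closedBall (e x) r) :=
    (he.contDiffOn_areaDensity.continuousOn.mono hball).integrableOn_compact
      (isCompact_closedBall _ _)
  exact (lintegral_mono_set hsub).trans_lt hint.lintegral_lt_top

instance isOpenPosMeasure_area : (area M).IsOpenPosMeasure := by
  refine ⟨fun U hU ⟨x, hx⟩ hzero ↦ ?_⟩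
  have he := isSmoothChart_chartAt (M := M) x
  set e := chartAt Plane x
  have hxe : x ∈ e.source := mem_chart_source Plane x
  have hO : IsOpen (U ∩ e.source) := hU.inter e.open_source
  have hopen := e.isOpen_inter_preimage_symm hO
  have hpos : 0 < volume (e.target ∩ e.symm ⁻¹' (U ∩ e.source)) :=
    hopen.measure_pos volume ⟨e x, e.map_source hxe, by simp [e.left_inv hxe, hx, hxe]⟩
  have hnull := measure_mono_null (Set.inter_subset_left (s := U) (t := e.source)) hzero
  rw [he.area_apply hO.measurableSet Set.inter_subset_right, he.chartArea_apply hO.measurableSet,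
    setLIntegral_eq_zero_iff' hopen.measurableSet
      (he.aemeasurable_areaDensity.mono_set Set.inter_subset_left)] at hnull
  refine hpos.ne' (measure_mono_null ?_ hnull)
  exact fun y hy h ↦ (he.areaDensity_pos hy.1).not_ge (ENNReal.ofReal_eq_zero.1 (h hy))

end Area

section Gradient

open Matrix

theorem fderiv_apply_eq_sum_pderiv (F : Plane → ℝ) (y a : Plane) :
    fderiv ℝ F y a = ∑ k, a k * pderiv k F y := by
  conv_lhs => rw [← sum_smul_single a]
  simp [pderiv]

theorem pderiv_congr {F G : Plane → ℝ} {y : Plane} (h : F =ᶠ[𝓝 y] G) (i : Fin 2) :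
    pderiv i F y = pderiv i G y := by
  rw [pderiv, pderiv, h.fderiv_eq]

theorem pderiv_comp {F : Plane → ℝ} {τ : Plane → Plane} {y : Plane}
    (hF : DifferentiableAt ℝ F (τ y)) (hτ : DifferentiableAt ℝ τ y) (i : Fin 2) :
    pderiv i (fun z ↦ F (τ z)) y = ∑ k, jacobian (fderiv ℝ τ y) k i * pderiv k F (τ y) := by
  have h := fderiv_comp y hF hτ
  change fderiv ℝ (F ∘ τ) y _ = _
  rw [h, ContinuousLinearMap.comp_apply, fderiv_apply_eq_sum_pderiv]
  rfl

theorem contDiffOn_pderiv {F : Plane → ℝ} {O : Set Plane} (hO : IsOpen O)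
    (hF : ContDiffOn ℝ ∞ F O) (i : Fin 2) : ContDiffOn ℝ ∞ (pderiv i F) O :=
  (hF.fderiv_of_isOpen hO (by simp)).clm_apply contDiffOn_const

variable {M : Type*} [TopologicalSpace M] [ChartedSpace Plane M]
  {e e' : OpenPartialHomeomorph M Plane}

theorem tendsto_symm_nhds {X : Type*} [TopologicalSpace X] {e : OpenPartialHomeomorph X Plane}
    {x : X} (hx : x ∈ e.source) :
    Filter.Tendsto e.symm (𝓝 (e x)) (𝓝 x) := by
  simpa only [ContinuousAt, e.left_inv hx] using e.continuousAt_symm (e.map_source hx)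

theorem IsSmoothChart.differentiableAt_comp_symm (he : IsSmoothChart e) {u : M → ℝ} {x : M}
    (hx : x ∈ e.source) (hu : MDifferentiableAt (𝓡 2) 𝓘(ℝ, ℝ) u x) :
    DifferentiableAt ℝ (fun z ↦ u (e.symm z)) (e x) := by
  have hsymm := he.mdifferentiableAt_symm (e.map_source hx)
  have hu' : MDifferentiableAt (𝓡 2) 𝓘(ℝ, ℝ) u (e.symm (e x)) := by rwa [e.left_inv hx]
  exact (hu'.comp (e x) hsymm).differentiableAt

theorem pderiv_comp_symm_eq_transpose_jacobian_mulVec (he : IsSmoothChart e)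
    (he' : IsSmoothChart e') {u : M → ℝ} {x : M} (hx : x ∈ e.source) (hx' : x ∈ e'.source)
    (hu : MDifferentiableAt (𝓡 2) 𝓘(ℝ, ℝ) u x) :
    (fun i ↦ pderiv i (fun z ↦ u (e.symm z)) (e x)) =
      (jacobian (fderiv ℝ (fun z ↦ e' (e.symm z)) (e x)))ᵀ *ᵥ
        fun i ↦ pderiv i (fun z ↦ u (e'.symm z)) (e' x) := by
  have hmem : e.target ∩ e.symm ⁻¹' e'.source ∈ 𝓝 (e x) :=
    (e.isOpen_inter_preimage_symm e'.open_source).mem_nhds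
      ⟨e.map_source hx, by simpa only [Set.mem_preimage, e.left_inv hx] using hx'⟩
  have hτ : DifferentiableAt ℝ (fun z ↦ e' (e.symm z)) (e x) :=
    ((he.contDiffOn_transition he').contDiffAt hmem).differentiableAt (by simp)
  have hτx : e' (e.symm (e x)) = e' x := by rw [e.left_inv hx]
  have hchange : (fun z ↦ u (e.symm z)) =ᶠ[𝓝 (e x)] fun z ↦ u (e'.symm (e' (e.symm z))) := by
    filter_upwards [hmem] with z hz
    rw [e'.left_inv hz.2]
  have hdiff := he'.differentiableAt_comp_symm hx' hu
  rw [← hτx] at hdiff ⊢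
  ext i
  rw [pderiv_congr hchange]
  exact pderiv_comp hdiff hτ i

variable [RiemannianBundle (fun x : M ↦ TangentSpace (𝓡 2) x)]

/-- The pairing `⟨∇u, ∇v⟩` computed in the chart `e`, at the point with coordinates `y`. -/
noncomputable def chartGradInner (e : OpenPartialHomeomorph M Plane) (u v : M → ℝ) (y : Plane) :
    ℝ :=
  ∑ i, ∑ j, (metricMatrix e y)⁻¹ i j * pderiv i (fun z ↦ u (e.symm z)) y *
    pderiv j (fun z ↦ v (e.symm z)) y

/-- The `i`-th component of `√(det g) ∇u` in the chart `e`. -/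
noncomputable def chartFlux (e : OpenPartialHomeomorph M Plane) (u : M → ℝ) (i : Fin 2)
    (y : Plane) : ℝ :=
  areaDensity e y * ∑ j, (metricMatrix e y)⁻¹ i j * pderiv j (fun z ↦ u (e.symm z)) y

/-- The Laplace–Beltrami operator computed in the chart `e`, at the point with coordinates `y`. -/
noncomputable def chartLaplacian (e : OpenPartialHomeomorph M Plane) (u : M → ℝ) (y : Plane) : ℝ :=
  (areaDensity e y)⁻¹ * ∑ i, pderiv i (chartFlux e u i) y

/-- The pairing `⟨∇u, ∇v⟩`. -/
noncomputable def gradInner (u v : M → ℝ) (x : M) : ℝ :=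
  chartGradInner (chartAt Plane x) u v (chartAt Plane x x)

theorem chartGradInner_eq_dotProduct (e : OpenPartialHomeomorph M Plane) (u v : M → ℝ) (y : Plane) :
    chartGradInner e u v y = (fun i ↦ pderiv i (fun z ↦ u (e.symm z)) y) ⬝ᵥ
      ((metricMatrix e y)⁻¹ *ᵥ fun i ↦ pderiv i (fun z ↦ v (e.symm z)) y) := by
  simp only [chartGradInner, dotProduct, mulVec, Fin.sum_univ_two]
  ring

theorem dotProduct_inv_mulVec_of_congruent {n R : Type*} [Fintype n] [DecidableEq n] [CommRing R]
    {J G : Matrix n n R} (hJ : IsUnit J.det)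
    (a b : n → R) :
    (Jᵀ *ᵥ a) ⬝ᵥ ((Jᵀ * G * J)⁻¹ *ᵥ (Jᵀ *ᵥ b)) = a ⬝ᵥ (G⁻¹ *ᵥ b) := by
  have hJt : IsUnit (Jᵀ).det := by rwa [det_transpose]
  rw [Matrix.mul_inv_rev, Matrix.mul_inv_rev, mulVec_mulVec, Matrix.mul_assoc,
    Matrix.mul_assoc, nonsing_inv_mul _ hJt,
    Matrix.mul_one, mulVec_transpose, ← dotProduct_mulVec, mulVec_mulVec, ← Matrix.mul_assoc,
    mul_nonsing_inv _ hJ, Matrix.one_mul]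

theorem chartGradInner_congr (he : IsSmoothChart e) (he' : IsSmoothChart e') {u v : M → ℝ} {x : M}
    (hx : x ∈ e.source) (hx' : x ∈ e'.source) (hu : MDifferentiableAt (𝓡 2) 𝓘(ℝ, ℝ) u x)
    (hv : MDifferentiableAt (𝓡 2) 𝓘(ℝ, ℝ) v x) :
    chartGradInner e u v (e x) = chartGradInner e' u v (e' x) := by
  have hG := metricMatrix_eq_transpose_mul_mul he he' (e.map_source hx)
    ((e.left_inv hx).symm ▸ hx')
  have hdet : IsUnit (jacobian (fderiv ℝ (fun z ↦ e' (e.symm z)) (e x))).det := by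
    have hne := (he.metricMatrix_det_pos (e.map_source hx)).ne'
    rw [hG, det_mul] at hne
    exact (right_ne_zero_of_mul hne).isUnit
  rw [chartGradInner_eq_dotProduct, chartGradInner_eq_dotProduct,
    pderiv_comp_symm_eq_transpose_jacobian_mulVec he he' hx hx' hu,
    pderiv_comp_symm_eq_transpose_jacobian_mulVec he he' hx hx' hv, hG,
    dotProduct_inv_mulVec_of_congruent hdet, e.left_inv hx]

theorem gradInner_eq_chartGradInner [IsManifold (𝓡 2) ∞ M] (he : IsSmoothChart e) {u v : M → ℝ}
    {x : M} (hx : x ∈ e.source) (hu : MDifferentiableAt (𝓡 2) 𝓘(ℝ, ℝ) u x)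
    (hv : MDifferentiableAt (𝓡 2) 𝓘(ℝ, ℝ) v x) :
    gradInner u v x = chartGradInner e u v (e x) :=
  chartGradInner_congr (isSmoothChart_chartAt x) he (mem_chart_source _ x) hx hu hv

section Pairing

variable {u Φ Ψ : M → ℝ}

theorem gradInner_congr {x : M} (h : Φ =ᶠ[𝓝 x] Ψ) (u : M → ℝ) :
    gradInner Φ u x = gradInner Ψ u x := by
  have hchart : (fun z ↦ Φ ((chartAt Plane x).symm z)) =ᶠ[𝓝 (chartAt Plane x x)]
      fun z ↦ Ψ ((chartAt Plane x).symm z) :=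
    (tendsto_symm_nhds (mem_chart_source _ x)).eventually h
  simp only [gradInner, chartGradInner, pderiv_congr hchart]

theorem gradInner_eq_zero_of_notMem_tsupport {x : M} (hx : x ∉ tsupport Φ) (u : M → ℝ) :
    gradInner Φ u x = 0 := by
  rw [gradInner_congr (notMem_tsupport_iff_eventuallyEq.1 hx)]
  simp [gradInner, chartGradInner, pderiv]

variable [IsManifold (𝓡 2) ∞ M]

theorem gradInner_self_nonneg (u : M → ℝ) (x : M) : 0 ≤ gradInner u u x := by
  rw [gradInner, chartGradInner_eq_dotProduct]
  have h := (((isSmoothChart_chartAt x).metricMatrix_posDef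
    (mem_chart_target Plane x)).inv.posSemidef).dotProduct_mulVec_nonneg
    (fun i ↦ pderiv i (fun z ↦ u ((chartAt Plane x).symm z)) (chartAt Plane x x))
  simpa using h

theorem gradInner_sum {ι : Type*} (F : Finset ι) {φ : ι → M → ℝ} {x : M}
    (hφ : ∀ k ∈ F, MDifferentiableAt (𝓡 2) 𝓘(ℝ, ℝ) (φ k) x) (u : M → ℝ) :
    gradInner (fun z ↦ ∑ k ∈ F, φ k z) u x = ∑ k ∈ F, gradInner (φ k) u x := by
  have h : ∀ i, pderiv i (fun z ↦ ∑ k ∈ F, φ k ((chartAt Plane x).symm z)) (chartAt Plane x x) =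
      ∑ k ∈ F, pderiv i (fun z ↦ φ k ((chartAt Plane x).symm z)) (chartAt Plane x x) := by
    intro i
    simp only [pderiv]
    rw [fderiv_fun_sum fun k hk ↦ (isSmoothChart_chartAt x).differentiableAt_comp_symm
      (mem_chart_source _ x) (hφ k hk), _root_.sum_apply]
  simp only [gradInner, chartGradInner, h, Finset.mul_sum, Finset.sum_mul, Fin.sum_univ_two,
    ← Finset.sum_add_distrib]

theorem gradInner_comp {T : ℝ → ℝ} {x : M} (hu : MDifferentiableAt (𝓡 2) 𝓘(ℝ, ℝ) u x)
    (hT : DifferentiableAt ℝ T (u x)) (v : M → ℝ) :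
    gradInner (fun z ↦ T (u z)) v x = deriv T (u x) * gradInner u v x := by
  have hxe := mem_chart_source Plane x
  have h : ∀ i, pderiv i (fun z ↦ T (u ((chartAt Plane x).symm z))) (chartAt Plane x x) =
      deriv T (u x) * pderiv i (fun z ↦ u ((chartAt Plane x).symm z)) (chartAt Plane x x) := by
    intro i
    have hu' := ((isSmoothChart_chartAt x).differentiableAt_comp_symm hxe hu).hasFDerivAt
    have hT' : HasDerivAt T (deriv T (u x)) (u ((chartAt Plane x).symm (chartAt Plane x x))) := by
      rw [(chartAt Plane x).left_inv hxe]; exact hT.hasDerivAt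
    have hcomp := HasDerivAt.comp_hasFDerivAt
      (f := fun z ↦ u ((chartAt Plane x).symm z)) (chartAt Plane x x) hT' hu'
    simp only [pderiv]
    rw [show (fun z ↦ T (u ((chartAt Plane x).symm z))) =
      T ∘ fun z ↦ u ((chartAt Plane x).symm z) from rfl, hcomp.fderiv]
    rfl
  simp only [gradInner, chartGradInner, h, Fin.sum_univ_two]
  ring

end Pairing

section Smooth

variable [IsManifold (𝓡 2) ∞ M]
  [IsContMDiffRiemannianBundle (𝓡 2) ∞ Plane (fun x : M ↦ TangentSpace (𝓡 2) x)]
  {u Φ : M → ℝ} {s : Set M}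

theorem IsSmoothChart.contDiffOn_chartFlux (he : IsSmoothChart e) {u : M → ℝ} {O : Set Plane}
    (hO : IsOpen O) (hOe : O ⊆ e.target) (hu : ContDiffOn ℝ ∞ (fun z ↦ u (e.symm z)) O)
    (i : Fin 2) : ContDiffOn ℝ ∞ (chartFlux e u i) O :=
  (he.contDiffOn_areaDensity.mono hOe).mul (ContDiffOn.sum fun j _ ↦
    ((he.contDiffOn_metricMatrix_inv i j).mono hOe).mul (contDiffOn_pderiv hO hu j))

theorem IsSmoothChart.contDiffOn_chartLaplacian (he : IsSmoothChart e) {u : M → ℝ}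
    {O : Set Plane} (hO : IsOpen O) (hOe : O ⊆ e.target)
    (hu : ContDiffOn ℝ ∞ (fun z ↦ u (e.symm z)) O) : ContDiffOn ℝ ∞ (chartLaplacian e u) O :=
  ((he.contDiffOn_areaDensity.mono hOe).inv fun _ hy ↦ (he.areaDensity_pos (hOe hy)).ne').mul
    (ContDiffOn.sum fun i _ ↦ contDiffOn_pderiv hO (he.contDiffOn_chartFlux hO hOe hu i) i)

theorem IsSmoothChart.contDiffOn_chartGradInner (he : IsSmoothChart e) {u v : M → ℝ}
    {O : Set Plane} (hO : IsOpen O) (hOe : O ⊆ e.target)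
    (hu : ContDiffOn ℝ ∞ (fun z ↦ u (e.symm z)) O) (hv : ContDiffOn ℝ ∞ (fun z ↦ v (e.symm z)) O) :
    ContDiffOn ℝ ∞ (chartGradInner e u v) O :=
  ContDiffOn.sum fun i _ ↦ ContDiffOn.sum fun j _ ↦
    (((he.contDiffOn_metricMatrix_inv i j).mono hOe).mul (contDiffOn_pderiv hO hu i)).mul
      (contDiffOn_pderiv hO hv j)

theorem IsSmoothChart.continuousOn_chartLaplacian (he : IsSmoothChart e) (hs : IsOpen s)
    (hu : ContMDiffOn (𝓡 2) 𝓘(ℝ, ℝ) ∞ u s) :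
    ContinuousOn (fun x ↦ chartLaplacian e u (e x)) (e.source ∩ s) := by
  refine (he.contDiffOn_chartLaplacian (e.isOpen_inter_preimage_symm hs) Set.inter_subset_left
    (he.contDiffOn_comp_symm hu)).continuousOn.comp
    (e.continuousOn.mono Set.inter_subset_left) fun x hx ↦ ⟨e.map_source hx.1, ?_⟩
  simpa [e.left_inv hx.1] using hx.2

theorem IsSmoothChart.continuousOn_chartGradInner (he : IsSmoothChart e) (hs : IsOpen s)
    (hΦ : ContMDiffOn (𝓡 2) 𝓘(ℝ, ℝ) ∞ Φ s) (hu : ContMDiffOn (𝓡 2) 𝓘(ℝ, ℝ) ∞ u s) :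
    ContinuousOn (fun x ↦ chartGradInner e Φ u (e x)) (e.source ∩ s) := by
  refine (he.contDiffOn_chartGradInner (e.isOpen_inter_preimage_symm hs) Set.inter_subset_left
    (he.contDiffOn_comp_symm hΦ) (he.contDiffOn_comp_symm hu)).continuousOn.comp
    (e.continuousOn.mono Set.inter_subset_left) fun x hx ↦ ⟨e.map_source hx.1, ?_⟩
  simpa [e.left_inv hx.1] using hx.2

theorem continuousOn_gradInner {v : M → ℝ} (hs : IsOpen s) (hu : ContMDiffOn (𝓡 2) 𝓘(ℝ, ℝ) ∞ u s)
    (hv : ContMDiffOn (𝓡 2) 𝓘(ℝ, ℝ) ∞ v s) : ContinuousOn (gradInner u v) s := by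
  intro x hx
  have he := isSmoothChart_chartAt (M := M) x
  have hxe := mem_chart_source Plane x
  have hn := ((chartAt Plane x).open_source.inter hs).mem_nhds ⟨hxe, hx⟩
  refine (((he.continuousOn_chartGradInner hs hu hv).continuousAt hn).congr ?_).continuousWithinAt
  filter_upwards [hn] with z hz
  exact (gradInner_eq_chartGradInner he hz.1 (mdifferentiableAt_of_contMDiffOn hs hu hz.2)
    (mdifferentiableAt_of_contMDiffOn hs hv hz.2)).symm

end Smooth

end Gradient

section GreenFormula

theorem integrable_mul_of_tsupport_subset {X : Type*} [TopologicalSpace X] [MeasurableSpace X]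
    [OpensMeasurableSpace X] {μ : Measure X} [IsFiniteMeasureOnCompacts μ] {a b : X → ℝ}
    {O : Set X} (hO : IsOpen O) (ha : Continuous a) (hc : HasCompactSupport a)
    (hsub : tsupport a ⊆ O) (hb : ContinuousOn b O) : Integrable (fun x ↦ a x * b x) μ :=
  ((ha.continuousOn.mul hb).continuous_of_tsupport_subset hO
    (tsupport_mul_subset_left.trans hsub)).integrable_of_hasCompactSupport hc.mul_right

theorem tsupport_pderiv_subset (φ : Plane → ℝ) (i : Fin 2) :
    tsupport (pderiv i φ) ⊆ tsupport φ :=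
  tsupport_fderiv_apply_subset ℝ _

theorem integrable_pderiv_mul {φ g : Plane → ℝ} {O : Set Plane} (hO : IsOpen O)
    (hφ : ContDiff ℝ ∞ φ) (hc : HasCompactSupport φ) (hsub : tsupport φ ⊆ O)
    (hg : ContinuousOn g O) (i : Fin 2) : Integrable (fun y ↦ pderiv i φ y * g y) :=
  integrable_mul_of_tsupport_subset hO
    ((hφ.continuous_fderiv (by simp)).clm_apply continuous_const)
    (hc.of_isClosed_subset (isClosed_tsupport _) (tsupport_pderiv_subset φ i))
    ((tsupport_pderiv_subset φ i).trans hsub) hg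

theorem setIntegral_mul_pderiv_eq_neg {φ g : Plane → ℝ} {O : Set Plane} (hO : IsOpen O)
    (hφ : ContDiff ℝ ∞ φ) (hc : HasCompactSupport φ) (hsub : tsupport φ ⊆ O)
    (hg : ContDiffOn ℝ ∞ g O) (i : Fin 2) :
    ∫ y in O, φ y * pderiv i g y = -∫ y in O, pderiv i φ y * g y := by
  have hsub' : tsupport (pderiv i φ) ⊆ O := (tsupport_pderiv_subset φ i).trans hsub
  rw [setIntegral_eq_integral_of_forall_compl_eq_zero fun y hy ↦ by
      rw [image_eq_zero_of_notMem_tsupport fun h ↦ hy (hsub h), zero_mul],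
    setIntegral_eq_integral_of_forall_compl_eq_zero fun y hy ↦ by
      rw [image_eq_zero_of_notMem_tsupport fun h ↦ hy (hsub' h), zero_mul]]
  exact integral_mul_fderiv_eq_neg_fderiv_mul_of_integrable
    (integrable_pderiv_mul hO hφ hc hsub hg.continuousOn i)
    (integrable_mul_of_tsupport_subset hO hφ.continuous hc hsub
      (contDiffOn_pderiv hO hg i).continuousOn)
    (integrable_mul_of_tsupport_subset hO hφ.continuous hc hsub hg.continuousOn)
    (fun y _ ↦ hφ.differentiable (by simp) y)
    fun y hy ↦ (hg.contDiffAt (hO.mem_nhds (hsub hy))).differentiableAt (by simp)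

section CoordExtend

variable {M : Type*} [TopologicalSpace M] {e : OpenPartialHomeomorph M Plane} {Φ : M → ℝ}

/-- The function `Φ` read in the chart `e` and extended by zero to the plane. -/
noncomputable def coordExtend (e : OpenPartialHomeomorph M Plane) (Φ : M → ℝ) : Plane → ℝ :=
  e.target.indicator fun y ↦ Φ (e.symm y)

theorem coordExtend_eventuallyEq {y : Plane} (hy : y ∈ e.target) :
    coordExtend e Φ =ᶠ[𝓝 y] fun z ↦ Φ (e.symm z) := by
  filter_upwards [e.open_target.mem_nhds hy] with z hz
  exact Set.indicator_of_mem hz _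

theorem isCompact_image_tsupport (hc : HasCompactSupport Φ) (hsub : tsupport Φ ⊆ e.source) :
    IsCompact (e '' tsupport Φ) :=
  hc.isCompact.image_of_continuousOn (e.continuousOn.mono hsub)

theorem tsupport_coordExtend_subset (hc : HasCompactSupport Φ) (hsub : tsupport Φ ⊆ e.source) :
    tsupport (coordExtend e Φ) ⊆ e '' tsupport Φ := by
  refine closure_minimal (fun y hy ↦ ?_) (isCompact_image_tsupport hc hsub).isClosed
  have hyt : y ∈ e.target := Set.mem_of_indicator_ne_zero hy
  refine ⟨e.symm y, subset_tsupport _ ?_, e.right_inv hyt⟩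
  simpa [coordExtend, hyt] using hy

theorem hasCompactSupport_coordExtend (hc : HasCompactSupport Φ)
    (hsub : tsupport Φ ⊆ e.source) : HasCompactSupport (coordExtend e Φ) :=
  (isCompact_image_tsupport hc hsub).of_isClosed_subset (isClosed_tsupport _)
    (tsupport_coordExtend_subset hc hsub)

theorem IsSmoothChart.contDiff_coordExtend [ChartedSpace Plane M] (he : IsSmoothChart e)
    (hΦ : ContMDiff (𝓡 2) 𝓘(ℝ, ℝ) ∞ Φ) (hc : HasCompactSupport Φ)
    (hsub : tsupport Φ ⊆ e.source) : ContDiff ℝ ∞ (coordExtend e Φ) := by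
  rw [← contMDiff_iff_contDiff]
  refine contMDiff_of_tsupport fun y hy ↦ ?_
  obtain ⟨x, hx, rfl⟩ := tsupport_coordExtend_subset hc hsub hy
  have hy := e.map_source (hsub hx)
  have hcoord : ContDiffAt ℝ ∞ (fun z ↦ Φ (e.symm z)) (e x) :=
    (he.contDiffOn_comp_symm (hΦ.contMDiffOn (s := Set.univ))).contDiffAt
      ((e.isOpen_inter_preimage_symm isOpen_univ).mem_nhds ⟨hy, trivial⟩)
  exact (hcoord.congr_of_eventuallyEq (coordExtend_eventuallyEq hy)).contMDiffAt

end CoordExtend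

variable {M : Type*} [TopologicalSpace M] [ChartedSpace Plane M] [IsManifold (𝓡 2) ∞ M]
  [RiemannianBundle (fun x : M ↦ TangentSpace (𝓡 2) x)]
  [IsContMDiffRiemannianBundle (𝓡 2) ∞ Plane (fun x : M ↦ TangentSpace (𝓡 2) x)]
  [MeasurableSpace M] [BorelSpace M] [SecondCountableTopology M]
  {e e' : OpenPartialHomeomorph M Plane} {u Φ : M → ℝ} {s : Set M}

theorem IsSmoothChart.setIntegral_mul_chartLaplacian (he : IsSmoothChart e) (hs : IsOpen s)
    (hse : s ⊆ e.source) (hu : ContMDiffOn (𝓡 2) 𝓘(ℝ, ℝ) ∞ u s)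
    (hΦ : ContMDiff (𝓡 2) 𝓘(ℝ, ℝ) ∞ Φ) (hc : HasCompactSupport Φ) (hsub : tsupport Φ ⊆ s) :
    ∫ x in s, Φ x * chartLaplacian e u (e x) ∂area M = -∫ x in s, gradInner Φ u x ∂area M := by
  set O := e.target ∩ e.symm ⁻¹' s
  have hO : IsOpen O := e.isOpen_inter_preimage_symm hs
  have hsub' := hsub.trans hse
  have hφ := he.contDiff_coordExtend hΦ hc hsub'
  have hφc := hasCompactSupport_coordExtend hc hsub'
  have hφO : tsupport (coordExtend e Φ) ⊆ O := by
    refine (tsupport_coordExtend_subset hc hsub').trans ?_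
    rintro _ ⟨x, hx, rfl⟩
    exact ⟨e.map_source (hsub' hx), by simpa [e.left_inv (hsub' hx)] using hsub hx⟩
  have hflux (i : Fin 2) : ContDiffOn ℝ ∞ (chartFlux e u i) O :=
    he.contDiffOn_chartFlux hO Set.inter_subset_left (he.contDiffOn_comp_symm hu) i
  have hlap : ContinuousOn (fun x ↦ chartLaplacian e u (e x)) s :=
    (he.continuousOn_chartLaplacian hs hu).mono fun x hx ↦ ⟨hse hx, hx⟩
  rw [he.setIntegral_area (F := fun x ↦ Φ x * chartLaplacian e u (e x)) hs.measurableSet hse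
      ((hΦ.continuous.continuousOn.mul hlap).aestronglyMeasurable hs.measurableSet),
    he.setIntegral_area hs.measurableSet hse
      ((continuousOn_gradInner hs hΦ.contMDiffOn hu).aestronglyMeasurable hs.measurableSet)]
  calc ∫ y in O, areaDensity e y * (Φ (e.symm y) * chartLaplacian e u (e (e.symm y)))
      = ∫ y in O, ∑ i, coordExtend e Φ y * pderiv i (chartFlux e u i) y := by
        refine setIntegral_congr_fun hO.measurableSet fun y hy ↦ ?_
        have hρ := (he.areaDensity_pos hy.1).ne'
        simp only [(coordExtend_eventuallyEq hy.1).eq_of_nhds, e.right_inv hy.1, chartLaplacian,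
          ← Finset.mul_sum]
        field_simp
    _ = -∫ y in O, ∑ i, pderiv i (coordExtend e Φ) y * chartFlux e u i y := by
        rw [integral_finsetSum _ fun i _ ↦ (integrable_mul_of_tsupport_subset hO hφ.continuous hφc
            hφO (contDiffOn_pderiv hO (hflux i) i).continuousOn).integrableOn,
          integral_finsetSum _ fun i _ ↦
            (integrable_pderiv_mul hO hφ hφc hφO (hflux i).continuousOn i).integrableOn,
          ← Finset.sum_neg_distrib]
        exact Finset.sum_congr rfl fun i _ ↦
          setIntegral_mul_pderiv_eq_neg hO hφ hφc hφO (hflux i) i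
    _ = -∫ y in O, areaDensity e y * gradInner Φ u (e.symm y) := by
        rw [setIntegral_congr_fun hO.measurableSet fun y hy ↦ ?_]
        rw [gradInner_eq_chartGradInner he (e.map_target hy.1)
          (mdifferentiableAt_of_contMDiffOn isOpen_univ hΦ.contMDiffOn trivial)
          (mdifferentiableAt_of_contMDiffOn hs hu hy.2), e.right_inv hy.1]
        simp only [chartGradInner, chartFlux, pderiv_congr (coordExtend_eventuallyEq hy.1),
          Fin.sum_univ_two]
        ring

variable [T2Space M]

/-- By Green's formula, the Laplacians computed in two charts have the same integral against every
test function. -/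
theorem chartLaplacian_congr (he : IsSmoothChart e) (he' : IsSmoothChart e') (hs : IsOpen s)
    (hu : ContMDiffOn (𝓡 2) 𝓘(ℝ, ℝ) ∞ u s) {x : M} (hx : x ∈ e.source) (hx' : x ∈ e'.source)
    (hxs : x ∈ s) : chartLaplacian e u (e x) = chartLaplacian e' u (e' x) := by
  have : LocallyCompactSpace M := ChartedSpace.locallyCompactSpace Plane M
  set U := (e.source ∩ e'.source) ∩ s
  have hU : IsOpen U := (e.open_source.inter e'.open_source).inter hs
  have hUe : U ⊆ e.source := fun z hz ↦ hz.1.1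
  have hUe' : U ⊆ e'.source := fun z hz ↦ hz.1.2
  have huU : ContMDiffOn (𝓡 2) 𝓘(ℝ, ℝ) ∞ u U := hu.mono Set.inter_subset_right
  have hcont {e₁ : OpenPartialHomeomorph M Plane} (he₁ : IsSmoothChart e₁) (h : U ⊆ e₁.source) :
      ContinuousOn (fun x ↦ chartLaplacian e₁ u (e₁ x)) U :=
    (he₁.continuousOn_chartLaplacian hU huU).mono fun z hz ↦ ⟨h hz, hz⟩
  have hae : ∀ᵐ z ∂area M, z ∈ U →
      chartLaplacian e u (e z) - chartLaplacian e' u (e' z) = 0 := by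
    refine hU.ae_eq_zero_of_integral_contMDiff_smul_eq_zero (𝓡 2)
      (((hcont he hUe).sub (hcont he' hUe')).locallyIntegrableOn hU.measurableSet)
      fun Φ hΦ hc hsub ↦ ?_
    simp only [smul_eq_mul, mul_sub]
    rw [← setIntegral_eq_integral_of_forall_compl_eq_zero (s := U) fun z hz ↦ by
        rw [image_eq_zero_of_notMem_tsupport fun h ↦ hz (hsub h), zero_mul, zero_mul, sub_zero],
      integral_sub
        (integrable_mul_of_tsupport_subset hU hΦ.continuous hc hsub (hcont he hUe)).integrableOn
        (integrable_mul_of_tsupport_subset hU hΦ.continuous hc hsub (hcont he' hUe')).integrableOn,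
      he.setIntegral_mul_chartLaplacian hU hUe huU hΦ hc hsub,
      he'.setIntegral_mul_chartLaplacian hU hUe' huU hΦ hc hsub, sub_self]
  refine Measure.eqOn_open_of_ae_eq (μ := area M) ?_ hU (hcont he hUe) (hcont he' hUe')
    ⟨⟨hx, hx'⟩, hxs⟩
  rw [Filter.EventuallyEq, ae_restrict_iff' hU.measurableSet]
  filter_upwards [hae] with z hz hzU using sub_eq_zero.1 (hz hzU)

theorem IsSmoothChart.laplaceBeltrami_eq (he : IsSmoothChart e) (hs : IsOpen s)
    (hu : ContMDiffOn (𝓡 2) 𝓘(ℝ, ℝ) ∞ u s) {x : M} (hx : x ∈ e.source) (hxs : x ∈ s) :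
    laplaceBeltrami u x = chartLaplacian e u (e x) :=
  chartLaplacian_congr (isSmoothChart_chartAt x) he hs hu (mem_chart_source _ x) hx hxs

theorem continuousOn_laplaceBeltrami (hs : IsOpen s) (hu : ContMDiffOn (𝓡 2) 𝓘(ℝ, ℝ) ∞ u s) :
    ContinuousOn (laplaceBeltrami u) s := by
  intro x hx
  have he := isSmoothChart_chartAt (M := M) x
  have hn := ((chartAt Plane x).open_source.inter hs).mem_nhds ⟨mem_chart_source Plane x, hx⟩
  refine (((he.continuousOn_chartLaplacian hs hu).continuousAt hn).congr ?_).continuousWithinAt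
  filter_upwards [hn] with z hz
  exact (he.laplaceBeltrami_eq hs hu hz.1 hz.2).symm

theorem integrableOn_of_continuousOn_of_eq_zero_off {X : Type*} [TopologicalSpace X] [T2Space X]
    [MeasurableSpace X] [OpensMeasurableSpace X] {μ : Measure X} [IsFiniteMeasureOnCompacts μ]
    {F : X → ℝ} {s K : Set X} (hs : MeasurableSet s) (hF : ContinuousOn F s) (hK : IsCompact K)
    (hKs : K ⊆ s) (h0 : ∀ x ∈ s, x ∉ K → F x = 0) : IntegrableOn F s μ :=
  ((hF.mono hKs).integrableOn_compact hK).of_forall_sdiff_eq_zero hs fun x hx ↦ h0 x hx.1 hx.2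

theorem IsSmoothChart.setIntegral_mul_laplaceBeltrami (he : IsSmoothChart e) (hs : IsOpen s)
    (hu : ContMDiffOn (𝓡 2) 𝓘(ℝ, ℝ) ∞ u s) (hΦ : ContMDiff (𝓡 2) 𝓘(ℝ, ℝ) ∞ Φ)
    (hc : HasCompactSupport Φ) (hsub : tsupport Φ ⊆ e.source ∩ s) :
    ∫ x in s, Φ x * laplaceBeltrami u x ∂area M = -∫ x in s, gradInner Φ u x ∂area M := by
  have hU : IsOpen (e.source ∩ s) := e.open_source.inter hs
  rw [setIntegral_eq_of_subset_of_forall_sdiff_eq_zero (s := e.source ∩ s) hs.measurableSet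
      Set.inter_subset_right fun x hx ↦ by
        rw [image_eq_zero_of_notMem_tsupport fun h ↦ hx.2 (hsub h), zero_mul],
    setIntegral_eq_of_subset_of_forall_sdiff_eq_zero (s := e.source ∩ s) hs.measurableSet
      Set.inter_subset_right fun x hx ↦
        gradInner_eq_zero_of_notMem_tsupport (fun h ↦ hx.2 (hsub h)) u,
    ← he.setIntegral_mul_chartLaplacian hU Set.inter_subset_left
      (hu.mono Set.inter_subset_right) hΦ hc hsub]
  refine setIntegral_congr_fun hU.measurableSet fun x hx ↦ ?_
  simp only [he.laplaceBeltrami_eq hs hu hx.1 hx.2]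

omit [RiemannianBundle (fun x : M ↦ TangentSpace (𝓡 2) x)]
  [IsContMDiffRiemannianBundle (𝓡 2) ∞ Plane (fun x : M ↦ TangentSpace (𝓡 2) x)]
  [MeasurableSpace M] [BorelSpace M] in
theorem exists_finset_sum_eq_of_hasCompactSupport (hΦ : ContMDiff (𝓡 2) 𝓘(ℝ, ℝ) ∞ Φ)
    (hc : HasCompactSupport Φ) :
    ∃ (F : Finset M) (φ : M → M → ℝ), (∀ x, ∑ k ∈ F, φ k x = Φ x) ∧
      ∀ k, ContMDiff (𝓡 2) 𝓘(ℝ, ℝ) ∞ (φ k) ∧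
        tsupport (φ k) ⊆ (chartAt Plane k).source ∩ tsupport Φ := by
  have : LocallyCompactSpace M := ChartedSpace.locallyCompactSpace Plane M
  obtain ⟨ζ, hζ⟩ := SmoothPartitionOfUnity.exists_isSubordinate_chartAt_source (𝓡 2) M
  have hfin := ζ.locallyFinite.finite_nonempty_inter_compact hc.isCompact
  refine ⟨hfin.toFinset, fun k x ↦ ζ k x * Φ x, fun x ↦ ?_, fun k ↦
    ⟨(ζ k).contMDiff.mul hΦ, Set.subset_inter (tsupport_mul_subset_left.trans (hζ k))
      tsupport_mul_subset_right⟩⟩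
  by_cases hx : x ∈ tsupport Φ
  · have hone : ∑ k ∈ hfin.toFinset, ζ k x = 1 := by
      rw [← ζ.sum_eq_one (Set.mem_univ x), finsum_eq_sum_of_support_subset]
      intro k hk
      rw [Set.Finite.coe_toFinset]
      exact ⟨x, hk, hx⟩
    rw [← Finset.sum_mul, hone, one_mul]
  · simp [image_eq_zero_of_notMem_tsupport hx]

theorem setIntegral_mul_laplaceBeltrami (hs : IsOpen s)
    (hu : ContMDiffOn (𝓡 2) 𝓘(ℝ, ℝ) ∞ u s) (hΦ : ContMDiff (𝓡 2) 𝓘(ℝ, ℝ) ∞ Φ)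
    (hc : HasCompactSupport Φ) (hsub : tsupport Φ ⊆ s) :
    ∫ x in s, Φ x * laplaceBeltrami u x ∂area M = -∫ x in s, gradInner Φ u x ∂area M := by
  obtain ⟨F, φ, hsum, hφ⟩ := exists_finset_sum_eq_of_hasCompactSupport hΦ hc
  have hsupp (k : M) : tsupport (φ k) ⊆ s := (hφ k).2.trans (Set.inter_subset_right.trans hsub)
  have hφc (k : M) : HasCompactSupport (φ k) :=
    hc.isCompact.of_isClosed_subset (isClosed_tsupport _) ((hφ k).2.trans Set.inter_subset_right)
  calc ∫ x in s, Φ x * laplaceBeltrami u x ∂area M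
      = ∑ k ∈ F, ∫ x in s, φ k x * laplaceBeltrami u x ∂area M := by
        simp only [← hsum, Finset.sum_mul]
        exact integral_finsetSum _ fun k _ ↦ (integrable_mul_of_tsupport_subset hs
          (hφ k).1.continuous (hφc k) (hsupp k) (continuousOn_laplaceBeltrami hs hu)).integrableOn
    _ = ∑ k ∈ F, -∫ x in s, gradInner (φ k) u x ∂area M :=
        Finset.sum_congr rfl fun k _ ↦
          (isSmoothChart_chartAt k).setIntegral_mul_laplaceBeltrami hs hu (hφ k).1 (hφc k)
            (Set.subset_inter ((hφ k).2.trans Set.inter_subset_left) (hsupp k))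
    _ = -∫ x in s, gradInner Φ u x ∂area M := by
        rw [Finset.sum_neg_distrib, ← integral_finsetSum _ fun k _ ↦
          integrableOn_of_continuousOn_of_eq_zero_off hs.measurableSet
            (continuousOn_gradInner hs (hφ k).1.contMDiffOn hu) (hφc k).isCompact (hsupp k)
            fun x _ hx ↦ gradInner_eq_zero_of_notMem_tsupport hx u]
        congr 1
        refine integral_congr_ae (.of_forall fun x ↦ ?_)
        rw [show Φ = fun z ↦ ∑ k ∈ F, φ k z from funext fun z ↦ (hsum z).symm]
        exact (gradInner_sum F (fun k _ ↦
          mdifferentiableAt_of_contMDiffOn isOpen_univ (hφ k).1.contMDiffOn trivial) u).symm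

end GreenFormula

section ChartCoarea

theorem measurePreserving_toPlane :
    MeasurePreserving (fun p : ℝ × ℝ ↦ (!₂[p.1, p.2] : Plane)) volume volume :=
  (PiLp.volume_preserving_toLp (Fin 2)).comp ((volume_preserving_finTwoArrow ℝ).symm _)

theorem toPlane_eq_add_smul (t : ℝ) : (fun y : ℝ ↦ (!₂[t, y] : Plane)) =
    fun y ↦ !₂[t, 0] + y • (EuclideanSpace.single 1 1 : Plane) := by
  ext y i
  fin_cases i <;> simp

theorem hasDerivAt_toPlane (t y : ℝ) :
    HasDerivAt (fun y : ℝ ↦ (!₂[t, y] : Plane)) (EuclideanSpace.single 1 1) y := by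
  rw [toPlane_eq_add_smul]
  have h := ((hasDerivAt_id y).smul_const (EuclideanSpace.single 1 1 : Plane)).const_add !₂[t, 0]
  rwa [one_smul] at h

theorem contDiff_toPlane (t : ℝ) : ContDiff ℝ ∞ (fun y : ℝ ↦ (!₂[t, y] : Plane)) := by
  rw [toPlane_eq_add_smul]
  exact contDiff_const.add (contDiff_id.smul contDiff_const)

theorem lintegral_plane {k : Plane → ℝ≥0∞} (hk : Measurable k) :
    ∫⁻ z, k z = ∫⁻ t : ℝ, ∫⁻ y : ℝ, k !₂[t, y] := by
  rw [← measurePreserving_toPlane.lintegral_comp hk, Measure.volume_eq_prod,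
    lintegral_prod (fun p : ℝ × ℝ ↦ k !₂[p.1, p.2])
      (hk.comp measurePreserving_toPlane.measurable).aemeasurable]

section Length

variable {X : Type*} [EMetricSpace X] [MeasurableSpace X] [BorelSpace X] {γ : ℝ → X} {g : ℝ → ℝ≥0}
  {J K : Set ℝ}

theorem hausdorffMeasure_image_le_lintegral_add (hJ : IsOpen J) (hg : ContinuousOn g J)
    (hγ : ∀ I ⊆ J, I.OrdConnected → ∀ c, (∀ y ∈ I, g y ≤ c) → LipschitzOnWith c γ I)
    (hK : MeasurableSet K) (hKJ : K ⊆ J) {ε : ℝ≥0} (hε : 0 < ε) :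
    (Measure.hausdorffMeasure 1 : Measure X) (γ '' K) ≤
      ∫⁻ y in K, (g y + (2 * ε : ℝ≥0)) := by
  have hdens (A : Set ℝ) (hA : MeasurableSet A) :
      volume.withDensity (fun y ↦ (g y + (2 * ε : ℝ≥0) : ℝ≥0∞)) A =
        ∫⁻ y in A, (g y + (2 * ε : ℝ≥0)) := withDensity_apply _ hA
  rw [← hdens K hK]
  refine outerMeasure_le_of_locally_le (OuterMeasure.comap γ
    (Measure.hausdorffMeasure 1 : Measure X).toOuterMeasure) _ hK fun y hy ↦ ?_
  have hgy : ContinuousAt g y := hg.continuousAt (hJ.mem_nhds (hKJ hy))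
  obtain ⟨r, hr, hball⟩ := Metric.eventually_nhds_iff_ball.1 <|
    (hJ.eventually_mem (hKJ hy)).and <|
    (hgy.eventually_lt_const (lt_add_of_pos_right (g y) hε)).and <|
    (hgy.add continuousAt_const).eventually_const_lt (lt_add_of_pos_right (g y) hε)
  refine ⟨Metric.ball y r, Metric.isOpen_ball, Metric.mem_ball_self hr, fun B hB hBm ↦ ?_⟩
  have hlip : LipschitzOnWith (g y + ε) γ (Metric.ball y r) :=
    hγ _ (fun z hz ↦ (hball z hz).1) (by rw [Real.ball_eq_Ioo]; exact Set.ordConnected_Ioo) _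
      fun z hz ↦ (hball z hz).2.1.le
  calc (Measure.hausdorffMeasure 1 : Measure X) (γ '' B)
      ≤ (g y + ε : ℝ≥0) * volume B := by
        simpa [hausdorffMeasure_real] using
          (hlip.mono (hB.trans Set.inter_subset_left)).hausdorffMeasure_image_le zero_le_one
    _ = ∫⁻ _ in B, (g y + ε : ℝ≥0) := (setLIntegral_const _ _).symm
    _ ≤ ∫⁻ z in B, (g z + (2 * ε : ℝ≥0)) := by
        refine setLIntegral_mono' hBm fun z hz ↦ ?_
        rw [two_mul, ← ENNReal.coe_add, ENNReal.coe_le_coe, ← add_assoc]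
        gcongr
        exact (hball z (hB hz).1).2.2.le
    _ = _ := (hdens B hBm).symm

theorem hausdorffMeasure_image_le_lintegral (hJ : IsOpen J) (hg : ContinuousOn g J)
    (hγ : ∀ I ⊆ J, I.OrdConnected → ∀ c, (∀ y ∈ I, g y ≤ c) → LipschitzOnWith c γ I)
    (hK : MeasurableSet K) (hKJ : K ⊆ J) :
    (Measure.hausdorffMeasure 1 : Measure X) (γ '' K) ≤ ∫⁻ y in K, g y := by
  rw [← withDensity_apply _ hK]
  refine outerMeasure_le_of_locally_le (OuterMeasure.comap γ
    (Measure.hausdorffMeasure 1 : Measure X).toOuterMeasure) _ hK fun y _ ↦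
      ⟨Metric.ball y 1, Metric.isOpen_ball, Metric.mem_ball_self one_pos, fun A hA hAm ↦ ?_⟩
  have hfin : volume A ≠ ⊤ :=
    (measure_lt_top_of_subset (hA.trans Set.inter_subset_left) measure_ball_lt_top.ne).ne
  rw [withDensity_apply _ hAm]
  refine ENNReal.le_of_forall_pos_le_add fun δ hδ _ ↦ ?_
  obtain ⟨ε, hε, hεδ⟩ := ENNReal.exists_nnreal_pos_mul_lt
    (ENNReal.mul_ne_top (ENNReal.ofNat_ne_top (n := 2)) hfin) (ENNReal.coe_ne_zero.2 hδ.ne')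
  calc (Measure.hausdorffMeasure 1 : Measure X) (γ '' A)
      ≤ ∫⁻ y in A, (g y + (2 * ε : ℝ≥0)) :=
        hausdorffMeasure_image_le_lintegral_add hJ hg hγ hAm
          (hA.trans (Set.inter_subset_right.trans hKJ)) hε
    _ = (∫⁻ y in A, g y) + ε * (2 * volume A) := by
        rw [lintegral_add_right _ measurable_const, setLIntegral_const, ENNReal.coe_mul,
          ENNReal.coe_ofNat]
        ring
    _ ≤ (∫⁻ y in A, g y) + δ := by gcongr

end Length

section CoordLine

theorem image_coordLine_eq_levelSet {X : Type*} [TopologicalSpace X]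
    {e : OpenPartialHomeomorph X Plane} {u : X → ℝ}
    (hue : ∀ y ∈ e.target, u (e.symm y) = y 0) {B : Set X} (hBe : B ⊆ e.source) (t : ℝ) :
    (fun y : ℝ ↦ e.symm !₂[t, y]) '' {y | (!₂[t, y] : Plane) ∈ e.target ∩ e.symm ⁻¹' B} =
      {x ∈ B | u x = t} := by
  ext x
  constructor
  · rintro ⟨y, ⟨hy, hyB⟩, rfl⟩
    exact ⟨hyB, by simp [hue _ hy]⟩
  · rintro ⟨hxB, hxt⟩
    have hxe := hBe hxB
    have hcoord : (!₂[t, (e x) 1] : Plane) = e x := by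
      have h0 : (e x) 0 = t := by rw [← hue _ (e.map_source hxe), e.left_inv hxe, hxt]
      ext i
      fin_cases i <;> simp [h0]
    refine ⟨(e x) 1, ?_, ?_⟩
    · rw [Set.mem_ofPred_eq, hcoord]
      exact ⟨e.map_source hxe, by rwa [Set.mem_preimage, e.left_inv hxe]⟩
    · simp only [hcoord, e.left_inv hxe]

variable {M : Type*} [TopologicalSpace M] [ChartedSpace Plane M]
  {e : OpenPartialHomeomorph M Plane}

theorem IsSmoothChart.mfderiv_coordLine_one (he : IsSmoothChart e) {t y : ℝ}
    (hy : (!₂[t, y] : Plane) ∈ e.target) :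
    mfderiv 𝓘(ℝ, ℝ) (𝓡 2) (fun y : ℝ ↦ e.symm !₂[t, y]) y (1 : ℝ) =
      coordVector e !₂[t, y] 1 := by
  have hline : mfderiv 𝓘(ℝ, ℝ) (𝓡 2) (fun y : ℝ ↦ (!₂[t, y] : Plane)) y (1 : ℝ) =
      (EuclideanSpace.single 1 1 : Plane) := by
    rw [mfderiv_eq_fderiv]
    exact (hasDerivAt_toPlane t y).deriv
  refine (mfderiv_comp_apply y (he.mdifferentiableAt_symm hy)
    (hasDerivAt_toPlane t y).differentiableAt.mdifferentiableAt (1 : ℝ)).trans ?_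
  rw [hline]
  rfl

variable [RiemannianBundle (fun x : M ↦ TangentSpace (𝓡 2) x)]

theorem sqrt_metricMatrix_self (e : OpenPartialHomeomorph M Plane) (y : Plane) (i : Fin 2) :
    √(metricMatrix e y i i) = ‖coordVector e y i‖ := by
  rw [metricMatrix_apply, metricForm_self_eq_norm_sq, Real.sqrt_sq (norm_nonneg _)]
  rfl

end CoordLine

variable {M : Type*} [EMetricSpace M] [ChartedSpace Plane M]
  [RiemannianBundle (fun x : M ↦ TangentSpace (𝓡 2) x)]
  {e : OpenPartialHomeomorph M Plane}

theorem IsSmoothChart.edist_coordLine_le [IsRiemannianManifold (𝓡 2) M] (he : IsSmoothChart e)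
    {t a b : ℝ} {c : ℝ≥0} (hab : a ≤ b) (htarget : ∀ y ∈ Set.Icc a b, (!₂[t, y] : Plane) ∈ e.target)
    (hc : ∀ y ∈ Set.Icc a b, √(metricMatrix e !₂[t, y] 1 1) ≤ c) :
    edist (e.symm !₂[t, a]) (e.symm !₂[t, b]) ≤ c * edist a b := by
  have hsmooth : ContMDiffOn 𝓘(ℝ, ℝ) (𝓡 2) 1 (fun y : ℝ ↦ e.symm !₂[t, y]) (Set.Icc a b) :=
    (he.contMDiffOn_symm.of_le (by simp)).comp
      ((contDiff_toPlane t).of_le (by simp)).contMDiff.contMDiffOn htarget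
  rw [IsRiemannianManifold.out (I := 𝓡 2)]
  refine (Manifold.riemannianEDist_le_pathELength hsmooth rfl rfl hab).trans ?_
  rw [Manifold.pathELength_eq_lintegral_mfderiv_Icc]
  calc _ ≤ ∫⁻ _ in Set.Icc a b, (c : ℝ≥0∞) := by
        refine setLIntegral_mono measurable_const fun y hy ↦ ?_
        refine (congrArg (fun w : TangentSpace (𝓡 2) (e.symm !₂[t, y]) ↦ ‖w‖ₑ)
          (he.mfderiv_coordLine_one (htarget y hy))).trans_le ?_
        exact enorm_le_coe.2 ((sqrt_metricMatrix_self e _ 1).symm.trans_le (hc y hy))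
    _ = c * edist a b := by
        rw [setLIntegral_const, Real.volume_Icc, edist_dist, Real.dist_eq, abs_sub_comm,
          abs_of_nonneg (sub_nonneg.2 hab)]

theorem IsSmoothChart.lipschitzOnWith_coordLine [IsRiemannianManifold (𝓡 2) M]
    (he : IsSmoothChart e) {t : ℝ} {J : Set ℝ} (hJ : J.OrdConnected) {c : ℝ≥0}
    (hJe : ∀ y ∈ J, (!₂[t, y] : Plane) ∈ e.target)
    (hc : ∀ y ∈ J, √(metricMatrix e !₂[t, y] 1 1) ≤ c) :
    LipschitzOnWith c (fun y : ℝ ↦ e.symm !₂[t, y]) J := by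
  have hle (a : ℝ) (ha : a ∈ J) (b : ℝ) (hb : b ∈ J) (hab : a ≤ b) :
      edist (e.symm !₂[t, a]) (e.symm !₂[t, b]) ≤ c * edist a b :=
    he.edist_coordLine_le hab (fun y hy ↦ hJe y (hJ.out ha hb hy)) fun y hy ↦
      hc y (hJ.out ha hb hy)
  intro a ha b hb
  rcases le_total a b with h | h
  · exact hle a ha b hb h
  · rw [edist_comm, edist_comm a b]
    exact hle b hb a ha h

theorem IsSmoothChart.areaDensity_mul_sqrt_chartGradInner (he : IsSmoothChart e) {u : M → ℝ}
    (hue : ∀ y ∈ e.target, u (e.symm y) = y 0) {y : Plane} (hy : y ∈ e.target) :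
    areaDensity e y * √(chartGradInner e u u y) = √(metricMatrix e y 1 1) := by
  have hcoord : (fun z ↦ u (e.symm z)) =ᶠ[𝓝 y] EuclideanSpace.proj (𝕜 := ℝ) (0 : Fin 2) := by
    filter_upwards [e.open_target.mem_nhds hy] with z hz using hue z hz
  have hpderiv (i : Fin 2) : pderiv i (fun z ↦ u (e.symm z)) y = if i = 0 then 1 else 0 := by
    rw [pderiv_congr hcoord, pderiv, ContinuousLinearMap.fderiv]
    fin_cases i <;> simp
  have hdet := he.metricMatrix_det_pos hy
  have hgrad : chartGradInner e u u y = metricMatrix e y 1 1 / (metricMatrix e y).det := by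
    simp only [chartGradInner, hpderiv, Fin.sum_univ_two]
    simp [Matrix.inv_def, Matrix.adjugate_fin_two]
    ring
  rw [hgrad, areaDensity, ← Real.sqrt_mul hdet.le, mul_div_cancel₀ _ hdet.ne']

variable [IsManifold (𝓡 2) ∞ M]
  [IsContMDiffRiemannianBundle (𝓡 2) ∞ Plane (fun x : M ↦ TangentSpace (𝓡 2) x)]
  [MeasurableSpace M] [BorelSpace M]

theorem IsSmoothChart.hausdorffMeasure_coordLine_le [IsRiemannianManifold (𝓡 2) M]
    (he : IsSmoothChart e) (t : ℝ) {K : Set ℝ} (hK : MeasurableSet K)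
    (hKe : ∀ y ∈ K, (!₂[t, y] : Plane) ∈ e.target) :
    (Measure.hausdorffMeasure 1 : Measure M) ((fun y : ℝ ↦ e.symm !₂[t, y]) '' K) ≤
      ∫⁻ y in K, ENNReal.ofReal √(metricMatrix e !₂[t, y] 1 1) := by
  have hline := (contDiff_toPlane t).continuous
  refine hausdorffMeasure_image_le_lintegral
    (g := fun y ↦ (√(metricMatrix e !₂[t, y] 1 1)).toNNReal) (e.open_target.preimage hline) ?_
    (fun I hI hIc c hc ↦ ?_) hK hKe
  · exact (continuous_real_toNNReal.comp Real.continuous_sqrt).comp_continuousOn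
      ((he.contDiffOn_metricMatrix 1 1).continuousOn.comp hline.continuousOn fun y hy ↦ hy)
  · exact he.lipschitzOnWith_coordLine hIc hI fun y hy ↦
      Real.toNNReal_le_iff_le_coe.1 (hc y hy)

variable [SecondCountableTopology M]

theorem IsSmoothChart.setLIntegral_sqrt_gradInner (he : IsSmoothChart e) {u : M → ℝ}
    (hue : ∀ y ∈ e.target, u (e.symm y) = y 0) (hu : ContMDiffOn (𝓡 2) 𝓘(ℝ, ℝ) ∞ u e.source)
    {B : Set M} (hB : MeasurableSet B) (hBe : B ⊆ e.source) :
    ∫⁻ x in B, ENNReal.ofReal √(gradInner u u x) ∂area M =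
      ∫⁻ y in e.target ∩ e.symm ⁻¹' B, ENNReal.ofReal √(metricMatrix e y 1 1) := by
  have hcont : ContinuousOn (fun x ↦ ENNReal.ofReal √(gradInner u u x)) e.source :=
    ENNReal.continuous_ofReal.comp_continuousOn (Real.continuous_sqrt.comp_continuousOn
      (continuousOn_gradInner e.open_source hu hu))
  rw [he.setLIntegral_area hB hBe ((hcont.mono hBe).aemeasurable hB)]
  refine setLIntegral_congr_fun (measurableSet_inter_preimage_of_continuousOn e.continuousOn_symm
    e.open_target.measurableSet hB) fun y hy ↦ ?_
  have hdiff := mdifferentiableAt_of_contMDiffOn e.open_source hu (e.map_target hy.1)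
  rw [gradInner_eq_chartGradInner he (e.map_target hy.1) hdiff hdiff, e.right_inv hy.1,
    ← ENNReal.ofReal_mul (he.areaDensity_pos hy.1).le,
    he.areaDensity_mul_sqrt_chartGradInner hue hy.1]

theorem IsSmoothChart.exists_measurable_hausdorffMeasure_le [IsRiemannianManifold (𝓡 2) M]
    (he : IsSmoothChart e) {u : M → ℝ} (hue : ∀ y ∈ e.target, u (e.symm y) = y 0)
    (hu : ContMDiffOn (𝓡 2) 𝓘(ℝ, ℝ) ∞ u e.source)
    {B : Set M} (hB : MeasurableSet B) (hBe : B ⊆ e.source) :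
    ∃ h : ℝ → ℝ≥0∞, Measurable h ∧
      (∀ t, (Measure.hausdorffMeasure 1 : Measure M) {x ∈ B | u x = t} ≤ h t) ∧
      ∫⁻ t, h t = ∫⁻ x in B, ENNReal.ofReal √(gradInner u u x) ∂area M := by
  classical
  set S : Set Plane := e.target ∩ e.symm ⁻¹' B
  have hS : MeasurableSet S := measurableSet_inter_preimage_of_continuousOn e.continuousOn_symm
    e.open_target.measurableSet hB
  set k : Plane → ℝ≥0∞ := S.indicator fun y ↦ ENNReal.ofReal √(metricMatrix e y 1 1)
  have hk : Measurable k := by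
    have hcont : ContinuousOn (fun y ↦ ENNReal.ofReal √(metricMatrix e y 1 1)) S :=
      (ENNReal.continuous_ofReal.comp Real.continuous_sqrt).comp_continuousOn
        ((he.contDiffOn_metricMatrix 1 1).continuousOn.mono Set.inter_subset_left)
    rw [show k = _ from (Set.piecewise_eq_indicator ..).symm]
    exact hcont.measurable_piecewise continuousOn_const hS
  refine ⟨fun t ↦ ∫⁻ y, k !₂[t, y],
    (hk.comp measurePreserving_toPlane.measurable).lintegral_prod_right', fun t ↦ ?_, ?_⟩
  · have hline : MeasurableSet {y : ℝ | (!₂[t, y] : Plane) ∈ S} :=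
      (contDiff_toPlane t).continuous.measurable hS
    rw [← image_coordLine_eq_levelSet hue hBe]
    refine (he.hausdorffMeasure_coordLine_le t hline fun y hy ↦ hy.1).trans_eq ?_
    rw [← lintegral_indicator hline]
    rfl
  · rw [← lintegral_plane hk, he.setLIntegral_sqrt_gradInner hue hu hB hBe, lintegral_indicator hS]

end ChartCoarea

section RegularPoints

theorem exists_openPartialHomeomorph_of_injective_fderiv {E : Type*} [NormedAddCommGroup E]
    [NormedSpace ℝ E] [FiniteDimensional ℝ E] {f : E → E} {N : Set E} (hN : IsOpen N)
    (hf : ContDiffOn ℝ ∞ f N) (hinj : ∀ y ∈ N, Function.Injective (fderiv ℝ f y))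
    {y₀ : E} (hy₀ : y₀ ∈ N) :
    ∃ ψ : OpenPartialHomeomorph E E, y₀ ∈ ψ.source ∧ ψ.source ⊆ N ∧
      ContDiffOn ℝ ∞ ψ.symm ψ.target ∧ ⇑ψ = f := by
  have : CompleteSpace E := FiniteDimensional.complete ℝ E
  have hder (y : E) (hy : y ∈ N) : ∃ L : E ≃L[ℝ] E, HasFDerivAt f (L : E →L[ℝ] E) y := by
    refine ⟨(LinearEquiv.ofInjectiveEndo (fderiv ℝ f y : E →ₗ[ℝ] E)
      (hinj y hy)).toContinuousLinearEquiv, ?_⟩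
    convert ((hf.contDiffAt (hN.mem_nhds hy)).differentiableAt (by simp)).hasFDerivAt using 1
    exact ContinuousLinearMap.ext fun a ↦ rfl
  obtain ⟨L, hL⟩ := hder y₀ hy₀
  have hsmooth := hf.contDiffAt (hN.mem_nhds hy₀)
  refine ⟨(hsmooth.toOpenPartialHomeomorph f hL (by simp)).restrOpen N hN,
    ⟨hsmooth.mem_toOpenPartialHomeomorph_source hL (by simp), hy₀⟩, fun y hy ↦ hy.2,
    fun z hz ↦ ?_, rfl⟩
  obtain ⟨L', hL'⟩ := hder _ hz.2
  exact ((hsmooth.toOpenPartialHomeomorph f hL (by simp)).contDiffAt_symm hz.1 hL'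
    (hf.contDiffAt (hN.mem_nhds hz.2))).contDiffWithinAt

theorem eq_zero_of_sum_mul_eq_zero_of_det_eq_zero {a : Plane} {d p : Fin 2 → ℝ}
    (hd : ∑ i, a i * d i = 0) (hp : p 0 * a 1 - p 1 * a 0 = 0) (hdp : ∑ i, d i * p i ≠ 0) :
    a = 0 := by
  rw [Fin.sum_univ_two] at hd hdp
  have hmul : ∀ j, a j * (d 0 * p 0 + d 1 * p 1) = 0 := Fin.forall_fin_two.2
    ⟨by linear_combination p 0 * hd - d 1 * hp, by linear_combination p 1 * hd + d 0 * hp⟩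
  ext j
  exact (mul_eq_zero.1 (hmul j)).resolve_right hdp

theorem exists_openPartialHomeomorph_coord {v : Plane → ℝ} {O : Set Plane} (hO : IsOpen O)
    (hv : ContDiffOn ℝ ∞ v O) {y₀ : Plane} (hy₀ : y₀ ∈ O) (hne : fderiv ℝ v y₀ ≠ 0) :
    ∃ ψ : OpenPartialHomeomorph Plane Plane, y₀ ∈ ψ.source ∧ ψ.source ⊆ O ∧
      ContDiffOn ℝ ∞ ψ ψ.source ∧ ContDiffOn ℝ ∞ ψ.symm ψ.target ∧
      ∀ y ∈ ψ.source, ψ y 0 = v y := by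
  -- The second coordinate `ℓ` is the linear form `a ↦ det (p, a)`, where `p` is the gradient at
  -- `y₀`; the Jacobian determinant of `(v, ℓ)` at `y` is then `dv (p)`.
  set p : Fin 2 → ℝ := fun i ↦ pderiv i v y₀
  let ℓ : Plane →L[ℝ] ℝ := p 0 • EuclideanSpace.proj 1 - p 1 • EuclideanSpace.proj 0
  let f : Plane → Plane := fun y ↦ !₂[v y, ℓ y]
  set N : Set Plane := O ∩ {y | ∑ i, pderiv i v y * p i ≠ 0}
  have hN : IsOpen N :=
    (continuousOn_finsetSum _ fun i _ ↦
      (contDiffOn_pderiv hO hv i).continuousOn.mul continuousOn_const).isOpen_inter_preimage hO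
      isOpen_ne
  have hy₀N : y₀ ∈ N := by
    refine ⟨hy₀, fun h ↦ hne (ContinuousLinearMap.ext fun a ↦ ?_)⟩
    have hp (i : Fin 2) : pderiv i v y₀ = 0 := mul_self_eq_zero.1
      ((Finset.sum_eq_zero_iff_of_nonneg fun i _ ↦ mul_self_nonneg (p i)).1 h i (Finset.mem_univ i))
    simp [fderiv_apply_eq_sum_pderiv, hp]
  have hf : ContDiffOn ℝ ∞ f N := by
    rw [contDiffOn_euclidean]
    intro j
    fin_cases j
    · exact hv.mono Set.inter_subset_left
    · exact ℓ.contDiff.contDiffOn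
  have hinj (y : Plane) (hy : y ∈ N) : Function.Injective (fderiv ℝ f y) := by
    have hder : HasFDerivAt f (fderiv ℝ f y) y :=
      ((hf.contDiffAt (hN.mem_nhds hy)).differentiableAt (by simp)).hasFDerivAt
    have hfst : (EuclideanSpace.proj 0).comp (fderiv ℝ f y) = fderiv ℝ v y :=
      (((EuclideanSpace.proj (𝕜 := ℝ) 0).hasFDerivAt.comp y hder).fderiv).symm
    have hsnd : (EuclideanSpace.proj 1).comp (fderiv ℝ f y) = ℓ :=
      ((EuclideanSpace.proj (𝕜 := ℝ) 1).hasFDerivAt.comp y hder).unique (by exact ℓ.hasFDerivAt)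
    rw [injective_iff_map_eq_zero]
    intro a ha
    have hva : ∑ i, a i * pderiv i v y = 0 := by
      rw [← fderiv_apply_eq_sum_pderiv, ← hfst]
      simp [ha]
    have hℓa : p 0 * a 1 - p 1 * a 0 = 0 := by
      change ℓ a = 0
      rw [← hsnd]
      simp [ha]
    exact eq_zero_of_sum_mul_eq_zero_of_det_eq_zero hva hℓa hy.2
  obtain ⟨ψ, hyψ, hψN, hψ, hψf⟩ := exists_openPartialHomeomorph_of_injective_fderiv hN hf hinj hy₀N
  exact ⟨ψ, hyψ, hψN.trans Set.inter_subset_left, hψf ▸ hf.mono hψN, hψ, fun y _ ↦ by simp [hψf, f]⟩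

variable {M : Type*} [TopologicalSpace M] [ChartedSpace Plane M] {e : OpenPartialHomeomorph M Plane}
  {u : M → ℝ} {s : Set M}

theorem IsSmoothChart.mfderiv_eq_zero_iff (he : IsSmoothChart e) {x : M} (hx : x ∈ e.source)
    (hu : MDifferentiableAt (𝓡 2) 𝓘(ℝ, ℝ) u x) :
    mfderiv (𝓡 2) 𝓘(ℝ, ℝ) u x = 0 ↔ fderiv ℝ (fun z ↦ u (e.symm z)) (e x) = 0 := by
  constructor
  · intro h
    have hu' : MDifferentiableAt (𝓡 2) 𝓘(ℝ, ℝ) u (e.symm (e x)) := by rwa [e.left_inv hx]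
    have h' : mfderiv (𝓡 2) 𝓘(ℝ, ℝ) u (e.symm (e x)) = 0 := by rwa [e.left_inv hx]
    have hcomp := mfderiv_comp (e x) hu' (he.mdifferentiableAt_symm (e.map_source hx))
    rw [h'] at hcomp
    rw [← mfderiv_eq_fderiv]
    exact hcomp.trans (ContinuousLinearMap.zero_comp _)
  · intro h
    have hlocal : u =ᶠ[𝓝 x] (fun z ↦ u (e.symm z)) ∘ e := by
      filter_upwards [e.open_source.mem_nhds hx] with z hz
      simp [e.left_inv hz]
    have hcomp := mfderiv_comp (I' := 𝓡 2) (I'' := 𝓘(ℝ, ℝ)) x (g := fun z ↦ u (e.symm z))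
      (he.differentiableAt_comp_symm hx hu).mdifferentiableAt (he.mdifferentiableAt hx)
    rw [mfderiv_eq_fderiv, h] at hcomp
    rw [hlocal.mfderiv_eq]
    exact hcomp.trans (ContinuousLinearMap.zero_comp _)

variable [IsManifold (𝓡 2) ∞ M]

theorem exists_isSmoothChart_coord (hs : IsOpen s) (hu : ContMDiffOn (𝓡 2) 𝓘(ℝ, ℝ) ∞ u s)
    {x : M} (hx : x ∈ s) (hne : mfderiv (𝓡 2) 𝓘(ℝ, ℝ) u x ≠ 0) :
    ∃ e : OpenPartialHomeomorph M Plane, IsSmoothChart e ∧ x ∈ e.source ∧ e.source ⊆ s ∧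
      ∀ y ∈ e.target, u (e.symm y) = y 0 := by
  have he := isSmoothChart_chartAt (M := M) x
  set e := chartAt Plane x
  have hxe : x ∈ e.source := mem_chart_source Plane x
  obtain ⟨ψ, hxψ, hψO, hψ, hψ', hψ0⟩ := exists_openPartialHomeomorph_coord
    (e.isOpen_inter_preimage_symm hs) (he.contDiffOn_comp_symm hu)
    (y₀ := e x) ⟨e.map_source hxe, by simpa [e.left_inv hxe] using hx⟩
    ((he.mfderiv_eq_zero_iff hxe (mdifferentiableAt_of_contMDiffOn hs hu hx)).not.1 hne)
  refine ⟨e.trans ψ, he.trans hψ hψ', ⟨hxe, hxψ⟩, fun z hz ↦ ?_, fun y hy ↦ ?_⟩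
  · exact e.left_inv hz.1 ▸ (hψO hz.2).2
  · have hcoord := hψ0 _ (ψ.map_target hy.1)
    rw [ψ.right_inv hy.1] at hcoord
    exact hcoord.symm

theorem isOpen_regular (hs : IsOpen s) (hu : ContMDiffOn (𝓡 2) 𝓘(ℝ, ℝ) ∞ u s) :
    IsOpen {x ∈ s | mfderiv (𝓡 2) 𝓘(ℝ, ℝ) u x ≠ 0} := by
  rw [isOpen_iff_mem_nhds]
  rintro x ⟨hxs, hx⟩
  obtain ⟨e, he, hxe, hes, hue⟩ := exists_isSmoothChart_coord hs hu hxs hx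
  filter_upwards [e.open_source.mem_nhds hxe] with z hz
  refine ⟨hes hz, fun hcrit ↦ ?_⟩
  have hcoord : (fun y ↦ u (e.symm y)) =ᶠ[𝓝 (e z)] EuclideanSpace.proj (𝕜 := ℝ) (0 : Fin 2) := by
    filter_upwards [e.open_target.mem_nhds (e.map_source hz)] with y hy using hue y hy
  rw [he.mfderiv_eq_zero_iff hz (mdifferentiableAt_of_contMDiffOn hs hu (hes hz)),
    hcoord.fderiv_eq, ContinuousLinearMap.fderiv] at hcrit
  simpa using congrArg (fun L : Plane →L[ℝ] ℝ ↦ L (EuclideanSpace.single 0 1)) hcrit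

theorem volume_image_critical_eq_zero_of_contMDiffOn [SecondCountableTopology M] (hs : IsOpen s)
    (hu : ContMDiffOn (𝓡 2) 𝓘(ℝ, ℝ) ∞ u s) :
    volume (u '' {x ∈ s | mfderiv (𝓡 2) 𝓘(ℝ, ℝ) u x = 0}) = 0 := by
  obtain ⟨c, hcc, hc⟩ := TopologicalSpace.countable_cover_nhds (α := M)
    (f := fun x ↦ (chartAt Plane x).source) fun x ↦ chart_source_mem_nhds Plane x
  have hsub : u '' {x ∈ s | mfderiv (𝓡 2) 𝓘(ℝ, ℝ) u x = 0} ⊆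
      ⋃ k ∈ c, (fun y ↦ u ((chartAt Plane k).symm y)) ''
        {y ∈ (chartAt Plane k).target ∩ (chartAt Plane k).symm ⁻¹' s |
          fderiv ℝ (fun y ↦ u ((chartAt Plane k).symm y)) y = 0} := by
    rintro _ ⟨x, ⟨hxs, hx⟩, rfl⟩
    obtain ⟨k, hk, hxk⟩ := Set.mem_iUnion₂.1 (hc.ge (Set.mem_univ x))
    have hl := (chartAt Plane k).left_inv hxk
    refine Set.mem_iUnion₂.2 ⟨k, hk, chartAt Plane k x,
      ⟨⟨(chartAt Plane k).map_source hxk, by simpa [hl] using hxs⟩, ?_⟩, by simp [hl]⟩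
    exact ((isSmoothChart_chartAt k).mfderiv_eq_zero_iff hxk
      (mdifferentiableAt_of_contMDiffOn hs hu hxs)).1 hx
  refine measure_mono_null hsub ((measure_biUnion_null_iff hcc).2 fun k _ ↦ ?_)
  exact volume_image_critical_eq_zero (by simp)
    ((chartAt Plane k).isOpen_inter_preimage_symm hs)
    (((isSmoothChart_chartAt k).contDiffOn_comp_symm hu).of_le ENat.LEInfty.out)

end RegularPoints

section Coarea

theorem exists_iUnion_eq_of_forall_mem_nhds {X : Type*} [TopologicalSpace X]
    [SecondCountableTopology X] [MeasurableSpace X] [OpensMeasurableSpace X] {B : Set X}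
    (hB : MeasurableSet B) (hne : B.Nonempty) {U : X → Set X} (hU : ∀ x ∈ B, IsOpen (U x))
    (hxU : ∀ x ∈ B, x ∈ U x) :
    ∃ (k : ℕ → X) (W : ℕ → Set X), (∀ n, k n ∈ B) ∧ (∀ n, MeasurableSet (W n)) ∧
      (∀ n, W n ⊆ U (k n)) ∧ Pairwise (Function.onFun Disjoint W) ∧ ⋃ n, W n = B := by
  obtain ⟨c, hcB, hcc, hcov⟩ := TopologicalSpace.countable_cover_nhdsWithin (f := U) (s := B)
    fun x hx ↦ mem_nhdsWithin_of_mem_nhds ((hU x hx).mem_nhds (hxU x hx))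
  have hcne : c.Nonempty := by
    obtain ⟨x, hx⟩ := hne
    obtain ⟨y, hy, -⟩ := Set.mem_iUnion₂.1 (hcov hx)
    exact ⟨y, hy⟩
  obtain ⟨k, rfl⟩ := hcc.exists_eq_range hcne
  have hkB (n : ℕ) : k n ∈ B := hcB ⟨n, rfl⟩
  refine ⟨k, disjointed fun n ↦ B ∩ U (k n), hkB,
    fun n ↦ .disjointed (fun n ↦ hB.inter (hU _ (hkB n)).measurableSet) n,
    fun n ↦ (disjointed_subset _ n).trans Set.inter_subset_right, disjoint_disjointed _, ?_⟩
  rw [iUnion_disjointed, ← Set.inter_iUnion, Set.inter_eq_left, ← Set.biUnion_range]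
  exact hcov

variable {M : Type*} [EMetricSpace M] [ChartedSpace Plane M] [IsManifold (𝓡 2) ∞ M]
  [RiemannianBundle (fun x : M ↦ TangentSpace (𝓡 2) x)]
  [IsContMDiffRiemannianBundle (𝓡 2) ∞ Plane (fun x : M ↦ TangentSpace (𝓡 2) x)]
  [IsRiemannianManifold (𝓡 2) M] [MeasurableSpace M] [BorelSpace M] [SecondCountableTopology M]

theorem exists_measurable_hausdorffMeasure_le {u : M → ℝ} {s B : Set M} (hs : IsOpen s)
    (hu : ContMDiffOn (𝓡 2) 𝓘(ℝ, ℝ) ∞ u s) (hB : MeasurableSet B) (hBs : B ⊆ s)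
    (hreg : ∀ x ∈ B, mfderiv (𝓡 2) 𝓘(ℝ, ℝ) u x ≠ 0) :
    ∃ h : ℝ → ℝ≥0∞, Measurable h ∧
      (∀ t, (Measure.hausdorffMeasure 1 : Measure M) {x ∈ B | u x = t} ≤ h t) ∧
      ∫⁻ t, h t = ∫⁻ x in B, ENNReal.ofReal √(gradInner u u x) ∂area M := by
  rcases B.eq_empty_or_nonempty with rfl | hne
  · exact ⟨0, measurable_zero, by simp, by simp⟩
  have : Nonempty (OpenPartialHomeomorph M Plane) := ⟨chartAt Plane hne.some⟩
  choose! e he hxe hes hue using fun x (hx : x ∈ B) ↦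
    exists_isSmoothChart_coord hs hu (hBs hx) (hreg x hx)
  obtain ⟨k, W, hkB, hWm, hWU, hdisj, rfl⟩ := exists_iUnion_eq_of_forall_mem_nhds hB hne
    (fun x _ ↦ (e x).open_source) hxe
  choose h hm hle hint using fun n ↦ (he _ (hkB n)).exists_measurable_hausdorffMeasure_le
    (hue _ (hkB n)) (hu.mono (hes _ (hkB n))) (hWm n) (hWU n)
  refine ⟨fun t ↦ ∑' n, h n t, Measurable.tsum hm, fun t ↦ ?_, ?_⟩
  · have hlevel : {x ∈ ⋃ n, W n | u x = t} = ⋃ n, {x ∈ W n | u x = t} := by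
      ext x
      simp
    exact hlevel ▸ (measure_iUnion_le _).trans (ENNReal.tsum_le_tsum fun n ↦ hle n t)
  · rw [lintegral_tsum fun n ↦ (hm n).aemeasurable, lintegral_iUnion hWm hdisj]
    exact tsum_congr hint

end Coarea

section Bound

open Asymptotics

theorem isBigO_one_iteratedFDeriv_of_contDiffWithinAt {E F : Type*} [NormedAddCommGroup E]
    [NormedSpace ℝ E] [NormedAddCommGroup F] [NormedSpace ℝ F] {v : E → F} {D O : Set E} {y₀ : E}
    {n : ℕ} (hO : IsOpen O) (hOD : O ⊆ D) (hv : ContDiffWithinAt ℝ n v D y₀) {k : ℕ}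
    (hk : k ≤ n) : iteratedFDeriv ℝ k v =O[𝓝[O] y₀] (fun _ ↦ (1 : ℝ)) := by
  obtain ⟨w, hw, q, hq⟩ := contDiffWithinAt_nat.1 hv
  obtain ⟨N, hN, hyN, hNw⟩ := mem_nhdsWithin.1 hw
  have hsub : N ∩ O ⊆ w := fun z hz ↦ hNw ⟨hz.1, .inr (hOD hz.2)⟩
  have hmem : N ∩ O ∈ 𝓝[O] y₀ :=
    Filter.inter_mem (mem_nhdsWithin_of_mem_nhds (hN.mem_nhds hyN)) self_mem_nhdsWithin
  have hk' : ((k : ℕ∞) : WithTop ℕ∞) ≤ (n : ℕ∞) := WithTop.coe_le_coe.2 (Nat.cast_le.2 hk)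
  have hlim : Filter.Tendsto (fun y ↦ q y k) (𝓝[O] y₀) (𝓝 (q y₀ k)) :=
    ((hq.cont k hk') y₀ (hNw ⟨hyN, .inl rfl⟩)).tendsto.mono_left
      (nhdsWithin_le_iff.2 (Filter.mem_of_superset hmem hsub))
  refine (hlim.isBigO_one ℝ).congr' ?_ .rfl
  filter_upwards [hmem] with y hy
  rw [(hq.mono hsub).eq_iteratedFDerivWithin_of_uniqueDiffOn hk' (hN.inter hO).uniqueDiffOn hy,
    iteratedFDerivWithin_of_isOpen k (hN.inter hO) hy]

theorem isBigO_one_pderiv_of_contDiffWithinAt {v : Plane → ℝ} {D O : Set Plane} {y₀ : Plane}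
    (hO : IsOpen O) (hOD : O ⊆ D) (hv : ContDiffWithinAt ℝ 1 v D y₀) (i : Fin 2) :
    pderiv i v =O[𝓝[O] y₀] (fun _ ↦ (1 : ℝ)) := by
  refine (IsBigO.of_bound' (.of_forall fun y ↦ ?_)).trans
    (isBigO_one_iteratedFDeriv_of_contDiffWithinAt (n := 1) hO hOD hv le_rfl)
  rw [norm_iteratedFDeriv_one]
  exact ((fderiv ℝ v y).le_opNorm _).trans_eq (by simp)

theorem isBigO_one_pderiv_pderiv_of_contDiffWithinAt {v : Plane → ℝ} {D O : Set Plane}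
    {y₀ : Plane} (hO : IsOpen O) (hOD : O ⊆ D) (hv : ContDiffWithinAt ℝ 2 v D y₀)
    (hvO : ContDiffOn ℝ 2 v O) (i j : Fin 2) :
    pderiv i (pderiv j v) =O[𝓝[O] y₀] (fun _ ↦ (1 : ℝ)) := by
  refine (IsBigO.of_bound' ?_).trans
    (isBigO_one_iteratedFDeriv_of_contDiffWithinAt (n := 2) hO hOD hv le_rfl)
  filter_upwards [self_mem_nhdsWithin] with y hy
  have hdiff : DifferentiableAt ℝ (fderiv ℝ v) y :=
    ((hvO.fderiv_of_isOpen hO (m := 1) le_rfl).contDiffAt (hO.mem_nhds hy)).differentiableAt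
      one_ne_zero
  have hsecond : pderiv i (pderiv j v) y =
      fderiv ℝ (fderiv ℝ v) y (EuclideanSpace.single i 1) (EuclideanSpace.single j 1) := by
    change fderiv ℝ (fun z ↦ fderiv ℝ v z (EuclideanSpace.single j 1)) y _ = _
    simp [fderiv_clm_apply hdiff]
  rw [hsecond, ← norm_iteratedFDeriv_fderiv, norm_iteratedFDeriv_one]
  exact (ContinuousLinearMap.le_opNorm₂ _ _ _).trans_eq (by simp)

theorem exists_bound_of_forall_isBigO_one {X : Type*} [TopologicalSpace X] {K s : Set X}
    {f : X → ℝ} (hK : IsCompact K) (hf : ∀ p ∈ K, f =O[𝓝[s] p] (fun _ ↦ (1 : ℝ))) :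
    ∃ C, ∀ x ∈ K ∩ s, |f x| ≤ C := by
  refine hK.induction_on (p := fun S ↦ ∃ C, ∀ x ∈ S ∩ s, |f x| ≤ C) ⟨0, by simp⟩
    (fun S T hST ⟨C, hC⟩ ↦ ⟨C, fun x hx ↦ hC x ⟨hST hx.1, hx.2⟩⟩) ?_ fun p hp ↦ ?_
  · rintro S T ⟨C, hC⟩ ⟨C', hC'⟩
    refine ⟨max C C', fun x ⟨hx, hxs⟩ ↦ hx.elim (fun h ↦ ?_) fun h ↦ ?_⟩
    · exact (hC x ⟨h, hxs⟩).trans (le_max_left _ _)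
    · exact (hC' x ⟨h, hxs⟩).trans (le_max_right _ _)
  · obtain ⟨C, hC⟩ := (hf p hp).bound
    refine ⟨{x | x ∈ s → ‖f x‖ ≤ C * ‖(1 : ℝ)‖},
      mem_nhdsWithin_of_mem_nhds (eventually_nhdsWithin_iff.1 hC), C, fun x hx ↦ ?_⟩
    simpa using hx.1 hx.2

variable {M : Type*} [TopologicalSpace M] [ChartedSpace Plane M] [IsManifold (𝓡 2) ∞ M]
  [RiemannianBundle (fun x : M ↦ TangentSpace (𝓡 2) x)]
  [IsContMDiffRiemannianBundle (𝓡 2) ∞ Plane (fun x : M ↦ TangentSpace (𝓡 2) x)]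
  {e : OpenPartialHomeomorph M Plane} {u : M → ℝ}

theorem IsSmoothChart.chartLaplacian_eq_sum (he : IsSmoothChart e) {O : Set Plane}
    (hO : IsOpen O) (hOe : O ⊆ e.target) (hu : ContDiffOn ℝ ∞ (fun z ↦ u (e.symm z)) O)
    {y : Plane} (hy : y ∈ O) :
    chartLaplacian e u y = (areaDensity e y)⁻¹ * ∑ i, ∑ j,
      (areaDensity e y * (metricMatrix e y)⁻¹ i j * pderiv i (pderiv j fun z ↦ u (e.symm z)) y +
        pderiv j (fun z ↦ u (e.symm z)) y *
          pderiv i (fun y ↦ areaDensity e y * (metricMatrix e y)⁻¹ i j) y) := by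
  have hflux (i : Fin 2) : chartFlux e u i = fun y ↦ ∑ j,
      areaDensity e y * (metricMatrix e y)⁻¹ i j * pderiv j (fun z ↦ u (e.symm z)) y := by
    ext y
    simp only [chartFlux, Finset.mul_sum, mul_assoc]
  rw [chartLaplacian]
  congr 1
  refine Finset.sum_congr rfl fun i _ ↦ ?_
  have hcoeff (j : Fin 2) :
      DifferentiableAt ℝ (fun y ↦ areaDensity e y * (metricMatrix e y)⁻¹ i j) y :=
    ((he.contDiffOn_areaDensity.mul (he.contDiffOn_metricMatrix_inv i j)).contDiffAt
      (e.open_target.mem_nhds (hOe hy))).differentiableAt (by simp)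
  have hpderiv (j : Fin 2) : DifferentiableAt ℝ (pderiv j fun z ↦ u (e.symm z)) y :=
    ((contDiffOn_pderiv hO hu j).contDiffAt (hO.mem_nhds hy)).differentiableAt (by simp)
  rw [hflux, pderiv, fderiv_fun_sum fun j _ ↦ (hcoeff j).fun_mul (hpderiv j), sum_apply]
  refine Finset.sum_congr rfl fun j _ ↦ ?_
  rw [fderiv_fun_mul (hcoeff j) (hpderiv j)]
  rfl

theorem IsSmoothChart.isBigO_one_chartLaplacian (he : IsSmoothChart e) {O D : Set Plane}
    (hO : IsOpen O) (hOD : O ⊆ D) (hDe : D ⊆ e.target)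
    (hu : ContDiffOn ℝ ∞ (fun z ↦ u (e.symm z)) D) {y₀ : Plane} (hy₀ : y₀ ∈ D) :
    chartLaplacian e u =O[𝓝[O] y₀] (fun _ ↦ (1 : ℝ)) := by
  have hv : ContDiffWithinAt ℝ 2 (fun z ↦ u (e.symm z)) D y₀ := (hu y₀ hy₀).of_le ENat.LEInfty.out
  have hmul {f g : Plane → ℝ} (hf : f =O[𝓝[O] y₀] (fun _ ↦ (1 : ℝ)))
      (hg : g =O[𝓝[O] y₀] (fun _ ↦ (1 : ℝ))) :
      (fun y ↦ f y * g y) =O[𝓝[O] y₀] (fun _ ↦ (1 : ℝ)) := by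
    simpa only [mul_one] using hf.mul hg
  have hbdd {F : Plane → ℝ} (hF : ContDiffOn ℝ ∞ F e.target) :
      F =O[𝓝[O] y₀] (fun _ ↦ (1 : ℝ)) :=
    ((hF.continuousOn.continuousAt (e.open_target.mem_nhds (hDe hy₀))).tendsto.mono_left
      nhdsWithin_le_nhds).isBigO_one ℝ
  have hcoeff (i j : Fin 2) :
      ContDiffOn ℝ ∞ (fun y ↦ areaDensity e y * (metricMatrix e y)⁻¹ i j) e.target :=
    he.contDiffOn_areaDensity.mul (he.contDiffOn_metricMatrix_inv i j)
  have hsum := hmul (hbdd (he.contDiffOn_areaDensity.inv fun _ hy ↦ (he.areaDensity_pos hy).ne'))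
    (IsBigO.sum (s := Finset.univ) fun i _ ↦ IsBigO.sum (s := Finset.univ) fun j _ ↦
      (hmul (hbdd (hcoeff i j)) (isBigO_one_pderiv_pderiv_of_contDiffWithinAt hO hOD hv
        ((hu.mono hOD).of_le ENat.LEInfty.out) i j)).add
      (hmul (isBigO_one_pderiv_of_contDiffWithinAt hO hOD (hv.of_le one_le_two) j)
        (hbdd (contDiffOn_pderiv e.open_target (hcoeff i j) i))))
  refine hsum.congr' ?_ .rfl
  filter_upwards [self_mem_nhdsWithin] with y hy
  exact (he.chartLaplacian_eq_sum hO (hOD.trans hDe) (hu.mono hOD) hy).symm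

variable [MeasurableSpace M] [BorelSpace M] [SecondCountableTopology M] [T2Space M] {Ω : Set M}

theorem isBigO_one_laplaceBeltrami (hΩ : IsOpen Ω)
    (hu : ContMDiffOn (𝓡 2) 𝓘(ℝ, ℝ) ∞ u (closure Ω)) {p : M} (hp : p ∈ closure Ω) :
    laplaceBeltrami u =O[𝓝[Ω] p] (fun _ ↦ (1 : ℝ)) := by
  have he := isSmoothChart_chartAt (M := M) p
  set e := chartAt Plane p
  have hpe : p ∈ e.source := mem_chart_source Plane p
  have hchart := he.isBigO_one_chartLaplacian (e.isOpen_inter_preimage_symm hΩ)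
    (Set.inter_subset_inter_right _ (Set.preimage_mono subset_closure)) Set.inter_subset_left
    (he.contDiffOn_comp_symm hu) (y₀ := e p)
    ⟨e.map_source hpe, by simpa [e.left_inv hpe] using hp⟩
  have hsource : ∀ᶠ x in 𝓝[Ω] p, x ∈ e.source :=
    mem_nhdsWithin_of_mem_nhds (e.open_source.mem_nhds hpe)
  have htend : Filter.Tendsto e (𝓝[Ω] p) (𝓝[e.target ∩ e.symm ⁻¹' Ω] (e p)) := by
    refine tendsto_nhdsWithin_iff.2 ⟨(e.continuousAt hpe).mono_left nhdsWithin_le_nhds, ?_⟩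
    filter_upwards [hsource, self_mem_nhdsWithin] with x hxe hxΩ
    exact ⟨e.map_source hxe, by simpa [e.left_inv hxe] using hxΩ⟩
  refine (hchart.comp_tendsto htend).congr' ?_ .rfl
  filter_upwards [hsource, self_mem_nhdsWithin] with x hxe hxΩ
  exact (he.laplaceBeltrami_eq hΩ (hu.mono subset_closure) hxe hxΩ).symm

theorem exists_bound_laplaceBeltrami (hΩ : IsOpen Ω) (hΩc : IsCompact (closure Ω))
    (hu : ContMDiffOn (𝓡 2) 𝓘(ℝ, ℝ) ∞ u (closure Ω)) :
    ∃ C, ∀ x ∈ Ω, |laplaceBeltrami u x| ≤ C := by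
  obtain ⟨C, hC⟩ := exists_bound_of_forall_isBigO_one hΩc fun p hp ↦
    isBigO_one_laplaceBeltrami hΩ hu hp
  exact ⟨C, fun x hx ↦ hC x ⟨subset_closure hx, hx⟩⟩

end Bound

section Sublevel

/-- The part of `Ω` on which `u` is at most `t`. -/
def sublevel {X : Type*} (u : X → ℝ) (Ω : Set X) (t : ℝ) : Set X :=
  {x ∈ Ω | u x ≤ t}

variable {X : Type*} {u : X → ℝ} {Ω : Set X}

theorem sublevel_subset (u : X → ℝ) (Ω : Set X) (t : ℝ) : sublevel u Ω t ⊆ Ω :=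
  Set.sep_subset _ _

theorem monotone_sublevel (u : X → ℝ) (Ω : Set X) : Monotone (sublevel u Ω) :=
  fun _ _ hab _ hx ↦ ⟨hx.1, hx.2.trans hab⟩

theorem mem_sublevel_sdiff {a b : ℝ} {x : X} :
    x ∈ sublevel u Ω b \ sublevel u Ω a ↔ x ∈ Ω ∧ a < u x ∧ u x ≤ b := by
  simp only [sublevel, Set.mem_sdiff, Set.mem_sep_iff, not_and, not_le]
  tauto

theorem biInter_gt_sublevel (u : X → ℝ) (Ω : Set X) (a : ℝ) :
    ⋂ r > a, sublevel u Ω r = sublevel u Ω a := by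
  refine subset_antisymm (fun x hx ↦ ?_) (Set.subset_iInter₂ fun r hr ↦
    monotone_sublevel u Ω (le_of_lt hr))
  rw [Set.mem_iInter₂] at hx
  exact ⟨(hx (a + 1) (lt_add_one a)).1, le_of_forall_gt_imp_ge_of_dense fun r hr ↦ (hx r hr).2⟩

variable [TopologicalSpace X]

theorem isCompact_sublevel (hΩ : IsOpen Ω) (hΩc : IsCompact (closure Ω))
    (hu : ContinuousOn u (closure Ω)) (hbd : ∀ x ∈ frontier Ω, u x = 0) {t : ℝ} (ht : t < 0) :
    IsCompact (sublevel u Ω t) := by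
  have h : sublevel u Ω t = closure Ω ∩ u ⁻¹' Set.Iic t := by
    refine subset_antisymm (fun x hx ↦ ⟨subset_closure hx.1, hx.2⟩) fun x ⟨hx, hxt⟩ ↦ ⟨?_, hxt⟩
    by_contra hxΩ
    exact (hbd x (hΩ.frontier_eq ▸ ⟨hx, hxΩ⟩)).not_lt (lt_of_le_of_lt hxt ht)
  exact h ▸ hΩc.of_isClosed_subset
    (hu.preimage_isClosed_of_isClosed isClosed_closure isClosed_Iic) Set.inter_subset_left

theorem frontier_sublevel_subset (hΩ : IsOpen Ω) (hu : ContinuousOn u Ω) {t : ℝ}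
    (hcl : IsClosed (sublevel u Ω t)) : frontier (sublevel u Ω t) ⊆ {x ∈ Ω | u x = t} := by
  intro x hx
  rw [hcl.frontier_eq] at hx
  refine ⟨hx.1.1, le_antisymm hx.1.2 (not_lt.1 fun hlt ↦ hx.2 ?_)⟩
  exact mem_interior.2 ⟨Ω ∩ u ⁻¹' Set.Iio t, fun y hy ↦ ⟨hy.1, le_of_lt hy.2⟩,
    hu.isOpen_inter_preimage hΩ isOpen_Iio, hx.1.1, hlt⟩

theorem exists_forall_le_sublevel_eq_empty (hΩc : IsCompact (closure Ω))
    (hu : ContinuousOn u (closure Ω)) : ∃ A, ∀ t ≤ A, sublevel u Ω t = ∅ := by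
  obtain ⟨m, hm⟩ := (hΩc.image_of_continuousOn hu).bddBelow
  refine ⟨m - 1, fun t ht ↦ Set.eq_empty_of_forall_notMem fun x hx ↦ ?_⟩
  linarith [hm ⟨x, subset_closure hx.1, rfl⟩, hx.2]

theorem measurableSet_sublevel [MeasurableSpace X] [OpensMeasurableSpace X] (hΩ : IsOpen Ω)
    (hu : ContinuousOn u Ω) (t : ℝ) : MeasurableSet (sublevel u Ω t) := by
  have h : sublevel u Ω t = Ω \ (Ω ∩ u ⁻¹' Set.Ioi t) := by
    ext x
    simp [sublevel]
  exact h ▸ hΩ.measurableSet.diff (hu.isOpen_inter_preimage hΩ isOpen_Ioi).measurableSet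

theorem isCompactSmoothDomain_sublevel {M : Type*} [TopologicalSpace M] [T2Space M]
    [ChartedSpace Plane M] [IsManifold (𝓡 2) ∞ M] {u : M → ℝ} {Ω : Set M} (hΩ : IsOpen Ω)
    (hu : ContMDiffOn (𝓡 2) 𝓘(ℝ, ℝ) ∞ u Ω) {t : ℝ} (hc : IsCompact (sublevel u Ω t))
    (ht : t ∉ u '' {x ∈ Ω | mfderiv (𝓡 2) 𝓘(ℝ, ℝ) u x = 0}) :
    IsCompactSmoothDomain (sublevel u Ω t) := by
  refine ⟨hc, fun p hp ↦ ?_⟩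
  obtain ⟨hpΩ, hpt⟩ := frontier_sublevel_subset hΩ hu.continuousOn hc.isClosed hp
  have hmfderiv {q : M} (hq : q ∈ Ω) :
      mfderiv (𝓡 2) 𝓘(ℝ, ℝ) (fun x ↦ u x - t) q = mfderiv (𝓡 2) 𝓘(ℝ, ℝ) u q :=
    ((mdifferentiableAt_of_contMDiffOn hΩ hu hq).hasMFDerivAt.sub
      (hasMFDerivAt_const t q)).mfderiv.trans (sub_zero _)
  refine ⟨{x ∈ Ω | mfderiv (𝓡 2) 𝓘(ℝ, ℝ) u x ≠ 0}, isOpen_regular hΩ hu,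
    ⟨hpΩ, fun h0 ↦ ht ⟨p, ⟨hpΩ, h0⟩, hpt⟩⟩, fun x ↦ u x - t,
    (hu.mono fun x hx ↦ hx.1).sub contMDiffOn_const, fun q hq ↦ hmfderiv hq.1 ▸ hq.2, ?_⟩
  ext q
  simp only [sublevel, Set.mem_inter_iff, Set.mem_ofPred_eq, sub_nonpos]
  tauto

end Sublevel

section Distribution

variable {X : Type*} [MeasurableSpace X]

/-- The distribution function of `u` on `Ω`: the measure of the sublevel sets. -/
noncomputable def distribution (μ : Measure X) (u : X → ℝ) (Ω : Set X) (t : ℝ) : ℝ :=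
  μ.real (sublevel u Ω t)

/-- The distribution function of `u` on `Ω` for the measure `e²ᵘ μ`, which is the area of the
conformal metric `e²ᵘ g` when `μ` is the area of `g`. -/
noncomputable def expDistribution (μ : Measure X) (u : X → ℝ) (Ω : Set X) (t : ℝ) : ℝ :=
  ∫ x in sublevel u Ω t, Real.exp (2 * u x) ∂μ

variable {μ : Measure X} {u : X → ℝ} {Ω : Set X}

theorem distribution_nonneg (t : ℝ) : 0 ≤ distribution μ u Ω t :=
  measureReal_nonneg

theorem distribution_le (hfin : μ Ω ≠ ⊤) (t : ℝ) : distribution μ u Ω t ≤ μ.real Ω :=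
  measureReal_mono (sublevel_subset u Ω t) hfin

theorem measure_sublevel_ne_top (hfin : μ Ω ≠ ⊤) (t : ℝ) : μ (sublevel u Ω t) ≠ ⊤ :=
  measure_ne_top_of_subset (sublevel_subset u Ω t) hfin

theorem monotone_distribution (hfin : μ Ω ≠ ⊤) : Monotone (distribution μ u Ω) :=
  fun _ b hab ↦ measureReal_mono (monotone_sublevel u Ω hab) (measure_sublevel_ne_top hfin b)

theorem measureReal_sublevel_sdiff (hfin : μ Ω ≠ ⊤)
    (hmeas : ∀ t, MeasurableSet (sublevel u Ω t)) {a b : ℝ} (hab : a ≤ b) :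
    μ.real (sublevel u Ω b \ sublevel u Ω a) = distribution μ u Ω b - distribution μ u Ω a :=
  measureReal_sdiff (monotone_sublevel u Ω hab) (hmeas a) (measure_sublevel_ne_top hfin b)

theorem setIntegral_exp_sublevel_sdiff (hmeas : ∀ t, MeasurableSet (sublevel u Ω t))
    (hexp : IntegrableOn (fun x ↦ Real.exp (2 * u x)) Ω μ) {a b : ℝ} (hab : a ≤ b) :
    ∫ x in sublevel u Ω b \ sublevel u Ω a, Real.exp (2 * u x) ∂μ =
      expDistribution μ u Ω b - expDistribution μ u Ω a :=
  setIntegral_sdiff (hmeas a) (hexp.mono_set (sublevel_subset u Ω b)) (monotone_sublevel u Ω hab)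

theorem exp_mul_distribution_sub_le (hfin : μ Ω ≠ ⊤)
    (hmeas : ∀ t, MeasurableSet (sublevel u Ω t))
    (hexp : IntegrableOn (fun x ↦ Real.exp (2 * u x)) Ω μ) {a b : ℝ} (hab : a ≤ b) :
    Real.exp (2 * a) * (distribution μ u Ω b - distribution μ u Ω a) ≤
      expDistribution μ u Ω b - expDistribution μ u Ω a := by
  have hsub : sublevel u Ω b \ sublevel u Ω a ⊆ Ω := Set.sdiff_subset.trans (sublevel_subset u Ω b)
  rw [← measureReal_sublevel_sdiff hfin hmeas hab, ← setIntegral_exp_sublevel_sdiff hmeas hexp hab,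
    mul_comm, ← smul_eq_mul, ← setIntegral_const]
  refine setIntegral_mono_on (integrableOn_const (measure_ne_top_of_subset hsub hfin))
    (hexp.mono_set hsub) ((hmeas b).diff (hmeas a)) fun x hx ↦ Real.exp_le_exp.2 ?_
  linarith [(mem_sublevel_sdiff.1 hx).2.1]

theorem expDistribution_sub_le_exp_mul (hfin : μ Ω ≠ ⊤)
    (hmeas : ∀ t, MeasurableSet (sublevel u Ω t))
    (hexp : IntegrableOn (fun x ↦ Real.exp (2 * u x)) Ω μ) {a b : ℝ} (hab : a ≤ b) :
    expDistribution μ u Ω b - expDistribution μ u Ω a ≤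
      Real.exp (2 * b) * (distribution μ u Ω b - distribution μ u Ω a) := by
  have hsub : sublevel u Ω b \ sublevel u Ω a ⊆ Ω := Set.sdiff_subset.trans (sublevel_subset u Ω b)
  rw [← measureReal_sublevel_sdiff hfin hmeas hab, ← setIntegral_exp_sublevel_sdiff hmeas hexp hab,
    mul_comm, ← smul_eq_mul, ← setIntegral_const]
  refine setIntegral_mono_on (hexp.mono_set hsub)
    (integrableOn_const (measure_ne_top_of_subset hsub hfin)) ((hmeas b).diff (hmeas a))
    fun x hx ↦ Real.exp_le_exp.2 ?_
  linarith [(mem_sublevel_sdiff.1 hx).2.2]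

theorem tendsto_distribution_nhdsGT (hfin : μ Ω ≠ ⊤)
    (hmeas : ∀ t, MeasurableSet (sublevel u Ω t)) (a : ℝ) :
    Filter.Tendsto (distribution μ u Ω) (𝓝[>] a) (𝓝 (distribution μ u Ω a)) := by
  have h := tendsto_measure_biInter_gt (μ := μ) (a := a)
    (fun r _ ↦ (hmeas r).nullMeasurableSet) (fun i j _ hij ↦ monotone_sublevel u Ω hij)
    ⟨a + 1, lt_add_one a, measure_sublevel_ne_top hfin _⟩
  rw [biInter_gt_sublevel] at h
  exact (ENNReal.tendsto_toReal (measure_sublevel_ne_top hfin a)).comp h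

theorem tendsto_setIntegral_sublevel (hΩ : MeasurableSet Ω)
    (hmeas : ∀ t, MeasurableSet (sublevel u Ω t)) {c : ℝ} (hc : ∀ x ∈ Ω, u x < c) {F : X → ℝ}
    (hF : IntegrableOn F Ω μ) :
    Filter.Tendsto (fun t ↦ ∫ x in sublevel u Ω t, F x ∂μ) (𝓝[<] c) (𝓝 (∫ x in Ω, F x ∂μ)) := by
  have hcover : AECover (μ.restrict Ω) (𝓝[<] c) (sublevel u Ω) := by
    refine ⟨ae_restrict_of_forall_mem hΩ fun x hx ↦ ?_, hmeas⟩
    filter_upwards [Ioo_mem_nhdsLT (hc x hx)] with t ht using ⟨hx, ht.1.le⟩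
  refine (hcover.integral_tendsto_of_countably_generated hF).congr fun t ↦ ?_
  rw [Measure.restrict_restrict (hmeas t),
    Set.inter_eq_self_of_subset_left (sublevel_subset u Ω t)]

theorem tendsto_distribution_nhdsLT (hΩ : MeasurableSet Ω) (hfin : μ Ω ≠ ⊤)
    (hmeas : ∀ t, MeasurableSet (sublevel u Ω t)) {c : ℝ} (hc : ∀ x ∈ Ω, u x < c) :
    Filter.Tendsto (distribution μ u Ω) (𝓝[<] c) (𝓝 (μ.real Ω)) := by
  have h := tendsto_setIntegral_sublevel hΩ hmeas hc (integrableOn_const hfin (C := (1 : ℝ)))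
  simp only [setIntegral_const, smul_eq_mul, mul_one] at h
  exact h

end Distribution

section Monotonicity

theorem hasDerivAt_of_mul_sub_le {α β φ : ℝ → ℝ} {t β' : ℝ}
    (hl : ∀ a b, a ≤ b → φ a * (β b - β a) ≤ α b - α a)
    (hr : ∀ a b, a ≤ b → α b - α a ≤ φ b * (β b - β a))
    (hφ : ContinuousAt φ t) (hβ : HasDerivAt β β' t) : HasDerivAt α (φ t * β') t := by
  have hdiff (x : ℝ) : ‖α x - α t - φ t * (β x - β t)‖ ≤ ‖(φ x - φ t) * (β x - β t)‖ := by
    rw [Real.norm_eq_abs, Real.norm_eq_abs]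
    rcases le_total t x with h | h
    · exact abs_le_abs_of_nonneg (by linarith [hl t x h]) (by linarith [hr t x h])
    · exact abs_le_abs_of_nonneg (by linarith [hr x t h]) (by linarith [hl x t h])
  have hsmall : (fun x ↦ φ x - φ t) =o[𝓝 t] fun _ ↦ (1 : ℝ) :=
    (Asymptotics.isLittleO_one_iff ℝ).2 (by simpa using hφ.tendsto.sub_const (φ t))
  have herr : (fun x ↦ α x - α t - φ t * (β x - β t)) =o[𝓝 t] fun x ↦ x - t :=
    ((Asymptotics.isBigO_of_le _ hdiff).trans_isLittleO
      (hsmall.mul_isBigO hβ.isBigO_sub)).congr_right fun x ↦ one_mul _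
  refine hasDerivAt_iff_isLittleO.2
    ((herr.add (hβ.isLittleO.const_mul_left (φ t))).congr_left fun x ↦ ?_)
  simp only [smul_eq_mul]
  ring

theorem le_of_sub_le_of_ae_hasDerivAt_nonpos {Ψ : ℝ → ℝ} {A B C : ℝ} (hAB : A ≤ B)
    (hinc : ∀ a b, a ≤ b → b ≤ B → Ψ b - Ψ a ≤ C * (b - a))
    (hderiv : ∀ᵐ t, t < B → ∃ d ≤ 0, HasDerivAt Ψ d t) : Ψ B ≤ Ψ A := by
  have hmono : MonotoneOn (fun t ↦ C * t - Ψ t) (Set.uIcc A B) := by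
    rw [Set.uIcc_of_le hAB]
    intro a _ b hb hab
    linarith [hinc a b hab hb.2]
  have hle : C * (B - A) ≤ ∫ t in A..B, deriv (fun t ↦ C * t - Ψ t) t := by
    rw [mul_comm, ← smul_eq_mul, ← intervalIntegral.integral_const]
    refine intervalIntegral.integral_mono_ae_restrict hAB intervalIntegrable_const
      hmono.intervalIntegrable_deriv ?_
    filter_upwards [ae_restrict_mem measurableSet_Icc, ae_restrict_of_ae hderiv,
      ae_restrict_of_ae (Measure.ae_ne volume B)] with t ht hd hne
    obtain ⟨d, hd0, hd⟩ := hd (lt_of_le_of_ne ht.2 hne)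
    have h : HasDerivAt (fun t ↦ C * t - Ψ t) (C * 1 - d) t :=
      ((hasDerivAt_id t).const_mul C).sub hd
    rw [h.deriv]
    linarith
  have hup := hmono.intervalIntegral_deriv_mem_uIcc
  rw [Set.uIcc_of_le (sub_nonneg.2 (hmono Set.left_mem_uIcc Set.right_mem_uIcc hAB))] at hup
  linarith [hup.2]

/-- The lower bound `c A - κ A²` for the squared length of the boundary of a domain of area `A`
in an isoperimetric inequality. -/
noncomputable def lengthSqBound (c κ A : ℝ) : ℝ :=
  c * A - κ * A ^ 2

theorem lengthSqBound_sub (c κ A B : ℝ) :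
    lengthSqBound c κ B - lengthSqBound c κ A = (c - κ * (A + B)) * (B - A) := by
  unfold lengthSqBound
  ring

variable {X : Type*} [MeasurableSpace X] {μ : Measure X} {u : X → ℝ} {Ω : Set X}
  {c κ lam p : ℝ}

variable (μ u Ω) in
/-- An upper bound for the flux `∫_{u ≤ t} Δu` of the gradient of a solution of
`-Δu + κ = λ e²ᵘ + f` through its level sets, where `p` stands for the integral of `f⁻`. -/
noncomputable def fluxBound (κ lam p t : ℝ) : ℝ :=
  κ * distribution μ u Ω t - lam * expDistribution μ u Ω t + p

variable (μ u Ω) in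
/-- The quantity which decreases along the level sets in Bol's argument; `c` stands for `4πθ` and
`p` for the integral of `f⁻`. -/
noncomputable def bolFunctional (c κ lam p t : ℝ) : ℝ :=
  Real.exp (2 * t) * lengthSqBound c κ (distribution μ u Ω t) -
    (c + 2 * p) * expDistribution μ u Ω t + lam * expDistribution μ u Ω t ^ 2

theorem hasDerivAt_expDistribution (hfin : μ Ω ≠ ⊤)
    (hmeas : ∀ t, MeasurableSet (sublevel u Ω t))
    (hexp : IntegrableOn (fun x ↦ Real.exp (2 * u x)) Ω μ) {t d : ℝ}
    (hd : HasDerivAt (distribution μ u Ω) d t) :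
    HasDerivAt (expDistribution μ u Ω) (Real.exp (2 * t) * d) t :=
  hasDerivAt_of_mul_sub_le (φ := fun t ↦ Real.exp (2 * t))
    (fun _ _ ↦ exp_mul_distribution_sub_le hfin hmeas hexp)
    (fun _ _ ↦ expDistribution_sub_le_exp_mul hfin hmeas hexp)
    (by fun_prop : Continuous fun t : ℝ ↦ Real.exp (2 * t)).continuousAt hd

theorem hasDerivAt_bolFunctional (hfin : μ Ω ≠ ⊤)
    (hmeas : ∀ t, MeasurableSet (sublevel u Ω t))
    (hexp : IntegrableOn (fun x ↦ Real.exp (2 * u x)) Ω μ) {t d : ℝ}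
    (hd : HasDerivAt (distribution μ u Ω) d t) :
    HasDerivAt (bolFunctional μ u Ω c κ lam p)
      (2 * Real.exp (2 * t) *
        (lengthSqBound c κ (distribution μ u Ω t) - d * fluxBound μ u Ω κ lam p t)) t := by
  have hα := hasDerivAt_expDistribution hfin hmeas hexp hd
  have he : HasDerivAt (fun t : ℝ ↦ Real.exp (2 * t)) (Real.exp (2 * t) * (2 * 1)) t :=
    ((hasDerivAt_id t).const_mul 2).exp
  refine (((he.mul ((hd.const_mul c).sub ((hd.pow 2).const_mul κ))).sub
    (hα.const_mul (c + 2 * p))).add ((hα.pow 2).const_mul lam)).congr_deriv ?_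
  simp only [lengthSqBound, fluxBound, Pi.sub_apply, Pi.pow_apply]
  ring

theorem exp_two_mul_sub_le {a b : ℝ} (hab : a ≤ b) (hb : b ≤ 0) :
    Real.exp (2 * b) - Real.exp (2 * a) ≤ 2 * (b - a) := by
  have hsplit : Real.exp (2 * a) = Real.exp (2 * b) * Real.exp (2 * (a - b)) := by
    rw [← Real.exp_add]
    ring_nf
  have hle : 1 - Real.exp (2 * (a - b)) ≤ 2 * (b - a) := by
    linarith [Real.add_one_le_exp (2 * (a - b))]
  calc Real.exp (2 * b) - Real.exp (2 * a) = Real.exp (2 * b) * (1 - Real.exp (2 * (a - b))) := by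
        rw [hsplit]
        ring
    _ ≤ 1 * (2 * (b - a)) := mul_le_mul (Real.exp_le_one_iff.2 (by linarith)) hle
        (sub_nonneg.2 (Real.exp_le_one_iff.2 (by linarith))) zero_le_one
    _ = 2 * (b - a) := one_mul _

theorem abs_sub_mul_le {A m : ℝ} (hA : 0 ≤ A) (hAm : A ≤ 2 * m) :
    |c - κ * A| ≤ |c| + 2 * |κ| * m := by
  calc |c - κ * A| ≤ |c| + |κ * A| := abs_sub _ _
    _ = |c| + |κ| * A := by rw [abs_mul, abs_of_nonneg hA]
    _ ≤ |c| + |κ| * (2 * m) := by gcongr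
    _ = |c| + 2 * |κ| * m := by ring

theorem lengthSqBound_le {A m : ℝ} (hA : 0 ≤ A) (hAm : A ≤ m) :
    lengthSqBound c κ A ≤ m * (|c| + 2 * |κ| * m) := by
  have h := abs_sub_mul_le (c := c) (κ := κ) hA (by linarith)
  calc lengthSqBound c κ A = A * (c - κ * A) := by
        unfold lengthSqBound
        ring
    _ ≤ m * (|c| + 2 * |κ| * m) :=
        mul_le_mul_of_nonneg hAm ((le_abs_self _).trans h) hA ((abs_nonneg _).trans h)

theorem bolFunctional_sub_le (hfin : μ Ω ≠ ⊤) (hmeas : ∀ t, MeasurableSet (sublevel u Ω t))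
    (hexp : IntegrableOn (fun x ↦ Real.exp (2 * u x)) Ω μ) {a b : ℝ} (hab : a ≤ b) (hb : b ≤ 0)
    (hPa : 0 ≤ fluxBound μ u Ω κ lam p a) (hPb : 0 ≤ fluxBound μ u Ω κ lam p b) :
    bolFunctional μ u Ω c κ lam p b - bolFunctional μ u Ω c κ lam p a ≤
      4 * μ.real Ω * (|c| + 2 * |κ| * μ.real Ω) * (b - a) := by
  have hl := exp_mul_distribution_sub_le hfin hmeas hexp hab
  have hr := expDistribution_sub_le_exp_mul hfin hmeas hexp hab
  have hβ := monotone_distribution (u := u) hfin hab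
  have hβa := distribution_nonneg (μ := μ) (u := u) (Ω := Ω) a
  have hβb := distribution_le (u := u) hfin b
  unfold bolFunctional
  unfold fluxBound at hPa hPb
  set α := expDistribution μ u Ω
  set β := distribution μ u Ω
  set m := μ.real Ω
  set K := |c| + 2 * |κ| * m
  set w := c - κ * (β a + β b)
  set δ := Real.exp (2 * b) - Real.exp (2 * a)
  have hw : |w| ≤ K := abs_sub_mul_le (by linarith) (by linarith)
  have hK : 0 ≤ K := (abs_nonneg _).trans hw
  have hδ0 : 0 ≤ δ := sub_nonneg.2 (Real.exp_le_exp.2 (by linarith))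
  have hα : 0 ≤ α b - α a := (mul_nonneg (Real.exp_pos _).le (sub_nonneg.2 hβ)).trans hl
  have hdecrease : 0 ≤ (α b - α a) * ((κ * β a - lam * α a + p) + (κ * β b - lam * α b + p)) :=
    mul_nonneg hα (add_nonneg hPa hPb)
  have hgrowth : δ * lengthSqBound c κ (β b) ≤ δ * (m * K) :=
    mul_le_mul_of_nonneg_left (lengthSqBound_le (hβa.trans hβ) hβb) hδ0
  have herror : (Real.exp (2 * a) * (β b - β a) - (α b - α a)) * w ≤ δ * (m * K) := by
    refine (le_abs_self _).trans ?_
    rw [abs_mul, abs_of_nonpos (by linarith), ← mul_assoc]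
    exact mul_le_mul ((by linarith : _ ≤ δ * (β b - β a)).trans
      (mul_le_mul_of_nonneg_left (by linarith) hδ0)) hw (abs_nonneg _) (by positivity)
  have hδK : δ * (m * K) ≤ 2 * (b - a) * (m * K) :=
    mul_le_mul_of_nonneg_right (exp_two_mul_sub_le hab hb) (mul_nonneg measureReal_nonneg hK)
  have hsub := lengthSqBound_sub c κ (β a) (β b)
  linear_combination hgrowth + herror + 2 * hδK + hdecrease + Real.exp (2 * a) * hsub

theorem bolFunctional_le (hfin : μ Ω ≠ ⊤) (hmeas : ∀ t, MeasurableSet (sublevel u Ω t))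
    (hexp : IntegrableOn (fun x ↦ Real.exp (2 * u x)) Ω μ) {A B : ℝ} (hAB : A ≤ B) (hB : B ≤ 0)
    (hflux : ∀ t ≤ B, 0 ≤ fluxBound μ u Ω κ lam p t)
    (hiso : ∀ t < B, ∀ d, HasDerivAt (distribution μ u Ω) d t →
      lengthSqBound c κ (distribution μ u Ω t) ≤ d * fluxBound μ u Ω κ lam p t) :
    bolFunctional μ u Ω c κ lam p B ≤ bolFunctional μ u Ω c κ lam p A := by
  refine le_of_sub_le_of_ae_hasDerivAt_nonpos hAB (fun a b hab hb ↦ bolFunctional_sub_le hfin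
    hmeas hexp hab (hb.trans hB) (hflux a (hab.trans hb)) (hflux b hb)) ?_
  filter_upwards [(monotone_distribution hfin).ae_differentiableAt] with t ht htB
  exact ⟨_, mul_nonpos_of_nonneg_of_nonpos (by positivity)
    (sub_nonpos.2 (hiso t htB _ ht.hasDerivAt)),
    hasDerivAt_bolFunctional hfin hmeas hexp ht.hasDerivAt⟩

end Monotonicity

section Energy

theorem exists_contDiff_support_eq_Ioo {a b ε : ℝ} (hε : 0 < ε) (hεb : 2 * ε < b - a) :
    ∃ φ : ℝ → ℝ, ContDiff ℝ ∞ φ ∧ (∀ s, φ s ∈ Set.Icc 0 1) ∧ Function.support φ = Set.Ioo a b ∧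
      ∀ s ∈ Set.Ioo (a + ε) (b - ε), φ s = 1 := by
  let φ : ContDiffBump ((a + b) / 2) := ⟨(b - a) / 2 - ε, (b - a) / 2, by linarith, by linarith⟩
  refine ⟨φ, φ.contDiff, fun s ↦ ⟨φ.nonneg, φ.le_one⟩, ?_, fun s hs ↦ φ.one_of_mem_closedBall ?_⟩
  · rw [φ.support_eq, Real.ball_eq_Ioo]
    congr 1 <;> simp only [φ] <;> ring
  · rw [Real.closedBall_eq_Icc]
    exact ⟨by simp only [φ]; linarith [hs.1], by simp only [φ]; linarith [hs.2]⟩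

theorem exists_contDiff_antitone_cutoff {a b ε : ℝ} (hε : 0 < ε) (hεb : 2 * ε < b - a) :
    ∃ T : ℝ → ℝ, ContDiff ℝ ∞ T ∧ Antitone T ∧ (∀ s ≤ a, T s = T a) ∧ (∀ s, b ≤ s → T s = 0) ∧
      0 < T a ∧ T a ≤ b - a ∧ ∀ s ∈ Set.Ioo (a + ε) (b - ε), deriv T s = -1 := by
  have hab : a < b := by linarith
  obtain ⟨φ, hφ, hφ01, hsupp, hφ1⟩ := exists_contDiff_support_eq_Ioo hε hεb
  have hφ0 {s : ℝ} (hs : s ∉ Set.Ioo a b) : φ s = 0 := Function.notMem_support.1 (hsupp ▸ hs)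
  have hint (r s : ℝ) : IntervalIntegrable φ volume r s := hφ.continuous.intervalIntegrable r s
  have hderiv (s : ℝ) : HasDerivAt (fun s ↦ ∫ r in s..b, φ r) (-φ s) s :=
    intervalIntegral.integral_hasDerivAt_left (hint s b)
      (hφ.continuous.stronglyMeasurableAtFilter _ _) hφ.continuous.continuousAt
  have hderiv_eq : deriv (fun s ↦ ∫ r in s..b, φ r) = fun s ↦ -φ s :=
    funext fun s ↦ (hderiv s).deriv
  refine ⟨fun s ↦ ∫ r in s..b, φ r, ?_, ?_, fun s hs ↦ ?_, fun s hs ↦ ?_, ?_, ?_, fun s hs ↦ ?_⟩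
  · rw [contDiff_infty_iff_deriv, hderiv_eq]
    exact ⟨fun s ↦ (hderiv s).differentiableAt, hφ.neg⟩
  · refine antitone_of_deriv_nonpos (fun s ↦ (hderiv s).differentiableAt) fun s ↦ ?_
    exact hderiv_eq ▸ neg_nonpos.2 (hφ01 s).1
  · simp only
    rw [← intervalIntegral.integral_add_adjacent_intervals (hint s a) (hint a b), add_eq_right]
    refine intervalIntegral.integral_zero_ae (.of_forall fun r hr ↦ hφ0 fun h ↦ ?_)
    exact (Set.uIoc_of_le hs ▸ hr).2.not_gt h.1
  · refine intervalIntegral.integral_zero_ae (.of_forall fun r hr ↦ hφ0 fun h ↦ ?_)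
    exact (Set.uIoc_of_ge hs ▸ hr).1.not_gt h.2
  · exact intervalIntegral.intervalIntegral_pos_of_pos_on (hint a b)
      (fun s hs ↦ (hφ01 s).1.lt_of_ne' (Function.mem_support.1 (hsupp ▸ hs))) hab
  · calc ∫ r in a..b, φ r ≤ ∫ _ in a..b, (1 : ℝ) :=
          intervalIntegral.integral_mono_on hab.le (hint a b) intervalIntegrable_const
            fun s _ ↦ (hφ01 s).2
      _ = b - a := by simp
  · rw [hderiv_eq, neg_inj]
    exact hφ1 s hs

theorem integrableOn_of_continuousOn_of_bound {X : Type*} [TopologicalSpace X] [MeasurableSpace X]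
    [OpensMeasurableSpace X] [SecondCountableTopologyEither X ℝ] {μ : Measure X} {F : X → ℝ}
    {s : Set X} {C : ℝ} (hs : MeasurableSet s) (hfin : μ s ≠ ⊤) (hF : ContinuousOn F s)
    (hC : ∀ x ∈ s, |F x| ≤ C) : IntegrableOn F s μ :=
  .of_bound hfin.lt_top (hF.aestronglyMeasurable hs) C (ae_restrict_of_forall_mem hs hC)

section Cutoff

variable {M : Type*} {u : M → ℝ} {Ω : Set M} {b : ℝ} {T : ℝ → ℝ}

theorem indicator_comp_eq_zero (hT0 : ∀ s, b ≤ s → T s = 0) {x : M}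
    (hx : x ∉ sublevel u Ω b) : Ω.indicator (T ∘ u) x = 0 := by
  by_cases hxΩ : x ∈ Ω
  · rw [Set.indicator_of_mem hxΩ]
    exact hT0 _ (not_le.1 fun h ↦ hx ⟨hxΩ, h⟩).le
  · exact Set.indicator_of_notMem hxΩ _

variable [TopologicalSpace M]

theorem tsupport_indicator_comp_subset (hc : IsClosed (sublevel u Ω b))
    (hT0 : ∀ s, b ≤ s → T s = 0) : tsupport (Ω.indicator (T ∘ u)) ⊆ sublevel u Ω b :=
  closure_minimal (fun _ hx ↦ by_contra fun h ↦ hx (indicator_comp_eq_zero hT0 h)) hc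

theorem contMDiff_indicator_comp [ChartedSpace Plane M] (hΩ : IsOpen Ω)
    (hu : ContMDiffOn (𝓡 2) 𝓘(ℝ, ℝ) ∞ u Ω) (hc : IsClosed (sublevel u Ω b))
    (hT : ContDiff ℝ ∞ T) (hT0 : ∀ s, b ≤ s → T s = 0) :
    ContMDiff (𝓡 2) 𝓘(ℝ, ℝ) ∞ (Ω.indicator (T ∘ u)) := by
  intro x
  by_cases hx : x ∈ Ω
  · exact (hT.contMDiff.contMDiffAt.comp x (hu.contMDiffAt (hΩ.mem_nhds hx))).congr_of_eventuallyEq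
      (Set.eqOn_indicator.eventuallyEq_of_mem (hΩ.mem_nhds hx))
  · refine (contMDiffAt_const (c := (0 : ℝ))).congr_of_eventuallyEq ?_
    filter_upwards [hc.isOpen_compl.mem_nhds fun h ↦ hx (sublevel_subset u Ω b h)] with z hz
      using indicator_comp_eq_zero hT0 hz

end Cutoff

variable {M : Type*} [TopologicalSpace M] [ChartedSpace Plane M] [IsManifold (𝓡 2) ∞ M]
  [RiemannianBundle (fun x : M ↦ TangentSpace (𝓡 2) x)]
  [IsContMDiffRiemannianBundle (𝓡 2) ∞ Plane (fun x : M ↦ TangentSpace (𝓡 2) x)]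
  [MeasurableSpace M] [BorelSpace M] [SecondCountableTopology M] [T2Space M]
  {u : M → ℝ} {Ω : Set M} {a b C : ℝ} {T : ℝ → ℝ}

theorem setIntegral_comp_mul_laplaceBeltrami (hΩ : IsOpen Ω)
    (hu : ContMDiffOn (𝓡 2) 𝓘(ℝ, ℝ) ∞ u Ω) (hc : IsCompact (sublevel u Ω b))
    (hT : ContDiff ℝ ∞ T) (hT0 : ∀ s, b ≤ s → T s = 0) :
    ∫ x in Ω, T (u x) * laplaceBeltrami u x ∂area M =
      ∫ x in Ω, -deriv T (u x) * gradInner u u x ∂area M := by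
  have hsupp := tsupport_indicator_comp_subset hc.isClosed hT0
  calc ∫ x in Ω, T (u x) * laplaceBeltrami u x ∂area M
      = ∫ x in Ω, Ω.indicator (T ∘ u) x * laplaceBeltrami u x ∂area M :=
        setIntegral_congr_fun hΩ.measurableSet fun x hx ↦ by
          simp only [Set.indicator_of_mem hx, Function.comp_apply]
    _ = -∫ x in Ω, gradInner (Ω.indicator (T ∘ u)) u x ∂area M :=
        setIntegral_mul_laplaceBeltrami hΩ hu
          (contMDiff_indicator_comp hΩ hu hc.isClosed hT hT0)
          (hc.of_isClosed_subset (isClosed_tsupport _) hsupp)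
          (hsupp.trans (sublevel_subset u Ω b))
    _ = ∫ x in Ω, -deriv T (u x) * gradInner u u x ∂area M := by
        rw [← integral_neg]
        refine setIntegral_congr_fun hΩ.measurableSet fun x hx ↦ ?_
        rw [gradInner_congr (Set.eqOn_indicator.eventuallyEq_of_mem (hΩ.mem_nhds hx)),
          Function.comp_def, gradInner_comp (mdifferentiableAt_of_contMDiffOn hΩ hu hx)
            (hT.differentiable (by simp) _), neg_mul]

theorem integrableOn_laplaceBeltrami (hΩ : IsOpen Ω) (hfin : area M Ω ≠ ⊤)
    (hu : ContMDiffOn (𝓡 2) 𝓘(ℝ, ℝ) ∞ u Ω) (hC : ∀ x ∈ Ω, |laplaceBeltrami u x| ≤ C) :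
    IntegrableOn (laplaceBeltrami u) Ω (area M) :=
  integrableOn_of_continuousOn_of_bound hΩ.measurableSet hfin (continuousOn_laplaceBeltrami hΩ hu)
    hC

theorem setIntegral_comp_mul_laplaceBeltrami_le (hΩ : IsOpen Ω) (hfin : area M Ω ≠ ⊤)
    (hu : ContMDiffOn (𝓡 2) 𝓘(ℝ, ℝ) ∞ u Ω) (hab : a ≤ b)
    (hC : ∀ x ∈ Ω, |laplaceBeltrami u x| ≤ C) (hT : Continuous T) (hTanti : Antitone T)
    (hTa : ∀ s ≤ a, T s = T a) (hT0 : ∀ s, b ≤ s → T s = 0) :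
    ∫ x in Ω, T (u x) * laplaceBeltrami u x ∂area M ≤
      T a * (∫ x in sublevel u Ω a, laplaceBeltrami u x ∂area M +
        C * (distribution (area M) u Ω b - distribution (area M) u Ω a)) := by
  have hmeas := measurableSet_sublevel hΩ hu.continuousOn
  have hTnn (s : ℝ) : 0 ≤ T s := (hT0 _ (le_max_right s b)).symm.le.trans (hTanti (le_max_left s b))
  have hTle (s : ℝ) : T s ≤ T a := (hTanti (min_le_left s a)).trans (hTa _ (min_le_right s a)).le
  have hbound {x : M} (hx : x ∈ Ω) : |T (u x) * laplaceBeltrami u x| ≤ T a * C := by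
    rw [abs_mul, abs_of_nonneg (hTnn _)]
    exact mul_le_mul (hTle _) (hC x hx) (abs_nonneg _) (hTnn a)
  have hint : IntegrableOn (fun x ↦ T (u x) * laplaceBeltrami u x) (sublevel u Ω b) (area M) :=
    (integrableOn_of_continuousOn_of_bound hΩ.measurableSet hfin
      ((hT.comp_continuousOn hu.continuousOn).mul (continuousOn_laplaceBeltrami hΩ hu))
      fun x hx ↦ hbound hx).mono_set (sublevel_subset u Ω b)
  have hsub : sublevel u Ω b \ sublevel u Ω a ⊆ Ω := Set.sdiff_subset.trans (sublevel_subset u Ω b)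
  have htop : ∫ x in Ω, T (u x) * laplaceBeltrami u x ∂area M =
      ∫ x in sublevel u Ω b, T (u x) * laplaceBeltrami u x ∂area M :=
    setIntegral_eq_of_subset_of_forall_sdiff_eq_zero hΩ.measurableSet (sublevel_subset u Ω b)
      fun x hx ↦ by rw [hT0 _ (not_le.1 fun h ↦ hx.2 ⟨hx.1, h⟩).le, zero_mul]
  have hbot : ∫ x in sublevel u Ω a, T (u x) * laplaceBeltrami u x ∂area M =
      T a * ∫ x in sublevel u Ω a, laplaceBeltrami u x ∂area M := by
    rw [← integral_const_mul]
    exact setIntegral_congr_fun (hmeas a) fun x hx ↦ by simp only [hTa _ hx.2]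
  have hmid : ∫ x in sublevel u Ω b \ sublevel u Ω a, T (u x) * laplaceBeltrami u x ∂area M ≤
      T a * C * (distribution (area M) u Ω b - distribution (area M) u Ω a) := by
    rw [← measureReal_sublevel_sdiff hfin hmeas hab]
    exact (Real.le_norm_self _).trans (norm_setIntegral_le_of_norm_le_const
      (measure_ne_top_of_subset hsub hfin).lt_top fun x hx ↦ hbound (hsub hx))
  have hsplit := setIntegral_sdiff (hmeas a) hint (monotone_sublevel u Ω hab)
  linear_combination htop + hbot + hmid - hsplit

theorem setIntegral_laplaceBeltrami_add_nonneg (hΩ : IsOpen Ω) (hfin : area M Ω ≠ ⊤)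
    (hu : ContMDiffOn (𝓡 2) 𝓘(ℝ, ℝ) ∞ u Ω) (hab : a < b) (hc : IsCompact (sublevel u Ω b))
    (hC : ∀ x ∈ Ω, |laplaceBeltrami u x| ≤ C) :
    0 ≤ ∫ x in sublevel u Ω a, laplaceBeltrami u x ∂area M +
      C * (distribution (area M) u Ω b - distribution (area M) u Ω a) := by
  obtain ⟨T, hT, hTanti, hTa, hT0, hTpos, -⟩ := exists_contDiff_antitone_cutoff (a := a) (b := b)
    (ε := (b - a) / 4) (by linarith) (by linarith)
  refine nonneg_of_mul_nonneg_right ?_ hTpos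
  calc 0 ≤ ∫ x in Ω, -deriv T (u x) * gradInner u u x ∂area M := integral_nonneg fun x ↦
        mul_nonneg (neg_nonneg.2 hTanti.deriv_nonpos) (gradInner_self_nonneg u x)
    _ = ∫ x in Ω, T (u x) * laplaceBeltrami u x ∂area M :=
        (setIntegral_comp_mul_laplaceBeltrami hΩ hu hc hT hT0).symm
    _ ≤ _ := setIntegral_comp_mul_laplaceBeltrami_le hΩ hfin hu hab.le hC hT.continuous hTanti hTa
        hT0

theorem setIntegral_laplaceBeltrami_sublevel_nonneg (hΩ : IsOpen Ω) (hfin : area M Ω ≠ ⊤)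
    (hu : ContMDiffOn (𝓡 2) 𝓘(ℝ, ℝ) ∞ u Ω) {b₀ : ℝ} (hab : a < b₀)
    (hc : ∀ b < b₀, IsCompact (sublevel u Ω b)) (hC : ∀ x ∈ Ω, |laplaceBeltrami u x| ≤ C) :
    0 ≤ ∫ x in sublevel u Ω a, laplaceBeltrami u x ∂area M := by
  have hlim := (((tendsto_distribution_nhdsGT hfin
    (measurableSet_sublevel hΩ hu.continuousOn) a).sub_const
      (distribution (area M) u Ω a)).const_mul C).const_add
        (∫ x in sublevel u Ω a, laplaceBeltrami u x ∂area M)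
  rw [sub_self, mul_zero, add_zero] at hlim
  refine ge_of_tendsto hlim ?_
  filter_upwards [Ioo_mem_nhdsGT hab] with b hb using
    setIntegral_laplaceBeltrami_add_nonneg hΩ hfin hu hb.1 (hc b hb.2) hC

end Energy

section Isoperimetric

theorem sq_lintegral_le {X : Type*} [MeasurableSpace X] {μ : Measure X} {F : X → ℝ≥0∞}
    (hF : AEMeasurable F μ) : (∫⁻ x, F x ∂μ) ^ 2 ≤ μ Set.univ * ∫⁻ x, F x ^ 2 ∂μ := by
  have h := ENNReal.lintegral_mul_le_Lp_mul_Lq μ Real.HolderConjugate.two_two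
    (aemeasurable_const (b := (1 : ℝ≥0∞))) hF
  simp only [Pi.mul_apply, one_mul, ENNReal.rpow_two, one_pow, lintegral_one] at h
  calc (∫⁻ x, F x ∂μ) ^ 2
      ≤ ((μ Set.univ) ^ (1 / 2 : ℝ) * (∫⁻ x, F x ^ 2 ∂μ) ^ (1 / 2 : ℝ)) ^ 2 := by gcongr
    _ = μ Set.univ * ∫⁻ x, F x ^ 2 ∂μ := by
        rw [mul_pow, ← ENNReal.rpow_mul_natCast, ← ENNReal.rpow_mul_natCast]
        norm_num

section Strip

variable {M : Type*} [TopologicalSpace M] [ChartedSpace Plane M] {u : M → ℝ} {Ω : Set M}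
  {a b : ℝ}

/-- The regular points of `u` in `Ω` at which `u` takes a value in `(a, b)`. -/
def regularStrip (u : M → ℝ) (Ω : Set M) (a b : ℝ) : Set M :=
  {x ∈ Ω | mfderiv (𝓡 2) 𝓘(ℝ, ℝ) u x ≠ 0} ∩ u ⁻¹' Set.Ioo a b

theorem regularStrip_subset (u : M → ℝ) (Ω : Set M) (a b : ℝ) : regularStrip u Ω a b ⊆ Ω :=
  fun _ hx ↦ hx.1.1

theorem isOpen_regularStrip [IsManifold (𝓡 2) ∞ M] (hΩ : IsOpen Ω)
    (hu : ContMDiffOn (𝓡 2) 𝓘(ℝ, ℝ) ∞ u Ω) : IsOpen (regularStrip u Ω a b) :=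
  (hu.continuousOn.mono fun _ hx ↦ hx.1).isOpen_inter_preimage (isOpen_regular hΩ hu) isOpen_Ioo

theorem measure_regularStrip_le [MeasurableSpace M] [OpensMeasurableSpace M] {μ : Measure M}
    {ε : ℝ} (hΩ : IsOpen Ω) (hfin : μ Ω ≠ ⊤) (hu : ContinuousOn u Ω) (hab : a ≤ b) (hε : 0 ≤ ε) :
    μ (regularStrip u Ω (a + ε) (b - ε)) ≤
      ENNReal.ofReal (distribution μ u Ω b - distribution μ u Ω a) := by
  have hsub : regularStrip u Ω (a + ε) (b - ε) ⊆ sublevel u Ω b \ sublevel u Ω a := fun x hx ↦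
    mem_sublevel_sdiff.2 ⟨hx.1.1, by linarith [hx.2.1], by linarith [hx.2.2]⟩
  have hne : μ (sublevel u Ω b \ sublevel u Ω a) ≠ ⊤ :=
    measure_ne_top_of_subset (Set.sdiff_subset.trans (sublevel_subset u Ω b)) hfin
  rw [← measureReal_sublevel_sdiff hfin (measurableSet_sublevel hΩ hu) hab, ofReal_measureReal hne]
  exact measure_mono hsub

end Strip

variable {M : Type*} [EMetricSpace M] [ChartedSpace Plane M] [IsManifold (𝓡 2) ∞ M]
  [RiemannianBundle (fun x : M ↦ TangentSpace (𝓡 2) x)]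
  [IsContMDiffRiemannianBundle (𝓡 2) ∞ Plane (fun x : M ↦ TangentSpace (𝓡 2) x)]
  [MeasurableSpace M] [BorelSpace M] [SecondCountableTopology M]
  {u : M → ℝ} {Ω : Set M} {a b C q θ κ : ℝ}

theorem lintegral_gradInner_regularStrip_le {ε : ℝ} (hΩ : IsOpen Ω) (hfin : area M Ω ≠ ⊤)
    (hu : ContMDiffOn (𝓡 2) 𝓘(ℝ, ℝ) ∞ u Ω) (hc : IsCompact (sublevel u Ω b))
    (hC : ∀ x ∈ Ω, |laplaceBeltrami u x| ≤ C) (hε : 0 < ε) (hεb : 2 * ε < b - a) :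
    ∫⁻ x in regularStrip u Ω (a + ε) (b - ε), ENNReal.ofReal (gradInner u u x) ∂area M ≤
      ENNReal.ofReal ((b - a) * (∫ x in sublevel u Ω a, laplaceBeltrami u x ∂area M +
        C * (distribution (area M) u Ω b - distribution (area M) u Ω a))) := by
  have hab : a < b := by linarith
  obtain ⟨T, hT, hTanti, hTa, hT0, -, hTab, hderiv⟩ := exists_contDiff_antitone_cutoff hε hεb
  have hnn (x : M) : 0 ≤ -deriv T (u x) * gradInner u u x :=
    mul_nonneg (neg_nonneg.2 hTanti.deriv_nonpos) (gradInner_self_nonneg u x)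
  have hint : IntegrableOn (fun x ↦ -deriv T (u x) * gradInner u u x) Ω (area M) := by
    refine integrableOn_of_continuousOn_of_eq_zero_off hΩ.measurableSet
      (((hT.continuous_deriv (by simp)).comp_continuousOn hu.continuousOn).neg.mul
        (continuousOn_gradInner hΩ hu hu)) hc (sublevel_subset u Ω b) fun x hx hxb ↦ ?_
    have hT0' : T =ᶠ[𝓝 (u x)] fun _ ↦ 0 :=
      (eventually_gt_nhds (not_le.1 fun h ↦ hxb ⟨hx, h⟩)).mono fun s hs ↦ hT0 s hs.le
    rw [hT0'.deriv_eq, deriv_const, neg_zero, zero_mul]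
  calc ∫⁻ x in regularStrip u Ω (a + ε) (b - ε), ENNReal.ofReal (gradInner u u x) ∂area M
      = ∫⁻ x in regularStrip u Ω (a + ε) (b - ε),
          ENNReal.ofReal (-deriv T (u x) * gradInner u u x) ∂area M :=
        setLIntegral_congr_fun (isOpen_regularStrip hΩ hu).measurableSet fun x hx ↦ by
          simp only [hderiv _ hx.2, neg_neg, one_mul]
    _ ≤ ∫⁻ x in Ω, ENNReal.ofReal (-deriv T (u x) * gradInner u u x) ∂area M :=
        lintegral_mono_set (regularStrip_subset u Ω _ _)
    _ = ENNReal.ofReal (∫ x in Ω, -deriv T (u x) * gradInner u u x ∂area M) :=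
        (ofReal_integral_eq_lintegral_ofReal hint (.of_forall hnn)).symm
    _ ≤ _ := by
        refine ENNReal.ofReal_le_ofReal ?_
        rw [← setIntegral_comp_mul_laplaceBeltrami hΩ hu hc hT hT0]
        exact (setIntegral_comp_mul_laplaceBeltrami_le hΩ hfin hu hab.le hC hT.continuous hTanti
          hTa hT0).trans (mul_le_mul_of_nonneg_right hTab
            (setIntegral_laplaceBeltrami_add_nonneg hΩ hfin hu hab hc hC))

variable [IsRiemannianManifold (𝓡 2) M]

theorem mul_sqrt_le_lintegral_sqrt_gradInner (hM : IsoperimetricInequality M θ κ)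
    (hΩ : IsOpen Ω) (hu : ContMDiffOn (𝓡 2) 𝓘(ℝ, ℝ) ∞ u Ω)
    (hc : ∀ t ∈ Set.Ioo a b, IsCompact (sublevel u Ω t))
    (hq : ∀ t ∈ Set.Ioo a b,
      q ≤ lengthSqBound (4 * Real.pi * θ) κ (distribution (area M) u Ω t)) :
    ENNReal.ofReal (√q * (b - a)) ≤
      ∫⁻ x in regularStrip u Ω a b, ENNReal.ofReal √(gradInner u u x) ∂area M := by
  obtain ⟨h, -, hle, hint⟩ := exists_measurable_hausdorffMeasure_le hΩ hu
    (isOpen_regularStrip (a := a) (b := b) hΩ hu).measurableSet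
    (regularStrip_subset u Ω a b) fun x hx ↦ hx.1.2
  have hlength : ∀ᵐ t, t ∈ Set.Ioo a b → ENNReal.ofReal √q ≤ h t := by
    filter_upwards [measure_eq_zero_iff_ae_notMem.1
      (volume_image_critical_eq_zero_of_contMDiffOn hΩ hu)] with t ht htab
    have hdomain := isCompactSmoothDomain_sublevel hΩ hu (hc t htab) ht
    have hfrontier : frontier (sublevel u Ω t) ⊆ {x ∈ regularStrip u Ω a b | u x = t} := by
      refine (frontier_sublevel_subset hΩ hu.continuousOn (hc t htab).isClosed).trans ?_
      rintro x ⟨hxΩ, rfl⟩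
      exact ⟨⟨⟨hxΩ, fun h0 ↦ ht ⟨x, ⟨hxΩ, h0⟩, rfl⟩⟩, htab⟩, rfl⟩
    calc ENNReal.ofReal √q
        ≤ ENNReal.ofReal ((Measure.hausdorffMeasure 1 : Measure M).real
            (frontier (sublevel u Ω t))) :=
          ENNReal.ofReal_le_ofReal
            ((Real.sqrt_le_left measureReal_nonneg).2 ((hq t htab).trans (hM _ hdomain)))
      _ ≤ Measure.hausdorffMeasure 1 (frontier (sublevel u Ω t)) := ENNReal.ofReal_toReal_le
      _ ≤ h t := (measure_mono hfrontier).trans (hle t)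
  calc ENNReal.ofReal (√q * (b - a))
      = ∫⁻ _ in Set.Ioo a b, ENNReal.ofReal √q := by
        rw [setLIntegral_const, Real.volume_Ioo, ENNReal.ofReal_mul (Real.sqrt_nonneg q)]
    _ ≤ ∫⁻ t in Set.Ioo a b, h t :=
        lintegral_mono_ae ((ae_restrict_iff' measurableSet_Ioo).2 hlength)
    _ ≤ ∫⁻ t, h t := setLIntegral_le_lintegral _ _
    _ = _ := hint

theorem sq_mul_le_of_isoperimetricInequality {ε : ℝ} (hM : IsoperimetricInequality M θ κ)
    (hΩ : IsOpen Ω) (hfin : area M Ω ≠ ⊤) (hu : ContMDiffOn (𝓡 2) 𝓘(ℝ, ℝ) ∞ u Ω)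
    (hc : ∀ t ≤ b, IsCompact (sublevel u Ω t)) (hC : ∀ x ∈ Ω, |laplaceBeltrami u x| ≤ C)
    (hq0 : 0 ≤ q) (hq : ∀ t ∈ Set.Ioo a b,
      q ≤ lengthSqBound (4 * Real.pi * θ) κ (distribution (area M) u Ω t))
    (hε : 0 < ε) (hεb : 2 * ε < b - a) :
    (b - a - 2 * ε) ^ 2 * q ≤ (b - a) *
      ((distribution (area M) u Ω b - distribution (area M) u Ω a) *
        (∫ x in sublevel u Ω a, laplaceBeltrami u x ∂area M +
          C * (distribution (area M) u Ω b - distribution (area M) u Ω a))) := by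
  have hab : a < b := by linarith
  have hE := setIntegral_laplaceBeltrami_add_nonneg hΩ hfin hu hab (hc b le_rfl) hC
  set S := regularStrip u Ω (a + ε) (b - ε)
  set m := distribution (area M) u Ω b - distribution (area M) u Ω a
  set E := ∫ x in sublevel u Ω a, laplaceBeltrami u x ∂area M + C * m
  have hm : 0 ≤ m := sub_nonneg.2 (monotone_distribution hfin hab.le)
  have hlength : ENNReal.ofReal (√q * (b - a - 2 * ε)) ≤
      ∫⁻ x in S, ENNReal.ofReal √(gradInner u u x) ∂area M := by
    have h := mul_sqrt_le_lintegral_sqrt_gradInner hM hΩ hu (a := a + ε) (b := b - ε) (q := q)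
      (fun t ht ↦ hc t (by linarith [ht.2])) fun t ht ↦
        hq t ⟨by linarith [ht.1], by linarith [ht.2]⟩
    rwa [show b - ε - (a + ε) = b - a - 2 * ε by ring] at h
  have hsqrt : AEMeasurable (fun x ↦ ENNReal.ofReal √(gradInner u u x)) ((area M).restrict S) :=
    (((continuousOn_gradInner hΩ hu hu).sqrt.mono
      (regularStrip_subset u Ω _ _)).aemeasurable
        (isOpen_regularStrip hΩ hu).measurableSet).ennreal_ofReal
  have hcs : ENNReal.ofReal ((√q * (b - a - 2 * ε)) ^ 2) ≤ ENNReal.ofReal (m * ((b - a) * E)) :=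
    calc ENNReal.ofReal ((√q * (b - a - 2 * ε)) ^ 2)
        = ENNReal.ofReal (√q * (b - a - 2 * ε)) ^ 2 :=
          ENNReal.ofReal_pow (mul_nonneg (Real.sqrt_nonneg q) (by linarith)) 2
      _ ≤ (∫⁻ x in S, ENNReal.ofReal √(gradInner u u x) ∂area M) ^ 2 := by gcongr
      _ ≤ area M S * ∫⁻ x in S, ENNReal.ofReal √(gradInner u u x) ^ 2 ∂area M := by
          simpa only [Measure.restrict_apply_univ] using sq_lintegral_le hsqrt
      _ = area M S * ∫⁻ x in S, ENNReal.ofReal (gradInner u u x) ∂area M := by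
          simp only [← ENNReal.ofReal_pow (Real.sqrt_nonneg _),
            Real.sq_sqrt (gradInner_self_nonneg u _)]
      _ ≤ ENNReal.ofReal m * ENNReal.ofReal ((b - a) * E) :=
          mul_le_mul' (measure_regularStrip_le hΩ hfin hu.continuousOn hab.le hε.le)
            (lintegral_gradInner_regularStrip_le hΩ hfin hu (hc b le_rfl) hC hε hεb)
      _ = ENNReal.ofReal (m * ((b - a) * E)) := (ENNReal.ofReal_mul hm).symm
  rw [ENNReal.ofReal_le_ofReal_iff (mul_nonneg hm (mul_nonneg (by linarith) hE)), mul_pow,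
    Real.sq_sqrt hq0] at hcs
  linarith

theorem sub_mul_le_of_isoperimetricInequality (hM : IsoperimetricInequality M θ κ)
    (hΩ : IsOpen Ω) (hfin : area M Ω ≠ ⊤) (hu : ContMDiffOn (𝓡 2) 𝓘(ℝ, ℝ) ∞ u Ω) (hab : a < b)
    (hc : ∀ t ≤ b, IsCompact (sublevel u Ω t)) (hC : ∀ x ∈ Ω, |laplaceBeltrami u x| ≤ C)
    (hq0 : 0 ≤ q) (hq : ∀ t ∈ Set.Ioo a b,
      q ≤ lengthSqBound (4 * Real.pi * θ) κ (distribution (area M) u Ω t)) :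
    (b - a) * q ≤ (distribution (area M) u Ω b - distribution (area M) u Ω a) *
      (∫ x in sublevel u Ω a, laplaceBeltrami u x ∂area M +
        C * (distribution (area M) u Ω b - distribution (area M) u Ω a)) := by
  have hlim : Filter.Tendsto (fun ε : ℝ ↦ (b - a - 2 * ε) ^ 2 * q) (𝓝[>] 0)
      (𝓝 ((b - a - 2 * 0) ^ 2 * q)) :=
    ((by fun_prop : Continuous fun ε : ℝ ↦ (b - a - 2 * ε) ^ 2 * q).tendsto 0).mono_left
      nhdsWithin_le_nhds
  have hsq := le_of_tendsto hlim (by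
    filter_upwards [Ioo_mem_nhdsGT (half_pos (sub_pos.2 hab))] with ε hε using
      sq_mul_le_of_isoperimetricInequality hM hΩ hfin hu hc hC hq0 hq hε.1 (by linarith [hε.2]))
  refine le_of_mul_le_mul_left ?_ (sub_pos.2 hab)
  linarith

theorem lengthSqBound_le_of_hasDerivAt_distribution {t b₀ d : ℝ}
    (hM : IsoperimetricInequality M θ κ) (hΩ : IsOpen Ω) (hfin : area M Ω ≠ ⊤)
    (hu : ContMDiffOn (𝓡 2) 𝓘(ℝ, ℝ) ∞ u Ω) (ht : t < b₀)
    (hc : ∀ b < b₀, IsCompact (sublevel u Ω b)) (hC : ∀ x ∈ Ω, |laplaceBeltrami u x| ≤ C)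
    (hd : HasDerivAt (distribution (area M) u Ω) d t) :
    lengthSqBound (4 * Real.pi * θ) κ (distribution (area M) u Ω t) ≤
      d * ∫ x in sublevel u Ω t, laplaceBeltrami u x ∂area M := by
  set β := distribution (area M) u Ω
  set E := ∫ x in sublevel u Ω t, laplaceBeltrami u x ∂area M
  have hd0 : 0 ≤ d := hd.deriv ▸ (monotone_distribution hfin).deriv_nonneg
  have hE : 0 ≤ E := setIntegral_laplaceBeltrami_sublevel_nonneg hΩ hfin hu ht hc hC
  refine le_of_forall_lt_imp_le_of_dense fun q hq ↦ ?_
  rcases lt_or_ge q 0 with hq0 | hq0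
  · exact hq0.le.trans (mul_nonneg hd0 hE)
  have hcont : ContinuousAt (fun s ↦ lengthSqBound (4 * Real.pi * θ) κ (β s)) t :=
    (hd.continuousAt.const_mul _).sub ((hd.continuousAt.pow 2).const_mul κ)
  obtain ⟨r, hr, hqr⟩ := mem_nhdsGT_iff_exists_Ioo_subset.1
    (nhdsWithin_le_nhds (hcont.eventually_const_lt hq))
  have hslope : Filter.Tendsto (slope β t) (𝓝[>] t) (𝓝 d) :=
    (hasDerivAt_iff_tendsto_slope.1 hd).mono_left (nhdsWithin_mono t fun _ h ↦ ne_of_gt h)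
  have hincr : Filter.Tendsto (fun b ↦ E + C * (β b - β t)) (𝓝[>] t) (𝓝 E) := by
    simpa using ((hd.continuousAt.tendsto.mono_left nhdsWithin_le_nhds).sub_const
      (β t)).const_mul C |>.const_add E
  refine ge_of_tendsto (hslope.mul hincr) ?_
  filter_upwards [Ioo_mem_nhdsGT hr, Ioo_mem_nhdsGT ht] with b hbr hb
  have h := sub_mul_le_of_isoperimetricInequality hM hΩ hfin hu hb.1
    (fun s hs ↦ hc s (hs.trans_lt hb.2)) hC hq0 fun s hs ↦ (hqr ⟨hs.1, hs.2.trans hbr.2⟩).le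
  rw [slope_def_field, div_mul_eq_mul_div, le_div_iff₀ (sub_pos.2 hb.1), mul_comm q]
  exact h

end Isoperimetric

section Bol

section Exp

variable {X : Type*} [TopologicalSpace X] [MeasurableSpace X] [OpensMeasurableSpace X]
  [SecondCountableTopologyEither X ℝ] {μ : Measure X} {u : X → ℝ} {Ω : Set X}

theorem integrableOn_exp_two_mul (hΩ : MeasurableSet Ω) (hfin : μ Ω ≠ ⊤) (hu : ContinuousOn u Ω)
    (hneg : ∀ x ∈ Ω, u x ≤ 0) : IntegrableOn (fun x ↦ Real.exp (2 * u x)) Ω μ := by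
  refine integrableOn_of_continuousOn_of_bound (C := 1) hΩ hfin
    (Real.continuous_exp.comp_continuousOn (hu.const_mul 2)) fun x hx ↦ ?_
  rw [abs_of_pos (Real.exp_pos _), Real.exp_le_one_iff]
  linarith [hneg x hx]

theorem setIntegral_exp_lt_measureReal (hΩ : MeasurableSet Ω) (hpos : 0 < μ Ω) (hfin : μ Ω ≠ ⊤)
    (hu : ContinuousOn u Ω) (hneg : ∀ x ∈ Ω, u x < 0) :
    ∫ x in Ω, Real.exp (2 * u x) ∂μ < μ.real Ω := by
  have hexp := integrableOn_exp_two_mul hΩ hfin hu fun x hx ↦ (hneg x hx).le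
  have hone : IntegrableOn (fun _ : X ↦ (1 : ℝ)) Ω μ := integrableOn_const hfin
  have hlt : ∀ x ∈ Ω, 0 < 1 - Real.exp (2 * u x) := fun x hx ↦
    sub_pos.2 (Real.exp_lt_one_iff.2 (by linarith [hneg x hx]))
  have h : 0 < ∫ x in Ω, (1 - Real.exp (2 * u x)) ∂μ := by
    rw [setIntegral_pos_iff_support_of_nonneg_ae
      (ae_restrict_of_forall_mem hΩ fun x hx ↦ (hlt x hx).le) (hone.sub hexp)]
    exact hpos.trans_le (measure_mono fun x hx ↦ ⟨(hlt x hx).ne', hx⟩)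
  rw [integral_sub hone hexp, setIntegral_const, smul_eq_mul, mul_one] at h
  exact sub_pos.1 h

end Exp

variable {M : Type*} [EMetricSpace M] [ChartedSpace Plane M] [IsManifold (𝓡 2) ∞ M]
  [RiemannianBundle (fun x : M ↦ TangentSpace (𝓡 2) x)]
  [IsContMDiffRiemannianBundle (𝓡 2) ∞ Plane (fun x : M ↦ TangentSpace (𝓡 2) x)]
  [MeasurableSpace M] [BorelSpace M] [SecondCountableTopology M]
  {u f : M → ℝ} {Ω : Set M} {θ κ lam C B : ℝ}

theorem area_ne_top_of_isCompact_closure (hΩc : IsCompact (closure Ω)) : area M Ω ≠ ⊤ :=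
  measure_ne_top_of_subset subset_closure hΩc.measure_lt_top.ne

theorem setIntegral_laplaceBeltrami_sublevel_le (hΩ : IsOpen Ω) (hfin : area M Ω ≠ ⊤)
    (hu : ContMDiffOn (𝓡 2) 𝓘(ℝ, ℝ) ∞ u Ω) (hC : ∀ x ∈ Ω, |laplaceBeltrami u x| ≤ C)
    (hexp : IntegrableOn (fun x ↦ Real.exp (2 * u x)) Ω (area M))
    (heq : ∀ x ∈ Ω, -laplaceBeltrami u x + κ = lam * Real.exp (2 * u x) + f x) (t : ℝ) :
    ∫ x in sublevel u Ω t, laplaceBeltrami u x ∂area M ≤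
      fluxBound (area M) u Ω κ lam (∫ x in Ω, (f x)⁻ ∂area M) t := by
  have hL : IntegrableOn (laplaceBeltrami u) Ω (area M) :=
    integrableOn_laplaceBeltrami hΩ hfin hu hC
  have hκ : IntegrableOn (fun _ : M ↦ κ) Ω (area M) := integrableOn_const hfin
  have hg : IntegrableOn (fun x ↦ κ - lam * Real.exp (2 * u x)) Ω (area M) :=
    hκ.sub (hexp.const_mul lam)
  have hf : IntegrableOn (fun x ↦ (f x)⁻) Ω (area M) := by
    refine ((hg.sub hL).congr_fun (fun x hx ↦ ?_) hΩ.measurableSet).neg_part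
    simp only [Pi.sub_apply]
    linarith [heq x hx]
  have hsub := sublevel_subset u Ω t
  calc ∫ x in sublevel u Ω t, laplaceBeltrami u x ∂area M
      ≤ ∫ x in sublevel u Ω t, (κ - lam * Real.exp (2 * u x) + (f x)⁻) ∂area M := by
        refine setIntegral_mono_on (hL.mono_set hsub) ((hg.add hf).mono_set hsub)
          (measurableSet_sublevel hΩ hu.continuousOn t) fun x hx ↦ ?_
        linarith [heq x (hsub hx), neg_le_negPart (f x)]
    _ = κ * distribution (area M) u Ω t - lam * expDistribution (area M) u Ω t +
          ∫ x in sublevel u Ω t, (f x)⁻ ∂area M := by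
        rw [integral_add (hg.mono_set hsub) (hf.mono_set hsub),
          integral_sub (hκ.mono_set hsub) ((hexp.mono_set hsub).const_mul lam), setIntegral_const,
          integral_const_mul, smul_eq_mul, mul_comm, distribution, expDistribution]
    _ ≤ fluxBound (area M) u Ω κ lam (∫ x in Ω, (f x)⁻ ∂area M) t :=
        add_le_add_right (setIntegral_mono_set hf (.of_forall fun x ↦ negPart_nonneg _)
          hsub.eventuallyLE) _

variable [IsRiemannianManifold (𝓡 2) M]

theorem bolFunctional_nonpos (hM : IsoperimetricInequality M θ κ) (hΩ : IsOpen Ω)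
    (hΩc : IsCompact (closure Ω)) (hu : ContMDiffOn (𝓡 2) 𝓘(ℝ, ℝ) ∞ u (closure Ω))
    (heq : ∀ x ∈ Ω, -laplaceBeltrami u x + κ = lam * Real.exp (2 * u x) + f x)
    (hbd : ∀ x ∈ frontier Ω, u x = 0) (hneg : ∀ x ∈ Ω, u x ≤ 0) (hB : B < 0) :
    bolFunctional (area M) u Ω (4 * Real.pi * θ) κ lam (∫ x in Ω, (f x)⁻ ∂area M) B ≤ 0 := by
  have hfin := area_ne_top_of_isCompact_closure (M := M) hΩc
  have huΩ := hu.mono subset_closure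
  have hexp := integrableOn_exp_two_mul hΩ.measurableSet hfin huΩ.continuousOn hneg
  obtain ⟨C, hC⟩ := exists_bound_laplaceBeltrami hΩ hΩc hu
  have hcompact : ∀ t < 0, IsCompact (sublevel u Ω t) := fun t ht ↦
    isCompact_sublevel hΩ hΩc hu.continuousOn hbd ht
  have hflux := setIntegral_laplaceBeltrami_sublevel_le hΩ hfin huΩ hC hexp heq
  obtain ⟨A, hA⟩ := exists_forall_le_sublevel_eq_empty hΩc hu.continuousOn
  calc bolFunctional (area M) u Ω (4 * Real.pi * θ) κ lam (∫ x in Ω, (f x)⁻ ∂area M) B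
      ≤ bolFunctional (area M) u Ω (4 * Real.pi * θ) κ lam (∫ x in Ω, (f x)⁻ ∂area M)
          (min A B) := by
        refine bolFunctional_le hfin (measurableSet_sublevel hΩ huΩ.continuousOn) hexp
          (min_le_right A B) hB.le (fun t ht ↦ ?_) fun t ht d hd ↦ ?_
        · exact (setIntegral_laplaceBeltrami_sublevel_nonneg hΩ hfin huΩ (ht.trans_lt hB)
            hcompact hC).trans (hflux t)
        · exact (lengthSqBound_le_of_hasDerivAt_distribution hM hΩ hfin huΩ (ht.trans hB) hcompact
            hC hd).trans (mul_le_mul_of_nonneg_left (hflux t)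
              (hd.deriv ▸ (monotone_distribution hfin).deriv_nonneg))
    _ = 0 := by
        simp [bolFunctional, lengthSqBound, distribution, expDistribution, hA _ (min_le_left A B)]

theorem bol_inequality (hM : IsoperimetricInequality M θ κ) (hΩ : IsOpen Ω)
    (hΩc : IsCompact (closure Ω)) (hu : ContMDiffOn (𝓡 2) 𝓘(ℝ, ℝ) ∞ u (closure Ω))
    (heq : ∀ x ∈ Ω, -laplaceBeltrami u x + κ = lam * Real.exp (2 * u x) + f x)
    (hbd : ∀ x ∈ frontier Ω, u x = 0) (hneg : ∀ x ∈ Ω, u x < 0) :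
    4 * Real.pi * θ * (area M).real Ω - κ * (area M).real Ω ^ 2 ≤
      (4 * Real.pi * θ + 2 * ∫ x in Ω, (f x)⁻ ∂area M) *
        (∫ x in Ω, Real.exp (2 * u x) ∂area M) -
      lam * (∫ x in Ω, Real.exp (2 * u x) ∂area M) ^ 2 := by
  have hfin := area_ne_top_of_isCompact_closure (M := M) hΩc
  have huΩ := hu.continuousOn.mono subset_closure
  have hmeas := measurableSet_sublevel hΩ huΩ
  have hβ := tendsto_distribution_nhdsLT hΩ.measurableSet hfin hmeas hneg
  have hα := tendsto_setIntegral_sublevel hΩ.measurableSet hmeas hneg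
    (integrableOn_exp_two_mul hΩ.measurableSet hfin huΩ fun x hx ↦ (hneg x hx).le)
  have hexp : Filter.Tendsto (fun t : ℝ ↦ Real.exp (2 * t)) (𝓝[<] 0) (𝓝 (Real.exp (2 * 0))) :=
    ((by fun_prop : Continuous fun t : ℝ ↦ Real.exp (2 * t)).tendsto 0).mono_left
      nhdsWithin_le_nhds
  have hlim := ((hexp.mul ((hβ.const_mul (4 * Real.pi * θ)).sub ((hβ.pow 2).const_mul κ))).sub
    (hα.const_mul (4 * Real.pi * θ + 2 * ∫ x in Ω, (f x)⁻ ∂area M))).add ((hα.pow 2).const_mul lam)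
  have h := le_of_tendsto hlim (eventually_mem_nhdsWithin.mono fun t ht ↦
    bolFunctional_nonpos hM hΩ hΩc hu heq hbd (fun x hx ↦ (hneg x hx).le) ht)
  rw [mul_zero, Real.exp_zero] at h
  linarith

end Bol

end RiemannianSurface

theorem theorem3p2_general
    {M : Type*} [EMetricSpace M] [SecondCountableTopology M]
    [MeasurableSpace M] [BorelSpace M]
    [ChartedSpace RiemannianSurface.Plane M] [IsManifold (𝓡 2) ∞ M]
    [RiemannianBundle (fun x : M ↦ TangentSpace (𝓡 2) x)]
    [IsContMDiffRiemannianBundle (𝓡 2) ∞ RiemannianSurface.Plane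
      (fun x : M ↦ TangentSpace (𝓡 2) x)]
    [IsRiemannianManifold (𝓡 2) M]
    (θ κ : ℝ)
    (hM : RiemannianSurface.IsoperimetricInequality M θ κ)
    (Ω : Set M) (hΩ : IsOpen Ω) (hΩne : Ω.Nonempty) (hΩc : IsCompact (closure Ω))
    (u f : M → ℝ) (lam Θ : ℝ)
    (hu : ContMDiffOn (𝓡 2) 𝓘(ℝ, ℝ) ∞ u (closure Ω))
    (heq : ∀ x ∈ Ω, -RiemannianSurface.laplaceBeltrami u x + κ
      = lam * Real.exp (2 * u x) + f x)
    (hbd : ∀ x ∈ frontier Ω, u x = 0)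
    (hneg : ∀ x ∈ Ω, u x < 0)
    (hΘ : Θ = 1 / (2 * Real.pi) * ∫ x in Ω, (f x)⁻ ∂(RiemannianSurface.area M)) :
    4 * Real.pi * θ * (RiemannianSurface.area M).real Ω
        - κ * (RiemannianSurface.area M).real Ω ^ 2
      ≤ 4 * Real.pi * (θ + Θ) * (∫ x in Ω, Real.exp (2 * u x) ∂(RiemannianSurface.area M))
        - lam * (∫ x in Ω, Real.exp (2 * u x) ∂(RiemannianSurface.area M)) ^ 2
    ∧ (Θ = 0 → lam = κ → 0 < lam →
      4 * Real.pi * θ / lam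
        ≤ (∫ x in Ω, Real.exp (2 * u x) ∂(RiemannianSurface.area M))
          + (RiemannianSurface.area M).real Ω) := by
  have hfin := RiemannianSurface.area_ne_top_of_isCompact_closure (M := M) hΩc
  have hbol := RiemannianSurface.bol_inequality hM hΩ hΩc hu heq hbd hneg
  have hlt := RiemannianSurface.setIntegral_exp_lt_measureReal hΩ.measurableSet
    (hΩ.measure_pos (RiemannianSurface.area M) hΩne) hfin
    (hu.continuousOn.mono subset_closure) hneg
  have hp : ∫ x in Ω, (f x)⁻ ∂(RiemannianSurface.area M) = 2 * Real.pi * Θ := by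
    rw [hΘ]
    field_simp
  rw [hp] at hbol
  refine ⟨hbol.trans_eq (by ring), fun hΘ0 hκ hpos ↦ ?_⟩
  rw [hΘ0, ← hκ] at hbol
  rw [div_le_iff₀ hpos]
  -- For `λ = κ` and `Θ = 0` the inequality is divisible by `μ(Ω) - ∫ e²ᵘ`.
  refine le_of_mul_le_mul_right ?_ (sub_pos.2 hlt)
  linarith

theorem theorem3p2
    {M : Type*} [EMetricSpace M] [SecondCountableTopology M]
    [MeasurableSpace M] [BorelSpace M]
    [ChartedSpace RiemannianSurface.Plane M] [IsManifold (𝓡 2) ∞ M]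
    [RiemannianBundle (fun x : M ↦ TangentSpace (𝓡 2) x)]
    [IsContMDiffRiemannianBundle (𝓡 2) ∞ RiemannianSurface.Plane
      (fun x : M ↦ TangentSpace (𝓡 2) x)]
    [IsRiemannianManifold (𝓡 2) M]
    (θ κ : ℝ) (hθ : 0 < θ) (hθ' : θ ≤ 1)
    (hM : RiemannianSurface.IsoperimetricInequality M θ κ)
    (Ω : Set M) (hΩ : IsOpen Ω) (hΩne : Ω.Nonempty) (hΩc : IsCompact (closure Ω))
    (u f : M → ℝ) (lam Θ : ℝ)
    (hu : ContMDiffOn (𝓡 2) 𝓘(ℝ, ℝ) ∞ u (closure Ω))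
    (heq : ∀ x ∈ Ω, -RiemannianSurface.laplaceBeltrami u x + κ
      = lam * Real.exp (2 * u x) + f x)
    (hbd : ∀ x ∈ frontier Ω, u x = 0)
    (hneg : ∀ x ∈ Ω, u x < 0)
    (hΘ : Θ = 1 / (2 * Real.pi) * ∫ x in Ω, (f x)⁻ ∂(RiemannianSurface.area M)) :
    4 * Real.pi * θ * (RiemannianSurface.area M).real Ω
        - κ * (RiemannianSurface.area M).real Ω ^ 2
      ≤ 4 * Real.pi * (θ + Θ) * (∫ x in Ω, Real.exp (2 * u x) ∂(RiemannianSurface.area M))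
        - lam * (∫ x in Ω, Real.exp (2 * u x) ∂(RiemannianSurface.area M)) ^ 2
    ∧ (Θ = 0 → lam = κ → 0 < lam →
      4 * Real.pi * θ / lam
        ≤ (∫ x in Ω, Real.exp (2 * u x) ∂(RiemannianSurface.area M))
          + (RiemannianSurface.area M).real Ω) := by
  exact theorem3p2_general θ κ hM Ω hΩ hΩne hΩc u f lam Θ hu heq hbd hneg hΘ
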